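/- Let $F$ be a non-archimedean local field with ring of integers $\mathcal O$, uniformizer $\pi$ and residue field of cardinality $q$. Let $G=\mathrm{SL}_2(F)$, $K=\mathrm{SL}_2(\mathcal O)$, and let $I\subset K$ be the Iwahori subgroup of matrices that are upper triangular modulo $\pi$. For $U\in\{I,K\}$ let $C_c^\infty(F^2)^U$ be the space of locally constant, compactly supported functions $f\colon F^2\to\mathbb C$ with $f(g^{-1}x)=f(x)$ for $g\in U$. For $n\in\mathbb Z$ let $\varphi_n$ and $\psi_n$ be the characteristic functions of the $I$-orbits $\pi^n\mathcal O\times\pi^n\mathcal O^\times$ and $\pi^n\mathcal O^\times\times\pi^{n+1}\mathcal O$, and let $\bar\varphi_n=\sum_{k\ge n}(\varphi_k+\psi_k)$ and $\bar\psi_n=\sum_{k\ge n}(\psi_k+\varphi_{k+1})$ on $F^2\setminus\{0\}$, extended to $F^2$ by continuity. Let $\tilde W=\langle s_0,s_1\mid s_0^2=s_1^2=1\rangle$ be the affine Weyl group of $\mathrm{SL}_2$, with $s_0$ and $s_1$ represented in $G$ by $\begin{pmatrix}0&-1\\1&0\end{pmatrix}$ and $\begin{pmatrix}0&\pi^{-1}\\-\pi&0\end{pmatrix}$.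 Let $H$ be its Iwahori–Hecke algebra over $\mathbb Z[q^{1/2},q^{-1/2}]$ ($q$ an indeterminate), with standard basis $T_w$ and Kazhdan–Lusztig bases $C'_w=q^{-\ell(w)/2}\sum_{y\le w}T_y$ and $C_w=(-1)^{\ell(w)}j(C'_w)$, where $j(\sum a_wT_w)=\sum\overline{a_w}(-1)^{\ell(w)}q^{-\ell(w)}T_w$. Write $C_xC_y=\sum_z h_{x,y,z}C_z$, let $a(z)$ be the least integer $n\ge 0$ with $(-q^{1/2})^{n}h_{x,y,z}\in\mathbb Z[q^{1/2}]$ for all $x,y$, and let $\mathcal D=\{1,s_0,s_1\}$ be the set of distinguished involutions. Let $\phi$ be Lusztig's homomorphism to the asymptotic Hecke algebra with basis $(t_w)_{w\in\tilde W}$, $$\phi\Big(\sum_x b_xC_x\Big)=\sum_{z}\ \sum_{x,\ d\in\mathcal D,\ a(d)=a(z)}b_xh_{x,d,z}\,t_z ,$$ extended to the formal sums with $b_x\in\mathbb Z((q^{1/2}))$ and $b_x\to0$ in the $q^{1/2}$-adic topology as $\ell(x)\to\infty$; $j$ extends to a map from the formal sums $\sum_x b_xC'_x$ with $b_x\in\mathbb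 Z((q^{-1/2}))$, $b_x\to0$ in the $q^{-1/2}$-adic topology, to these. For $i=0,1$ there is exactly one formal sum $\sum_x b_xC'_x$ of the latter kind which $\phi\circ j$ sends to $t_{s_i}$; it is again denoted $t_{s_i}$. After specializing $q$ to the cardinality of the residue field and $T_w$ to the characteristic function of $IwI$, it converges pointwise to a function $t_{s_i}\colon G\to\mathbb C$. For every $f\in C_c^\infty(F^2)^I$ and $x\in F^2\setminus\{0\}$ the convolution $$(t_{s_i}\star f)(x)=\sum_{gI\in G/I}t_{s_i}(g)f(g^{-1}x)$$ converges absolutely, and $t_{s_i}\star f$ extends to an element of $C_c^\infty(F^2)^I$; this defines a linear action of $t_{s_i}$ on $C_c^\infty(F^2)^I$. For all $m\in\mathbb Z$: 1. $t_{s_0}\star\bar\varphi_m=\bar\varphi_m$ and $t_{s_0}\star\bar\psi_m=0$; and $t_{s_0}$ acts on $C_c^\infty(F^2)^I$ by a projector onto $C_c^\infty(F^2)^K$. 2. $t_{s_1}\star\bar\psi_m=\bar\psi_m$ and $t_{s_1}\star\bar\varphi_m=0$; and $t_{s_1}$ acts on $C_c^\infty(F^2)^I$ as $\mathrm{id}-t_{s_0}$.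 -/

import Mathlib

namespace AffineSL2

open scoped LaurentPolynomial

/-- The affine Weyl group of `SL₂`: the infinite dihedral group. The translation by `n` times the
positive coroot is `r n`, and the finite reflection is `sr 0`. -/
abbrev AffWeyl : Type := DihedralGroup 0

/-- The Coxeter generators `s₀` (finite) and `s₁` (affine); one has `s₀ s₁ = r 1`. -/
def gen (i : Fin 2) : AffWeyl := if i = 0 then .sr 0 else .sr 1

def wordProd (l : List (Fin 2)) : AffWeyl := (l.map gen).prod

/-- The alternating word `i, 1 - i, i, …` with `n` letters. -/
def altWord : Fin 2 → ℕ → List (Fin 2)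
  | _, 0 => []
  | i, n + 1 => i :: altWord (1 - i) n

/-- The length function (see `wordProd_reducedWord` and `len_wordProd_le`). -/
def len : AffWeyl → ℕ
  | .r n => 2 * Int.natAbs n
  | .sr n => let k : ℤ := n; Int.natAbs (2 * k - 1)

/-- The first letter of the reduced word (junk for the identity). -/
def firstLetter : AffWeyl → Fin 2
  | .r n => let k : ℤ := n; if 0 < k then 0 else 1
  | .sr n => let k : ℤ := n; if k ≤ 0 then 0 else 1

/-- The unique reduced word of an element. -/
def reducedWord (w : AffWeyl) : List (Fin 2) := altWord (firstLetter w) (len w)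

theorem length_altWord (i : Fin 2) (n : ℕ) : (altWord i n).length = n := by
  induction n generalizing i with
  | zero => rfl
  | succ n ih => simp [altWord, ih]

theorem length_reducedWord (w : AffWeyl) : (reducedWord w).length = len w := length_altWord _ _

theorem gen_mul_gen_mul (i : Fin 2) (w : AffWeyl) : gen i * (gen i * w) = w := by
  fin_cases i <;> rcases w with n | n <;> simp [gen]

theorem exists_gen_mul_r (i : Fin 2) (n : ℤ) :
    gen i * .r n = .sr ((i.val : ℤ) + n : ℤ) := by
  fin_cases i <;> rfl

theorem exists_gen_mul_sr (i : Fin 2) (n : ℤ) :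
    gen i * .sr n = .r (n - (i.val : ℤ) : ℤ) := by
  fin_cases i <;> rfl

theorem len_r (n : ℤ) : len (.r n) = 2 * n.natAbs := rfl
theorem len_sr (n : ℤ) : len (.sr n) = (2 * n - 1).natAbs := rfl
theorem firstLetter_r (n : ℤ) : firstLetter (.r n) = if 0 < n then 0 else 1 := rfl
theorem firstLetter_sr (n : ℤ) : firstLetter (.sr n) = if n ≤ 0 then 0 else 1 := rfl

/-- Left multiplication by a generator: the length goes up or down by one, according to the
first letter. -/
theorem len_gen_mul (i : Fin 2) (w : AffWeyl) :
    (len (gen i * w) = len w + 1 ∧ firstLetter (gen i * w) = i ∧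
        (len w = 0 ∨ firstLetter w = 1 - i)) ∨
      (len w = len (gen i * w) + 1 ∧ firstLetter w = i ∧
        (len (gen i * w) = 0 ∨ firstLetter (gen i * w) = 1 - i)) := by
  rcases w with n | n
  · change ℤ at n
    rw [exists_gen_mul_r]
    simp only [len_r, len_sr, firstLetter_r, firstLetter_sr]
    fin_cases i <;> simp <;> omega
  · change ℤ at n
    rw [exists_gen_mul_sr]
    simp only [len_r, len_sr, firstLetter_r, firstLetter_sr]
    fin_cases i <;> simp <;> omega

theorem len_one : len 1 = 0 := rfl

theorem eq_one_of_len {w : AffWeyl} (h : len w = 0) : w = 1 := by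
  rcases w with n | n
  · change ℤ at n
    rw [len_r] at h
    have : n = 0 := by omega
    subst this; rfl
  · change ℤ at n
    rw [len_sr] at h
    omega

theorem altWord_congr {i j : Fin 2} {n : ℕ} (h : n = 0 ∨ i = j) : altWord i n = altWord j n := by
  rcases h with rfl | rfl <;> rfl

theorem reducedWord_gen_mul {i : Fin 2} {w : AffWeyl} (h : len w < len (gen i * w)) :
    reducedWord (gen i * w) = i :: reducedWord w := by
  rcases len_gen_mul i w with ⟨h1, h2, h3⟩ | ⟨h1, -⟩
  · rw [reducedWord, h1, h2, altWord, reducedWord, altWord_congr h3]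
  · omega

theorem wordProd_cons (i : Fin 2) (l : List (Fin 2)) : wordProd (i :: l) = gen i * wordProd l := by
  simp [wordProd]

/-- Induction along reduced words. -/
theorem up_induction {P : AffWeyl → Prop} (h1 : P 1)
    (h2 : ∀ i w, len w < len (gen i * w) → P w → P (gen i * w)) (w : AffWeyl) : P w := by
  induction hn : len w generalizing w with
  | zero => rw [eq_one_of_len hn]; exact h1
  | succ n ih =>
    rcases len_gen_mul (firstLetter w) w with ⟨-, -, h | h⟩ | ⟨h, -⟩
    · omega
    · exfalso; revert h; generalize firstLetter w = j; revert j; decide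
    · have := h2 (firstLetter w) (gen (firstLetter w) * w)
        (by rw [gen_mul_gen_mul]; omega) (ih _ (by omega))
      rwa [gen_mul_gen_mul] at this

theorem wordProd_reducedWord (w : AffWeyl) : wordProd (reducedWord w) = w := by
  induction w using up_induction with
  | h1 => rfl
  | h2 i w h ih => rw [reducedWord_gen_mul h, wordProd_cons, ih]

theorem len_wordProd_le (l : List (Fin 2)) : len (wordProd l) ≤ l.length := by
  induction l with
  | nil => simp [wordProd, len_one]
  | cons i l ih =>
    rw [wordProd_cons, List.length_cons]
    rcases len_gen_mul i (wordProd l) with h | h <;> omega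

/-- The Bruhat interval `{y | y ≤ w}`: products of subwords of the reduced word of `w`. -/
def bruhatIic (w : AffWeyl) : Finset AffWeyl :=
  ((reducedWord w).sublists.map wordProd).toFinset

theorem mem_bruhatIic {w y : AffWeyl} :
    y ∈ bruhatIic w ↔ ∃ l, List.Sublist l (reducedWord w) ∧ wordProd l = y := by
  simp [bruhatIic]

theorem eq_or_len_lt_of_mem {w y : AffWeyl} (h : y ∈ bruhatIic w) : y = w ∨ len y < len w := by
  obtain ⟨l, hl, rfl⟩ := mem_bruhatIic.1 h
  rcases hl.length_le.eq_or_lt with h | h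
  · rw [hl.eq_of_length h, wordProd_reducedWord]; exact Or.inl rfl
  · exact Or.inr ((len_wordProd_le l).trans_lt (by rwa [length_reducedWord] at h))

theorem self_mem_bruhatIic (w : AffWeyl) : w ∈ bruhatIic w :=
  mem_bruhatIic.2 ⟨_, List.Sublist.refl _, wordProd_reducedWord w⟩

theorem altWord_sublist_cons (i j : Fin 2) (n m : ℕ) (h : n < m) :
    List.Sublist (altWord i n) (altWord j m) := by
  induction m generalizing i j n with
  | zero => omega
  | succ m ih =>
    rcases n with _ | n
    · simp [altWord]
    · by_cases hij : i = j
      · subst hij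
        exact (ih _ _ n (by omega)).cons_cons _
      · have : i = 1 - j := by revert i j; decide
        subst this
        rcases m with _ | m
        · omega
        · refine List.Sublist.cons _ ?_
          rcases Nat.lt_or_ge n m with h' | h'
          · exact ih (1 - j) (1 - j) (n + 1) (by omega)
          · have : n = m := by omega
            subst this
            exact List.Sublist.refl _

theorem mem_bruhatIic_iff {w y : AffWeyl} : y ∈ bruhatIic w ↔ y = w ∨ len y < len w := by
  refine ⟨eq_or_len_lt_of_mem, ?_⟩
  rintro (rfl | h)
  · exact self_mem_bruhatIic y
  · exact mem_bruhatIic.2 ⟨reducedWord y, altWord_sublist_cons _ _ _ _ h, wordProd_reducedWord y⟩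

/-! ### The Iwahori-Hecke algebra -/

/-- The Laurent polynomial `q` over `ℤ`, where the variable `T 1` is `q ^ (1/2)`. -/
noncomputable def qq : ℤ[T;T⁻¹] := LaurentPolynomial.T 2

/-- The Iwahori-Hecke algebra over `ℤ[q^(1/2), q^(-1/2)]`, as the free module on the `T_w`; its
product is `heckeMul`. -/
abbrev Hecke : Type := AffWeyl →₀ ℤ[T;T⁻¹]

noncomputable def stdT (w : AffWeyl) : Hecke := Finsupp.single w 1

/-- Left multiplication by `T_s`: `T_s T_w` is `T_{sw}` if `sw > w`, and
`(q - 1) T_w + q T_{sw}` otherwise. -/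
noncomputable def genMul (i : Fin 2) : Module.End ℤ[T;T⁻¹] Hecke :=
  Finsupp.linearCombination _ fun w =>
    if len w < len (gen i * w) then stdT (gen i * w)
    else (qq - 1) • stdT w + qq • stdT (gen i * w)

/-- Left multiplication by `T_w`. -/
noncomputable def stdMul (w : AffWeyl) : Module.End ℤ[T;T⁻¹] Hecke :=
  ((reducedWord w).map genMul).prod

/-- The product of the Iwahori-Hecke algebra. -/
noncomputable def heckeMul : Hecke →ₗ[ℤ[T;T⁻¹]] Hecke →ₗ[ℤ[T;T⁻¹]] Hecke :=
  Finsupp.linearCombination _ stdMul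

theorem genMul_stdT (i : Fin 2) (w : AffWeyl) : genMul i (stdT w) =
    if len w < len (gen i * w) then stdT (gen i * w)
    else (qq - 1) • stdT w + qq • stdT (gen i * w) := by
  simp [genMul, stdT, Finsupp.linearCombination_single]

theorem hecke_ext {M : Type*} [AddCommMonoid M] [Module ℤ[T;T⁻¹] M]
    {f g : Hecke →ₗ[ℤ[T;T⁻¹]] M} (h : ∀ w, f (stdT w) = g (stdT w)) : f = g :=
  Finsupp.lhom_ext' fun w => LinearMap.ext_ring (h w)

theorem genMul_sq (i : Fin 2) : genMul i * genMul i = (qq - 1) • genMul i + qq • 1 := by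
  refine hecke_ext fun w => ?_
  simp only [Module.End.mul_apply, LinearMap.add_apply, LinearMap.smul_apply, Module.End.one_apply]
  rcases len_gen_mul i w with h | h
  · rw [genMul_stdT i w, if_pos (by omega), genMul_stdT, gen_mul_gen_mul, if_neg (by omega)]
  · rw [genMul_stdT i w, if_neg (by omega), map_add, map_smul, map_smul, genMul_stdT i w,
      if_neg (by omega), genMul_stdT i (gen i * w), gen_mul_gen_mul, if_pos (by omega)]

theorem stdMul_gen_mul {i : Fin 2} {w : AffWeyl} (h : len w < len (gen i * w)) :
    stdMul (gen i * w) = genMul i * stdMul w := by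
  simp [stdMul, reducedWord_gen_mul h]

theorem stdMul_one : stdMul 1 = 1 := rfl

theorem heckeMul_stdT (w : AffWeyl) : heckeMul (stdT w) = stdMul w := by
  simp [heckeMul, stdT, Finsupp.linearCombination_single]

theorem heckeMul_genMul (i : Fin 2) (x : Hecke) :
    heckeMul (genMul i x) = genMul i ∘ₗ heckeMul x := by
  suffices h : heckeMul ∘ₗ genMul i =
      LinearMap.lcomp ℤ[T;T⁻¹] _ LinearMap.id ∘ₗ
        (LinearMap.llcomp ℤ[T;T⁻¹] _ _ _ (genMul i)) ∘ₗ heckeMul by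
    exact LinearMap.congr_fun h x
  refine hecke_ext fun w => ?_
  change heckeMul (genMul i (stdT w)) = genMul i ∘ₗ heckeMul (stdT w)
  rw [heckeMul_stdT]
  change _ = genMul i * stdMul w
  rcases len_gen_mul i w with h | h
  · rw [genMul_stdT, if_pos (by omega), heckeMul_stdT, stdMul_gen_mul (by omega)]
  · have h' : stdMul w = genMul i * stdMul (gen i * w) := by
      rw [← stdMul_gen_mul (by rw [gen_mul_gen_mul]; omega), gen_mul_gen_mul]
    rw [genMul_stdT, if_neg (by omega), map_add, map_smul, map_smul, heckeMul_stdT, heckeMul_stdT,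
      h', ← mul_assoc, genMul_sq, add_mul, smul_mul_assoc, smul_mul_assoc, one_mul]

theorem heckeMul_assoc (x y z : Hecke) :
    heckeMul (heckeMul x y) z = heckeMul x (heckeMul y z) := by
  have key : ∀ (w : AffWeyl) (y : Hecke), heckeMul (stdMul w y) = stdMul w ∘ₗ heckeMul y := by
    intro w
    induction w using up_induction with
    | h1 => intro y; rfl
    | h2 i w h ih =>
      intro y
      rw [stdMul_gen_mul h, Module.End.mul_apply, heckeMul_genMul, ih]; rfl
  induction x using Finsupp.induction_linear with
  | zero => simp
  | add f g hf hg => simp [hf, hg]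
  | single w a =>
    have : (Finsupp.single w a : Hecke) = a • stdT w := by simp [stdT]
    rw [this]
    simp only [map_smul, LinearMap.smul_apply, heckeMul_stdT, key]
    rfl

theorem stdMul_stdT_one (w : AffWeyl) : stdMul w (stdT 1) = stdT w := by
  induction w using up_induction with
  | h1 => rfl
  | h2 i w h ih => rw [stdMul_gen_mul h, Module.End.mul_apply, ih, genMul_stdT, if_pos h]

theorem heckeMul_one (x : Hecke) : heckeMul x (stdT 1) = x := by
  suffices h : heckeMul.flip (stdT 1) = LinearMap.id from LinearMap.congr_fun h x
  refine hecke_ext fun w => ?_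
  rw [LinearMap.flip_apply, heckeMul_stdT, stdMul_stdT_one]; rfl

theorem one_heckeMul (x : Hecke) : heckeMul (stdT 1) x = x := by
  rw [heckeMul_stdT]; rfl

theorem stdT_mul_stdT (x y : AffWeyl) (h : len (x * y) = len x + len y) :
    heckeMul (stdT x) (stdT y) = stdT (x * y) := by
  have sub : ∀ x y : AffWeyl, len (x * y) ≤ len x + len y := by
    intro x y
    have := len_wordProd_le (reducedWord x ++ reducedWord y)
    rw [wordProd, List.map_append, List.prod_append, ← wordProd, ← wordProd, wordProd_reducedWord,
      wordProd_reducedWord, List.length_append, length_reducedWord, length_reducedWord] at this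
    exact this
  induction x using up_induction with
  | h1 => simp [one_heckeMul]
  | h2 i x hx ih =>
    have h1 := sub x y
    have h2 := len_gen_mul i x
    have h3 := len_gen_mul i (x * y)
    rw [mul_assoc] at h
    rw [heckeMul_stdT, stdMul_gen_mul hx, Module.End.mul_apply, ← heckeMul_stdT,
      ih (by omega), genMul_stdT, if_pos (by omega), mul_assoc]

theorem stdT_quadratic (i : Fin 2) :
    heckeMul (stdT (gen i) + stdT 1) (stdT (gen i) - qq • stdT 1) = 0 := by
  have h : len (1 : AffWeyl) < len (gen i * 1) := by
    fin_cases i <;> decide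
  have h1 : heckeMul (stdT (gen i)) = genMul i := by
    have := stdMul_gen_mul h
    rw [mul_one] at this
    rw [heckeMul_stdT, this, stdMul_one, mul_one]
  have h2 : genMul i (stdT 1) = stdT (gen i) := by rw [genMul_stdT, if_pos h, mul_one]
  have h3 := LinearMap.congr_fun (genMul_sq i) (stdT 1)
  simp only [Module.End.mul_apply, LinearMap.add_apply, LinearMap.smul_apply, h2,
    Module.End.one_apply] at h3
  rw [map_add, LinearMap.add_apply, h1, one_heckeMul, map_sub, map_smul, h2, h3]
  module


/-! ### The Kazhdan-Lusztig basis -/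

/-- Left multiplication by the inverse of `T_s`. -/
noncomputable def genInv (i : Fin 2) : Module.End ℤ[T;T⁻¹] Hecke :=
  (LaurentPolynomial.T (-2) : ℤ[T;T⁻¹]) • genMul i + (LaurentPolynomial.T (-2) - 1 : ℤ[T;T⁻¹]) • 1

theorem T_mul_qq : (LaurentPolynomial.T (-2) : ℤ[T;T⁻¹]) * qq = 1 := by
  rw [qq, ← LaurentPolynomial.T_add]; rfl

theorem genMul_mul_genInv (i : Fin 2) : genMul i * genInv i = 1 := by
  rw [genInv, mul_add, mul_smul_comm, mul_smul_comm, mul_one, genMul_sq, smul_add, smul_smul,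
    smul_smul, T_mul_qq, mul_sub, T_mul_qq]
  module

theorem genInv_mul_genMul (i : Fin 2) : genInv i * genMul i = 1 := by
  rw [← genMul_mul_genInv i, genInv, add_mul, mul_add]
  simp

theorem genInv_sq (i : Fin 2) : genInv i * genInv i =
    (LaurentPolynomial.T (-2) - 1 : ℤ[T;T⁻¹]) • genInv i +
      (LaurentPolynomial.T (-2) : ℤ[T;T⁻¹]) • 1 := by
  conv_lhs => enter [1]; rw [genInv]
  rw [add_mul, smul_mul_assoc, smul_mul_assoc, genMul_mul_genInv, one_mul, add_comm]

/-- The bar involution of the Hecke algebra: it inverts `q ^ (1/2)` and sends `T_w` to the inverse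
of `T_{w⁻¹}` (see `stdT_inv_mul_bar`). -/
noncomputable def heckeBar : Hecke →+ Hecke :=
  Finsupp.liftAddHom fun w =>
    { toFun := fun a => LaurentPolynomial.invert a • (((reducedWord w).map genInv).prod (stdT 1))
      map_zero' := by simp
      map_add' := by intro a b; rw [map_add, add_smul] }

theorem heckeBar_single (w : AffWeyl) (a : ℤ[T;T⁻¹]) : heckeBar (Finsupp.single w a) =
    LaurentPolynomial.invert a • (((reducedWord w).map genInv).prod (stdT 1)) := by
  simp [heckeBar]

theorem heckeBar_smul (a : ℤ[T;T⁻¹]) (x : Hecke) :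
    heckeBar (a • x) = LaurentPolynomial.invert a • heckeBar x := by
  induction x using Finsupp.induction_linear with
  | zero => simp
  | add f g hf hg => rw [smul_add, map_add, map_add, hf, hg, smul_add]
  | single w b => rw [Finsupp.smul_single, heckeBar_single, heckeBar_single, smul_eq_mul, map_mul,
      smul_smul]

theorem heckeBar_stdT_gen_mul {i : Fin 2} {w : AffWeyl} (h : len w < len (gen i * w)) :
    heckeBar (stdT (gen i * w)) = genInv i (heckeBar (stdT w)) := by
  rw [stdT, stdT, heckeBar_single, heckeBar_single, reducedWord_gen_mul h]
  simp

theorem stdMul_mul (x y : AffWeyl) (h : len (x * y) = len x + len y) :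
    stdMul (x * y) = stdMul x * stdMul y := by
  rw [← heckeMul_stdT, ← stdT_mul_stdT x y h]
  refine LinearMap.ext fun z => ?_
  rw [heckeMul_assoc, heckeMul_stdT, heckeMul_stdT]
  rfl

theorem len_inv (w : AffWeyl) : len w⁻¹ = len w := by
  rcases w with n | n
  · change ℤ at n
    change 2 * Int.natAbs (-n) = 2 * n.natAbs
    rw [Int.natAbs_neg]
  · rfl

theorem gen_inv (i : Fin 2) : (gen i)⁻¹ = gen i := by
  fin_cases i <;> rfl

theorem len_gen (i : Fin 2) : len (gen i) = 1 := by
  fin_cases i <;> rfl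

theorem stdT_inv_mul_bar (w : AffWeyl) : heckeMul (stdT w⁻¹) (heckeBar (stdT w)) = stdT 1 := by
  rw [heckeMul_stdT]
  induction w using up_induction with
  | h1 =>
    rw [inv_one, stdMul_one, stdT, heckeBar_single]
    simp [reducedWord, len_one, altWord, stdT]
  | h2 i w h ih =>
    have h0 := len_gen_mul i w
    have h1 := len_gen i
    have h2 : stdMul (gen i) = genMul i := by
      have := @stdMul_gen_mul i 1 (by rw [mul_one, h1, len_one]; omega)
      rwa [mul_one, stdMul_one, mul_one] at this
    rw [heckeBar_stdT_gen_mul h, mul_inv_rev, gen_inv, stdMul_mul, h2, ← Module.End.mul_apply,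
      mul_assoc, genMul_mul_genInv, mul_one, ih]
    have h3 : w⁻¹ * gen i = (gen i * w)⁻¹ := by rw [mul_inv_rev, gen_inv]
    rw [h3, len_inv, len_inv, h1]
    omega

theorem heckeBar_genMul (i : Fin 2) (x : Hecke) :
    heckeBar (genMul i x) = genInv i (heckeBar x) := by
  have hq : LaurentPolynomial.invert qq = (LaurentPolynomial.T (-2) : ℤ[T;T⁻¹]) := by simp [qq]
  induction x using Finsupp.induction_linear with
  | zero => simp
  | add f g hf hg => simp only [map_add, hf, hg]
  | single w a =>
    have : (Finsupp.single w a : Hecke) = a • stdT w := by simp [stdT]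
    rw [this, map_smul, heckeBar_smul, heckeBar_smul, map_smul]
    congr 1
    rcases len_gen_mul i w with h | h
    · rw [genMul_stdT, if_pos (by omega), heckeBar_stdT_gen_mul (by omega)]
    · have h' : heckeBar (stdT w) = genInv i (heckeBar (stdT (gen i * w))) := by
        rw [← heckeBar_stdT_gen_mul (by rw [gen_mul_gen_mul]; omega), gen_mul_gen_mul]
      rw [genMul_stdT, if_neg (by omega), map_add, heckeBar_smul, heckeBar_smul, map_sub, map_one,
        hq, h', ← Module.End.mul_apply, genInv_sq]
      rfl

/-- The element `C'_w = q ^ (-ℓ(w)/2) ∑_{y ≤ w} T_y` (for the infinite dihedral group all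
Kazhdan-Lusztig polynomials `P_{y,w}` with `y ≤ w` are `1`; see `heckeBar_klPrime`). -/
noncomputable def klPrime (w : AffWeyl) : Hecke :=
  ∑ y ∈ bruhatIic w, (LaurentPolynomial.T (-(len w : ℤ)) : ℤ[T;T⁻¹]) • stdT y

/-- The involution `j (∑ a_w T_w) = ∑ ā_w (-1) ^ ℓ(w) q ^ (-ℓ(w)) T_w`. -/
noncomputable def heckeJ : Hecke →+ Hecke :=
  Finsupp.liftAddHom fun w =>
    { toFun := fun a => (LaurentPolynomial.invert a * ((-1) ^ len w *
        LaurentPolynomial.T (-(2 * len w : ℤ)))) • stdT w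
      map_zero' := by simp
      map_add' := by intro a b; rw [map_add, add_mul, add_smul] }

/-- The Kazhdan-Lusztig element `C_w`, determined by `C'_w = (-1) ^ ℓ(w) j (C_w)`. -/
noncomputable def klC (w : AffWeyl) : Hecke := (-1 : ℤ[T;T⁻¹]) ^ len w • heckeJ (klPrime w)

theorem heckeJ_smul_stdT (w : AffWeyl) (a : ℤ[T;T⁻¹]) : heckeJ (a • stdT w) =
    (LaurentPolynomial.invert a * ((-1) ^ len w * LaurentPolynomial.T (-(2 * len w : ℤ)))) •
      stdT w := by
  simp [heckeJ, stdT]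

theorem klC_eq (w : AffWeyl) : klC w = ∑ y ∈ bruhatIic w,
    ((-1) ^ (len w + len y) * LaurentPolynomial.T (len w - 2 * len y : ℤ) : ℤ[T;T⁻¹]) • stdT y := by
  rw [klC, klPrime, map_sum, Finset.smul_sum]
  refine Finset.sum_congr rfl fun y _ => ?_
  rw [heckeJ_smul_stdT, smul_smul, LaurentPolynomial.invert_T, neg_neg, sub_eq_add_neg,
    LaurentPolynomial.T_add, pow_add]
  congr 1
  ring

/-- The element of length `n` whose reduced word starts with `i`. -/
def altElt (i : Fin 2) (n : ℕ) : AffWeyl := wordProd (altWord i n)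

theorem altElt_succ (i : Fin 2) (n : ℕ) : altElt i (n + 1) = gen i * altElt (1 - i) n := by
  rw [altElt, altWord, wordProd_cons]; rfl

theorem altElt_zero (i : Fin 2) : altElt i 0 = 1 := rfl

theorem len_altElt (i : Fin 2) (n : ℕ) :
    len (altElt i n) = n ∧ (n = 0 ∨ firstLetter (altElt i n) = i) := by
  induction n generalizing i with
  | zero => exact ⟨rfl, Or.inl rfl⟩
  | succ n ih =>
    obtain ⟨h1, h2⟩ := ih (1 - i)
    rw [altElt_succ]
    rcases len_gen_mul i (altElt (1 - i) n) with h | h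
    · exact ⟨by omega, Or.inr h.2.1⟩
    · exfalso
      rcases h2 with h2 | h2
      · omega
      · rw [h.2.1] at h2
        exact absurd h2 (by clear * -; revert i; decide)

theorem eq_altElt (w : AffWeyl) : w = altElt (firstLetter w) (len w) :=
  (wordProd_reducedWord w).symm

theorem altElt_inj {i j : Fin 2} {n : ℕ} (hn : n ≠ 0) (h : altElt i n = altElt j n) : i = j := by
  have h1 := (len_altElt i n).2.resolve_left hn
  have h2 := (len_altElt j n).2.resolve_left hn
  rw [← h1, ← h2, h]

/-- The sum of `T_y` over `y ≤ w`, where `w` has length `n` and starts with `i`. -/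
noncomputable def lowSum (i : Fin 2) (n : ℕ) : Hecke := ∑ y ∈ bruhatIic (altElt i n), stdT y

theorem mem_bruhatIic_altElt {i : Fin 2} {n : ℕ} {y : AffWeyl} :
    y ∈ bruhatIic (altElt i n) ↔ y = altElt i n ∨ len y < n := by
  rw [mem_bruhatIic_iff, (len_altElt i n).1]

theorem bruhatIic_altElt_succ (i : Fin 2) (n : ℕ) : bruhatIic (altElt i (n + 1)) =
    insert (altElt i (n + 1)) (insert (altElt (1 - i) n) (bruhatIic (altElt i n))) := by
  ext y
  simp only [Finset.mem_insert, mem_bruhatIic_altElt]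
  constructor
  · rintro (h | h)
    · exact Or.inl h
    · rcases Nat.lt_succ_iff_lt_or_eq.1 h with h | h
      · exact Or.inr (Or.inr (Or.inr h))
      · have := eq_altElt y
        rw [h] at this
        by_cases hi : firstLetter y = i
        · rw [hi] at this; exact Or.inr (Or.inr (Or.inl this))
        · have : firstLetter y = 1 - i := by
            revert hi; generalize firstLetter y = k; revert k i; decide
          refine Or.inr (Or.inl ?_)
          rw [← this]; assumption
  · rintro (h | h | h | h)
    · exact Or.inl h
    · right; rw [h, (len_altElt _ _).1]; omega
    · right; rw [h, (len_altElt _ _).1]; omega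
    · right; omega

theorem lowSum_succ (i : Fin 2) (n : ℕ) (hn : n ≠ 0) : lowSum i (n + 1) =
    stdT (altElt i (n + 1)) + (stdT (altElt (1 - i) n) + lowSum i n) := by
  rw [lowSum, bruhatIic_altElt_succ i n, Finset.sum_insert, Finset.sum_insert]
  · rfl
  · rw [mem_bruhatIic_altElt, (len_altElt _ _).1]
    rintro (h | h)
    · have := altElt_inj hn h
      exact absurd this (by clear * -; revert i; decide)
    · omega
  · rw [Finset.mem_insert, mem_bruhatIic_altElt, (len_altElt _ _).1]
    rintro (h | h | h)
    · have := congrArg len h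
      rw [(len_altElt _ _).1, (len_altElt _ _).1] at this; omega
    · have := congrArg len h
      rw [(len_altElt _ _).1, (len_altElt _ _).1] at this; omega
    · omega

theorem genMul_altElt (i : Fin 2) (n : ℕ) :
    genMul i (stdT (altElt (1 - i) n)) = stdT (altElt i (n + 1)) := by
  rw [genMul_stdT, ← altElt_succ, (len_altElt _ _).1, (len_altElt _ _).1, if_pos (by omega)]

theorem genMul_altElt' (i : Fin 2) (n : ℕ) : genMul i (stdT (altElt i (n + 1))) =
    (qq - 1) • stdT (altElt i (n + 1)) + qq • stdT (altElt (1 - i) n) := by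
  rw [← genMul_altElt, ← Module.End.mul_apply, genMul_sq]; rfl

theorem lowSum_zero (i : Fin 2) : lowSum i 0 = stdT 1 := by
  have : bruhatIic (altElt i 0) = {1} := by
    ext y; rw [mem_bruhatIic_altElt]; simp [altElt_zero]
  rw [lowSum, this, Finset.sum_singleton]

theorem lowSum_one (i : Fin 2) : lowSum i 1 = stdT (altElt i 1) + stdT 1 := by
  have : bruhatIic (altElt i 1) = {altElt i 1, 1} := by
    ext y
    rw [mem_bruhatIic_altElt]
    simp only [Finset.mem_insert, Finset.mem_singleton, Nat.lt_one_iff]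
    exact or_congr_right ⟨eq_one_of_len, fun h => by rw [h]; rfl⟩
  rw [lowSum, this, Finset.sum_pair]
  intro h
  have := congrArg len h
  rw [(len_altElt _ _).1, len_one] at this; omega

theorem genMul_lowSum (i : Fin 2) (n : ℕ) :
    genMul i (lowSum i (n + 1)) = qq • lowSum i (n + 1) := by
  induction n with
  | zero =>
    rw [lowSum_one, map_add, genMul_altElt']
    have := genMul_altElt i 0
    rw [altElt_zero] at this
    rw [this, altElt_zero]
    module
  | succ n ih =>
    rw [lowSum_succ _ _ (Nat.succ_ne_zero n), map_add, map_add, ih, genMul_altElt', genMul_altElt]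
    module

theorem lowSum_two (i : Fin 2) : lowSum i 2 = genMul i (lowSum (1 - i) 1) + lowSum (1 - i) 1 := by
  have h := genMul_altElt i 0
  rw [altElt_zero] at h
  rw [lowSum_succ i 1 one_ne_zero, lowSum_one, lowSum_one, map_add, genMul_altElt, h]
  module

theorem lowSum_add_three (i : Fin 2) (n : ℕ) : lowSum i (n + 3) =
    genMul i (lowSum (1 - i) (n + 2)) + lowSum (1 - i) (n + 2) - qq • lowSum i (n + 1) := by
  have key : lowSum (1 - i) (n + 2) =
      stdT (altElt (1 - i) (n + 2)) + (stdT (altElt (1 - i) (n + 1)) + lowSum i (n + 1)) := by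
    rcases n with _ | n
    · rw [lowSum_succ (1 - i) 1 one_ne_zero, lowSum_one, lowSum_one, sub_sub_cancel]; abel
    · rw [lowSum_succ (1 - i) (n + 2) (by omega), lowSum_succ (1 - i) (n + 1) (by omega),
        lowSum_succ i (n + 1) (by omega), sub_sub_cancel]
      have : ∀ m, m ≠ 0 → stdT (altElt i m) + lowSum (1 - i) m =
          stdT (altElt (1 - i) m) + lowSum i m := by
        intro m hm
        induction m with
        | zero => exact absurd rfl hm
        | succ m ihm =>
          rcases m with _ | m
          · rw [lowSum_one, lowSum_one]; abel
          · rw [lowSum_succ i (m + 1) (by omega), lowSum_succ (1 - i) (m + 1) (by omega),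
              sub_sub_cancel, ihm (by omega)]
            abel
      rw [this (n + 1) (by omega)]
      abel
  rw [lowSum_succ i (n + 2) (by omega), lowSum_succ i (n + 1) (by omega), key, map_add, map_add,
    genMul_lowSum, genMul_altElt, genMul_altElt]
  module

theorem klPrime_altElt (i : Fin 2) (n : ℕ) :
    klPrime (altElt i n) = (LaurentPolynomial.T (-(n : ℤ)) : ℤ[T;T⁻¹]) • lowSum i n := by
  rw [klPrime, lowSum, Finset.smul_sum, (len_altElt i n).1]

theorem heckeBar_lowSum (i : Fin 2) (n : ℕ) : heckeBar (lowSum i n) =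
    (LaurentPolynomial.T (-(2 * n : ℤ)) : ℤ[T;T⁻¹]) • lowSum i n := by
  have hq : LaurentPolynomial.invert qq = (LaurentPolynomial.T (-2) : ℤ[T;T⁻¹]) := by simp [qq]
  have h1 : heckeBar (stdT 1) = stdT 1 := by
    rw [stdT, heckeBar_single]; simp [reducedWord, len_one, altWord, stdT]
  have hl1 : ∀ i, lowSum i 1 = genMul i (stdT 1) + stdT 1 := by
    intro i
    have h := genMul_altElt i 0
    rw [altElt_zero] at h
    rw [lowSum_one, h]
  have hinv : ∀ x, genInv i x + x =
      (LaurentPolynomial.T (-2) : ℤ[T;T⁻¹]) • (genMul i x + x) := by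
    intro x
    simp only [genInv, LinearMap.add_apply, LinearMap.smul_apply, Module.End.one_apply]
    module
  induction n using Nat.strong_induction_on generalizing i with
  | _ n ih =>
    match n, ih with
    | 0, _ => rw [lowSum_zero, h1]; simp
    | 1, _ =>
      rw [hl1, map_add, heckeBar_genMul, h1, hinv]; norm_num
    | 2, ih =>
      rw [lowSum_two, map_add, heckeBar_genMul, ih 1 (by omega) (1 - i)
        (fun x => by simp only [genInv, LinearMap.add_apply, LinearMap.smul_apply,
          Module.End.one_apply]; module), hinv, map_smul, ← smul_add, smul_smul,
        ← LaurentPolynomial.T_add]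
      norm_num
    | n + 3, ih =>
      rw [lowSum_add_three, map_sub, map_add, heckeBar_smul, heckeBar_genMul,
        ih (n + 2) (by omega) (1 - i) (fun x => by
          simp only [genInv, LinearMap.add_apply, LinearMap.smul_apply,
            Module.End.one_apply]; module), ih (n + 1) (by omega) i hinv, hinv, hq, map_smul,
        ← smul_add, smul_smul, smul_smul, smul_sub, smul_smul, ← LaurentPolynomial.T_add,
        ← LaurentPolynomial.T_add, qq, ← LaurentPolynomial.T_add]
      congr 3 <;> push_cast <;> ring

/-- `C'_w` is invariant under the bar involution, which together with its triangular shape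
characterises the Kazhdan-Lusztig basis. -/
theorem heckeBar_klPrime (w : AffWeyl) : heckeBar (klPrime w) = klPrime w := by
  rw [eq_altElt w, klPrime_altElt, heckeBar_smul, heckeBar_lowSum, smul_smul,
    LaurentPolynomial.invert_T, ← LaurentPolynomial.T_add]
  congr 2
  ring

theorem klC_apply_self (w : AffWeyl) : klC w w = LaurentPolynomial.T (-(len w : ℤ)) := by
  rw [klC_eq, Finsupp.finsetSum_apply, Finset.sum_eq_single w]
  · rw [← two_mul, pow_mul]
    simp only [stdT, Finsupp.smul_single, Finsupp.single_eq_same, smul_eq_mul, mul_one, neg_one_sq,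
      one_pow, one_mul]
    congr 1; ring
  · intro y _ hy; simp [stdT, hy]
  · intro h; exact absurd (self_mem_bruhatIic w) h

theorem klC_apply_ne {w y : AffWeyl} (h : klC w y ≠ 0) : y = w ∨ len y < len w := by
  rw [← mem_bruhatIic_iff]
  contrapose! h
  rw [klC_eq, Finsupp.finsetSum_apply]
  refine Finset.sum_eq_zero fun x hx => ?_
  have : x ≠ y := by rintro rfl; exact h hx
  simp [stdT, this]

theorem klC_linearIndependent : LinearIndependent ℤ[T;T⁻¹] klC := by
  rw [linearIndependent_iff]
  intro l hl
  by_contra hne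
  obtain ⟨w, hw, hmax⟩ := Finset.exists_max_image l.support len
    (Finsupp.support_nonempty_iff.2 hne)
  have h := DFunLike.congr_fun hl w
  rw [Finsupp.linearCombination_apply, Finsupp.sum, Finsupp.finsetSum_apply,
    Finset.sum_eq_single w] at h
  · rw [Finsupp.smul_apply, klC_apply_self, Finsupp.zero_apply, smul_eq_mul] at h
    have hu : IsUnit (LaurentPolynomial.T (-(len w : ℤ)) : ℤ[T;T⁻¹]) := LaurentPolynomial.isUnit_T _
    exact (Finsupp.mem_support_iff.1 hw) ((hu.mul_left_eq_zero).1 h)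
  · intro x hx hxw
    rw [Finsupp.smul_apply, smul_eq_mul]
    by_contra h0
    rcases klC_apply_ne (right_ne_zero_of_mul h0) with h1 | h1
    · exact hxw h1.symm
    · exact absurd (hmax x hx) (by omega)
  · intro h'; exact absurd hw h'

theorem klC_span : ⊤ ≤ Submodule.span ℤ[T;T⁻¹] (Set.range klC) := by
  have key : ∀ n w, len w = n → stdT w ∈ Submodule.span ℤ[T;T⁻¹] (Set.range klC) := by
    intro n
    induction n using Nat.strong_induction_on with
    | _ n ih =>
      intro w hw
      have h1 : klC w ∈ Submodule.span ℤ[T;T⁻¹] (Set.range klC) :=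
        Submodule.subset_span ⟨w, rfl⟩
      rw [klC_eq, ← Finset.sum_erase_add _ _ (self_mem_bruhatIic w)] at h1
      have h2 := (Submodule.add_mem_iff_right _ (Submodule.sum_mem _ fun y hy => ?_)).1 h1
      · rw [← two_mul, pow_mul, neg_one_sq, one_pow, one_mul] at h2
        have h3 := Submodule.smul_mem _
          (LaurentPolynomial.T (len w : ℤ) : ℤ[T;T⁻¹]) h2
        rw [smul_smul, ← LaurentPolynomial.T_add] at h3
        have h4 : (len w : ℤ) + (len w - 2 * len w) = 0 := by ring
        rwa [h4, LaurentPolynomial.T_zero, one_smul] at h3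
      · rw [Finset.mem_erase] at hy
        rcases eq_or_len_lt_of_mem hy.2 with h | h
        · exact absurd h hy.1
        · exact Submodule.smul_mem _ _ (ih _ (by omega) y rfl)
  intro x _
  induction x using Finsupp.induction_linear with
  | zero => exact Submodule.zero_mem _
  | add f g hf hg => exact Submodule.add_mem _ (hf trivial) (hg trivial)
  | single w a =>
    have : (Finsupp.single w a : Hecke) = a • stdT w := by simp [stdT]
    rw [this]
    exact Submodule.smul_mem _ _ (key _ w rfl)

/-- The Kazhdan-Lusztig basis `C_w`. -/
noncomputable def klBasis : Module.Basis AffWeyl ℤ[T;T⁻¹] Hecke :=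
  Module.Basis.mk klC_linearIndependent klC_span

/-- The structure constants: `C_x C_y = ∑_z h_{x,y,z} C_z`. -/
noncomputable def hStruct (x y z : AffWeyl) : ℤ[T;T⁻¹] :=
  klBasis.repr (heckeMul (klC x) (klC y)) z

/-! ### The map to the asymptotic Hecke algebra, on completions -/

/-- Lusztig's function: `a(z)` is the least `n` such that `(-q ^ (1/2)) ^ n h_{x,y,z}` is a
polynomial in `q ^ (1/2)` for all `x, y`. -/
noncomputable def aFun (z : AffWeyl) : ℕ :=
  sInf {n | ∀ x y, ∃ p : Polynomial ℤ,
    (-LaurentPolynomial.T 1 : ℤ[T;T⁻¹]) ^ n * hStruct x y z = Polynomial.toLaurent p}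

/-- The distinguished involutions. -/
def distinguished : Finset AffWeyl := {1, gen 0, gen 1}

/-- The variable of `ℤ((X))` as a unit. -/
noncomputable def seriesX : (LaurentSeries ℤ)ˣ where
  val := HahnSeries.single 1 1
  inv := HahnSeries.single (-1) 1
  val_inv := by simp
  inv_val := by simp

/-- The inclusion `ℤ[q^(1/2), q^(-1/2)] → ℤ((q^(1/2)))`. -/
noncomputable def toSeries : ℤ[T;T⁻¹] →+* LaurentSeries ℤ :=
  LaurentPolynomial.eval₂ (Int.castRingHom _) seriesX

/-- Membership of a family of coefficients in the completion: `b x → 0` as `ℓ(x) → ∞`, in the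
`X`-adic topology. For expansions `∑ b x C_x` and `∑ b x t_x` the variable `X` is `q ^ (1/2)`, and
for expansions `∑ b x C'_x` it is `q ^ (-1/2)`. -/
def InCompletion (b : AffWeyl → LaurentSeries ℤ) : Prop :=
  ∀ N : ℕ, ∃ L : ℕ, ∀ x, L ≤ len x → ∀ k : ℤ, k < N → (b x).coeff k = 0

/-- The involution `j`, from expansions in the `C'_x` (with `X = q ^ (-1/2)`) to expansions in the
`C_x` (with `X = q ^ (1/2)`): as `j (C'_x) = (-1) ^ ℓ(x) C_x`, it sends `∑ b x C'_x` to
`∑ (-1) ^ ℓ(x) (b x)⁻ C_x`, where the bar exchanges `q ^ (-1/2)` and `q ^ (1/2)` and so is the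
identity on series in `X`. -/
noncomputable def jHat (b : AffWeyl → LaurentSeries ℤ) : AffWeyl → LaurentSeries ℤ :=
  fun x => (-1) ^ len x * b x

/-- Lusztig's map `φ : ∑ b_x C_x ↦ ∑ b_x h_{x,d,z} t_z`, the sum being over `x`, `z` and
distinguished involutions `d` with `a(d) = a(z)`. For each `z` only finitely many `x` contribute. -/
noncomputable def phiHat (b : AffWeyl → LaurentSeries ℤ) : AffWeyl → LaurentSeries ℤ :=
  fun z => ∑ᶠ x, ∑ d ∈ distinguished with aFun d = aFun z, b x * toSeries (hStruct x d z)

/-- The basis element `t_w` of the asymptotic Hecke algebra, in its completion. -/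
noncomputable def asympT (w : AffWeyl) : AffWeyl → LaurentSeries ℤ := Pi.single w 1

/-- The element `∑ b x C'_x` of the completed Hecke algebra is `(φ ∘ j)⁻¹ (t_w)`: it is the only
element of the completion with image `t_w`. -/
def IsPreimageOfT (w : AffWeyl) (b : AffWeyl → LaurentSeries ℤ) : Prop :=
  (InCompletion b ∧ phiHat (jHat b) = asympT w) ∧
    ∀ b', InCompletion b' → phiHat (jHat b') = asympT w → b' = b

/-! ### The group, and functions on the plane -/

section LocalField

open ValuativeRel Matrix

/-- The upper triangular Iwahori subgroup of `SL₂(𝒪)`. -/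
def iwahoriIntegral (F : Type*) [Field F] [ValuativeRel F] :
    Subgroup (SpecialLinearGroup (Fin 2) 𝒪[F]) where
  carrier := {g | g.1 1 0 ∈ 𝓂[F]}
  one_mem' := by simp
  mul_mem' := by
    intro a b ha hb
    change (a.1 * b.1) 1 0 ∈ 𝓂[F]
    rw [Matrix.mul_apply, Fin.sum_univ_two]
    exact Ideal.add_mem _ (Ideal.mul_mem_right _ _ ha) (Ideal.mul_mem_left _ _ hb)
  inv_mem' := by
    intro a ha
    change (Matrix.adjugate a.1) 1 0 ∈ 𝓂[F]
    rw [Matrix.adjugate_fin_two]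
    exact neg_mem ha

/-- `K = SL₂(𝒪)` in `SL₂(F)`. -/
noncomputable def maxCompact (F : Type*) [Field F] [ValuativeRel F] : Subgroup (SpecialLinearGroup (Fin 2) F) :=
  (SpecialLinearGroup.map (algebraMap 𝒪[F] F)).range

/-- The Iwahori subgroup `I` of `SL₂(F)`. -/
noncomputable def iwahori (F : Type*) [Field F] [ValuativeRel F] : Subgroup (SpecialLinearGroup (Fin 2) F) :=
  (iwahoriIntegral F).map (SpecialLinearGroup.map (algebraMap 𝒪[F] F))

variable {F : Type*} [Field F] [ValuativeRel F]

/-- Representatives of `s₀` and `s₁` in `SL₂(F)`. -/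
noncomputable def genMatrix {ϖ : 𝒪[F]} (hϖ : Irreducible ϖ) (i : Fin 2) : SpecialLinearGroup (Fin 2) F :=
  if i = 0 then ⟨!![0, -1; 1, 0], by simp [Matrix.det_fin_two]⟩
  else ⟨!![0, (ϖ : F)⁻¹; -ϖ, 0], by
    have : (ϖ : F) ≠ 0 := fun h => hϖ.ne_zero (Subtype.ext h)
    simp [Matrix.det_fin_two, this]⟩

/-- The Iwahori double coset `I w I`. -/
def cell {ϖ : 𝒪[F]} (hϖ : Irreducible ϖ) (w : AffWeyl) : Set (SpecialLinearGroup (Fin 2) F) :=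
  DoubleCoset.doubleCoset ((reducedWord w).map (genMatrix hϖ)).prod (iwahori F) (iwahori F)

/-- `C_c^∞(F²)^U`: locally constant functions with compact support that are invariant
under the subgroup `U`. -/
def schwartz [TopologicalSpace F] (U : Subgroup (SpecialLinearGroup (Fin 2) F)) :
    Submodule ℂ ((Fin 2 → F) → ℂ) where
  carrier := {f | IsLocallyConstant f ∧ HasCompactSupport f ∧
    ∀ g ∈ U, ∀ x, f ((g⁻¹).1 *ᵥ x) = f x}
  zero_mem' := ⟨IsLocallyConstant.const 0, HasCompactSupport.zero, fun _ _ _ => rfl⟩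
  add_mem' := by
    rintro a b ⟨a1, a2, a3⟩ ⟨b1, b2, b3⟩
    exact ⟨a1.add b1, a2.add b2, fun g hg x => by
      simp only [Pi.add_apply, a3 g hg x, b3 g hg x]⟩
  smul_mem' := by
    rintro c a ⟨a1, a2, a3⟩
    exact ⟨a1.comp (fun z => c * z), a2.comp_left (g := fun z => c * z) (mul_zero c), fun g hg x => by
      simp only [Pi.smul_apply, a3 g hg x]⟩

/-- The `I`-orbit whose characteristic function is `φ_n`. -/
def phiOrbit (ϖ : 𝒪[F]) (n : ℤ) : Set (Fin 2 → F) :=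
  {x | ∃ a b : 𝒪[F], IsUnit b ∧ x = ![(ϖ : F) ^ n * a, (ϖ : F) ^ n * b]}

/-- The `I`-orbit whose characteristic function is `ψ_n`. -/
def psiOrbit (ϖ : 𝒪[F]) (n : ℤ) : Set (Fin 2 → F) :=
  {x | ∃ a b : 𝒪[F], IsUnit a ∧ x = ![(ϖ : F) ^ n * a, (ϖ : F) ^ (n + 1) * b]}

/-- The function `∑_{k ≥ n} (φ_k + ψ_k)` on `F² ∖ {0}`, extended to `F²` by continuity. -/
noncomputable def phiBar (ϖ : 𝒪[F]) (n : ℤ) : (Fin 2 → F) → ℂ :=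
  Set.indicator ({0} ∪ ⋃ k ≥ n, (phiOrbit ϖ k ∪ psiOrbit ϖ k)) 1

/-- The function `∑_{k ≥ n} (ψ_k + φ_{k+1})` on `F² ∖ {0}`, extended to `F²` by continuity. -/
noncomputable def psiBar (ϖ : 𝒪[F]) (n : ℤ) : (Fin 2 → F) → ℂ :=
  Set.indicator ({0} ∪ ⋃ k ≥ n, (psiOrbit ϖ k ∪ phiOrbit ϖ (k + 1))) 1

/-- The convolution `(t ⋆ f)(x) = ∫_G t(g) f(g⁻¹ x) dg`, with the Haar measure for which `I` has
volume one, for a function `t` on `I\G/I` and an `I`-invariant function `f`; it is the sum over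
`G/I`. It is a function on `G/N = F² ∖ {0}`, and `h` is an extension of it to `F²`. -/
def IsConvolution (t : SpecialLinearGroup (Fin 2) F → ℂ) (f h : (Fin 2 → F) → ℂ) : Prop :=
  ∀ x, x ≠ 0 → HasSum
    (fun c : SpecialLinearGroup (Fin 2) F ⧸ iwahori F => t c.out * f ((c.out⁻¹).1 *ᵥ x)) (h x)

variable (F) in
/-- The square root of the cardinality of the residue field. -/
noncomputable def sqrtq [TopologicalSpace F] [IsNonarchimedeanLocalField F] : ℂˣ :=
  Units.mk0 (Real.sqrt (Nat.card 𝓀[F]) : ℂ) (by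
    have : 0 < Nat.card 𝓀[F] := Nat.card_pos
    exact Complex.ofReal_ne_zero.2 (Real.sqrt_ne_zero'.2 (by exact_mod_cast this)))

/-- The element `∑ a_w T_w` of the Hecke algebra as a function on `G`, where `q` is specialised to
the cardinality of the residue field and `T_w` is the characteristic function of `I w I`. -/
noncomputable def heckeFun [TopologicalSpace F] [IsNonarchimedeanLocalField F] {ϖ : 𝒪[F]} (hϖ : Irreducible ϖ)
    (x : Hecke) : SpecialLinearGroup (Fin 2) F → ℂ :=
  fun g => x.sum fun w a => LaurentPolynomial.eval₂ (Int.castRingHom ℂ) (sqrtq F) a *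
    Set.indicator (cell hϖ w) 1 g

/-- The function `t` on `G` is the specialisation of the element `∑ b w C'_w` of the completed Hecke
algebra: `b w`, a series in `q ^ (-1/2)`, is evaluated at the cardinality `q` of the residue field,
and the sum over `w` is taken pointwise. Convergence of all these series is part of the claim. -/
def IsSpecialization [TopologicalSpace F] [IsNonarchimedeanLocalField F] {ϖ : 𝒪[F]} (hϖ : Irreducible ϖ)
    (b : AffWeyl → LaurentSeries ℤ) (t : SpecialLinearGroup (Fin 2) F → ℂ) : Prop :=
  ∃ β : AffWeyl → ℂ,
    (∀ w, HasSum (fun k : ℤ => ((b w).coeff k : ℂ) * ((sqrtq F ^ (-k) : ℂˣ) : ℂ)) (β w)) ∧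
    ∀ g, HasSum (fun w => β w * heckeFun hϖ (klPrime w) g) (t g)

end LocalField

end AffineSL2

set_option linter.unusedSectionVars false

namespace AffineSL2

open scoped LaurentPolynomial

/-! ### Multiplication of Kazhdan-Lusztig elements by the simple ones -/

/-! Write v = q^(1/2). In the infinite dihedral group C_x C_s is elementary: it is -(v + v⁻¹) C_x if
x ends in s, and otherwise the sum of the C_z where z arises from x by appending s or by deleting
the last letter, the second term being present only when x has length at least two. Hence a(1) = 0
and a(z) = 1 for all other z. The map φ keeps the coefficient at 1, and on each of the two rays of
words with a fixed first letter it is the difference operator b_n + b_{n+2} - (v + v⁻¹) b_{n+1}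
(`phiHat_altElt`). Its characteristic roots are v and v⁻¹, and the completion admits only v. So the
unique preimage of t_{s_i} has C-coefficients -v^n on the words of length n ≥ 1 that start with s_i,
and zero elsewhere (`phiHat_jHat_tCoeff`, `eq_zero_of_recurrence`).

After undoing j and specializing, the value on IwI is the geometric tail -∑_{n ≥ N} (-1/q)^n, where
N is the least length of an element ≥ w starting with s_i (`isSpecialization_tFun`). Lengthening w
by a letter s_j on the right raises N by one, and so multiplies the value by -1/q, except in the
step from 1 to s_i, where N stays 1 (`tVal_add`).

If f is invariant under I and s_j, its sum over the cosets in I w s_j I is q times its sum over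
those in IwI whenever the length goes up (`orbSum_mul_gen`). Pairing w with w s_j therefore cancels
everything in t_{s_i} ⋆ f except the pair {1, s_j}, which contributes f if i = j and 0 otherwise
(`hasSum_convolution`). The rearrangement is legitimate since t_{s_i} is O(q^(-ℓ(w))) on IwI, while
only O(q^(ℓ(w)/2)) of the cosets gI in IwI have g⁻¹x in the support of f (`summable_convolution`).

Finally, the I-invariant functions are the direct sum of the K-invariant and the s₁-invariant ones
(`isCompl_maxCompactInvariants`). The sum is direct because convolution with t_{s_0} is the identity
on the first and zero on the second. It is everything because the φ̄_m and ψ̄_m are indicators of a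
descending chain of lattices, whose successive differences are the I-orbits. So t_{s_0} is the
projection onto the first summand along the second, and t_{s_1} is the complementary projection. -/

theorem heckeJ_smul (a : ℤ[T;T⁻¹]) (x : Hecke) :
    heckeJ (a • x) = LaurentPolynomial.invert a • heckeJ x := by
  induction x using Finsupp.induction_linear with
  | zero => simp
  | add f g hf hg => rw [smul_add, map_add, map_add, hf, hg, smul_add]
  | single w b =>
    have : (Finsupp.single w b : Hecke) = b • stdT w := by simp [stdT]
    rw [this, smul_smul, heckeJ_smul_stdT, heckeJ_smul_stdT, smul_smul, map_mul, mul_assoc]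

theorem heckeJ_stdT (w : AffWeyl) : heckeJ (stdT w) =
    ((-1) ^ len w * LaurentPolynomial.T (-(2 * len w : ℤ)) : ℤ[T;T⁻¹]) • stdT w := by
  have := heckeJ_smul_stdT w 1
  rwa [one_smul, map_one, one_mul] at this

/-- The eigenvalues of T_s are q and -1, so those of -q⁻¹T_s are -1 and q⁻¹: rescaling by -q⁻¹ turns
the quadratic relation into the one with q inverted. This is what makes j compatible with products
and carries identities for C' over to C. -/
theorem heckeJ_genMul (i : Fin 2) (x : Hecke) : heckeJ (genMul i x) =
    (-LaurentPolynomial.T (-2) : ℤ[T;T⁻¹]) • genMul i (heckeJ x) := by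
  have hq : LaurentPolynomial.invert qq = (LaurentPolynomial.T (-2) : ℤ[T;T⁻¹]) := by simp [qq]
  induction x using Finsupp.induction_linear with
  | zero => simp
  | add f g hf hg => simp only [map_add, hf, hg, smul_add]
  | single w a =>
    have : (Finsupp.single w a : Hecke) = a • stdT w := by simp [stdT]
    rw [this, map_smul, heckeJ_smul, heckeJ_smul, map_smul, smul_comm]
    congr 1
    rw [heckeJ_stdT, map_smul]
    rcases len_gen_mul i w with h | h
    · rw [genMul_stdT, if_pos (by omega), heckeJ_stdT, smul_smul, h.1, pow_succ]
      congr 1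
      rw [show (-(2 * ((len w + 1 : ℕ) : ℤ))) = -2 + -(2 * len w : ℤ) by push_cast; ring,
        LaurentPolynomial.T_add]
      ring
    · rw [genMul_stdT, if_neg (by omega), map_add, heckeJ_smul, heckeJ_smul, map_sub, map_one, hq,
        heckeJ_stdT, heckeJ_stdT, h.1, pow_succ]
      simp only [smul_add, smul_smul]
      rw [show (-(2 * ((len (gen i * w) + 1 : ℕ) : ℤ))) = -2 + -(2 * len (gen i * w) : ℤ) by
        push_cast; ring, LaurentPolynomial.T_add]
      have h2 := T_mul_qq
      generalize (LaurentPolynomial.T (-2) : ℤ[T;T⁻¹]) = A at *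
      generalize (LaurentPolynomial.T (-(2 * len (gen i * w) : ℤ)) : ℤ[T;T⁻¹]) = B at *
      generalize ((-1) ^ len (gen i * w) : ℤ[T;T⁻¹]) = c at *
      generalize qq = Q at *
      congr 2
      · linear_combination (-(c * A * B)) * h2
      · linear_combination (-(c * A * B)) * h2

/-- Left multiplication by `C_s`. -/
noncomputable def cMul (i : Fin 2) : Module.End ℤ[T;T⁻¹] Hecke :=
  (LaurentPolynomial.T (-1) : ℤ[T;T⁻¹]) • genMul i - (LaurentPolynomial.T 1 : ℤ[T;T⁻¹]) • 1

theorem cMul_apply (i : Fin 2) (x : Hecke) : cMul i x =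
    (LaurentPolynomial.T (-1) : ℤ[T;T⁻¹]) • genMul i x -
      (LaurentPolynomial.T 1 : ℤ[T;T⁻¹]) • x := rfl

theorem klC_altElt (i : Fin 2) (n : ℕ) : klC (altElt i n) =
    ((-1) ^ n * LaurentPolynomial.T (n : ℤ) : ℤ[T;T⁻¹]) • heckeJ (lowSum i n) := by
  rw [klC, klPrime_altElt, heckeJ_smul, smul_smul, (len_altElt i n).1, LaurentPolynomial.invert_T,
    neg_neg]

theorem T_add' (m n : ℤ) : (LaurentPolynomial.T m * LaurentPolynomial.T n : ℤ[T;T⁻¹]) =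
    LaurentPolynomial.T (m + n) := (LaurentPolynomial.T_add m n).symm

theorem klC_one : klC 1 = stdT 1 := by
  have := klC_altElt 0 0
  rw [altElt_zero, lowSum_zero, heckeJ_stdT, len_one] at this
  rw [this]
  simp

/-- The sum `v + v⁻¹`, where `v = q ^ (1/2)`. -/
noncomputable def vSum : ℤ[T;T⁻¹] := LaurentPolynomial.T 1 + LaurentPolynomial.T (-1)

/-- The sum of T_y over y ≤ w is a q-eigenvector of T_s when w starts with s. Its image under j is
then a (-1)-eigenvector, on which v⁻¹T_s - v acts by -(v⁻¹ + v). -/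
theorem cMul_self (i : Fin 2) (n : ℕ) :
    cMul i (klC (altElt i (n + 1))) = -vSum • klC (altElt i (n + 1)) := by
  have h : genMul i (heckeJ (lowSum i (n + 1))) = -heckeJ (lowSum i (n + 1)) := by
    have h1 := heckeJ_genMul i (lowSum i (n + 1))
    rw [genMul_lowSum, heckeJ_smul, qq, LaurentPolynomial.invert_T] at h1
    have h2 := congrArg (fun y => (LaurentPolynomial.T 2 : ℤ[T;T⁻¹]) • y) h1
    simp only [smul_smul, mul_neg, T_add'] at h2
    norm_num at h2
    rw [eq_neg_iff_add_eq_zero, add_comm, ← eq_neg_iff_add_eq_zero] at h2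
    exact h2
  rw [klC_altElt, map_smul, smul_comm, cMul_apply, h, vSum]
  module

/-- The element `C_w` for `w` of length `n` with first letter `i`, or zero if `n = 0`. -/
noncomputable def klAlt (i : Fin 2) (n : ℕ) : Hecke := if n = 0 then 0 else klC (altElt i n)

theorem klAlt_zero (i : Fin 2) : klAlt i 0 = 0 := rfl
theorem klAlt_succ (i : Fin 2) (n : ℕ) : klAlt i (n + 1) = klC (altElt i (n + 1)) := rfl

theorem cMul_one (i : Fin 2) : cMul i (klC 1) = klC (gen i) := by
  have h : gen i = altElt i 1 := by rw [altElt_succ, altElt_zero, mul_one]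
  have h2 := genMul_altElt i 0
  rw [altElt_zero] at h2
  rw [h, klC_altElt, lowSum_one, map_add, heckeJ_stdT, heckeJ_stdT, (len_altElt i 1).1, len_one,
    klC_one, cMul_apply, h2]
  have e1 : ((-1) ^ 1 * LaurentPolynomial.T ((1 : ℕ) : ℤ) *
      ((-1) ^ 1 * LaurentPolynomial.T (-(2 * ((1 : ℕ) : ℤ)))) : ℤ[T;T⁻¹]) =
      LaurentPolynomial.T (-1) := by
    rw [pow_one, mul_mul_mul_comm, T_add', neg_one_mul, neg_neg, one_mul]; rfl
  have e2 : ((-1) ^ 1 * LaurentPolynomial.T ((1 : ℕ) : ℤ) *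
      ((-1) ^ 0 * LaurentPolynomial.T (-(2 * ((0 : ℕ) : ℤ)))) : ℤ[T;T⁻¹]) =
      -LaurentPolynomial.T 1 := by
    rw [pow_one, mul_mul_mul_comm, T_add', pow_zero, mul_one, neg_one_mul]; rfl
  rw [smul_add, smul_smul, smul_smul, e1, e2, neg_smul, sub_eq_add_neg]

/-- This is the image under j of the recursions `lowSum_two` and `lowSum_add_three`. The convention
`klAlt i 0 = 0` matters: shortening a one-letter word does not produce C_1. -/
theorem cMul_other (i : Fin 2) (n : ℕ) :
    cMul i (klAlt (1 - i) (n + 1)) = klAlt i (n + 2) + klAlt i n := by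
  rcases n with _ | n
  · rw [klAlt_zero, add_zero, klAlt_succ, klAlt_succ, klC_altElt, klC_altElt, lowSum_two, map_add,
      heckeJ_genMul, map_smul, cMul_apply]
    simp only [smul_add, smul_sub, smul_smul, mul_neg, mul_assoc, T_add']
    norm_num
  · rw [klAlt_succ, klAlt_succ, klAlt_succ, klC_altElt, klC_altElt, klC_altElt, lowSum_add_three,
      map_sub, map_add, heckeJ_genMul, map_smul, cMul_apply, heckeJ_smul, qq,
      LaurentPolynomial.invert_T]
    simp only [smul_add, smul_sub, smul_smul, mul_neg, mul_assoc, T_add', pow_succ]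
    push_cast
    rw [show (n : ℤ) + 2 + 1 + -2 = n + 1 by ring, show (n : ℤ) + 2 + 1 = n + 1 + 1 + 1 by ring,
      show (n : ℤ) + 1 + 1 + -1 = n + 1 by ring]
    module

theorem heckeMul_klC_gen (i : Fin 2) : heckeMul (klC (gen i)) = cMul i := by
  have h2 := genMul_altElt i 0
  rw [altElt_zero] at h2
  rw [← cMul_one, cMul_apply, map_sub, map_smul, map_smul, klC_one, heckeMul_genMul,
    heckeMul_stdT, stdMul_one]
  rfl

/-! ### The anti-involution -/

/-- The anti-involution `T_w ↦ T_{w⁻¹}`. -/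
noncomputable def heckeInv : Hecke →ₗ[ℤ[T;T⁻¹]] Hecke :=
  Finsupp.linearCombination _ fun w => stdT w⁻¹

theorem heckeInv_stdT (w : AffWeyl) : heckeInv (stdT w) = stdT w⁻¹ := by
  simp [heckeInv, stdT, Finsupp.linearCombination_single]

theorem heckeInv_heckeInv (x : Hecke) : heckeInv (heckeInv x) = x := by
  suffices h : heckeInv ∘ₗ heckeInv = LinearMap.id from LinearMap.congr_fun h x
  refine hecke_ext fun w => ?_
  rw [LinearMap.comp_apply, heckeInv_stdT, heckeInv_stdT, inv_inv]; rfl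

theorem stdT_mul_gen {w : AffWeyl} {i : Fin 2} (h : len (w * gen i) = len w + 1) :
    heckeMul (stdT w) (stdT (gen i)) = stdT (w * gen i) :=
  stdT_mul_stdT _ _ (by rw [h, len_gen])

theorem heckeMul_gen (i : Fin 2) : heckeMul (stdT (gen i)) = genMul i := by
  have h := genMul_altElt i 0
  rw [altElt_zero] at h
  have h2 : gen i = altElt i 1 := by rw [altElt_succ, altElt_zero, mul_one]
  rw [h2, ← h, heckeMul_genMul, heckeMul_stdT, stdMul_one]; rfl

theorem gen_mul_gen (i : Fin 2) : gen i * gen i = 1 := by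
  have := gen_mul_gen_mul i 1
  rwa [mul_one] at this

theorem heckeInv_genMul (i : Fin 2) (x : Hecke) :
    heckeInv (genMul i x) = heckeMul (heckeInv x) (stdT (gen i)) := by
  suffices h : heckeInv ∘ₗ genMul i = heckeMul.flip (stdT (gen i)) ∘ₗ heckeInv from
    LinearMap.congr_fun h x
  refine hecke_ext fun w => ?_
  rw [LinearMap.comp_apply, LinearMap.comp_apply, LinearMap.flip_apply, heckeInv_stdT, genMul_stdT]
  have hw : (gen i * w)⁻¹ = w⁻¹ * gen i := by rw [mul_inv_rev, gen_inv]
  have h1 := len_inv w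
  have h2 := len_inv (gen i * w)
  rw [hw] at h2
  rcases len_gen_mul i w with h | h
  · rw [if_pos (by omega), heckeInv_stdT, hw, stdT_mul_gen (by omega)]
  · have h3 : w⁻¹ * gen i * gen i = w⁻¹ := by rw [mul_assoc, gen_mul_gen, mul_one]
    have h4 := stdT_mul_gen (w := w⁻¹ * gen i) (i := i) (by rw [h3]; omega)
    have h5 : genMul i (stdT (gen i)) = (qq - 1) • stdT (gen i) + qq • stdT 1 := by
      rw [genMul_stdT, gen_mul_gen, len_one, len_gen, if_neg (by omega)]
    rw [h3] at h4
    rw [if_neg (by omega), map_add, map_smul, map_smul, heckeInv_stdT, heckeInv_stdT, hw, ← h4,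
      heckeMul_assoc, heckeMul_gen, h5, map_add, map_smul, map_smul, heckeMul_one]

theorem heckeInv_klC (w : AffWeyl) : heckeInv (klC w) = klC w⁻¹ := by
  rw [klC_eq, klC_eq, map_sum]
  refine Finset.sum_nbij' (fun y => y⁻¹) (fun y => y⁻¹) ?_ ?_ ?_ ?_ ?_
  · intro y hy
    rw [mem_bruhatIic_iff] at hy ⊢
    rwa [inv_inj, len_inv, len_inv]
  · intro y hy
    rw [mem_bruhatIic_iff] at hy ⊢
    rwa [inv_eq_iff_eq_inv, len_inv, ← len_inv w]
  · intro y _; exact inv_inv y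
  · intro y _; exact inv_inv y
  · intro y _
    rw [map_smul, heckeInv_stdT, len_inv, len_inv]

/-- The definition of φ has the distinguished involution as right factor, so the left multiplication
rules are transported through the anti-involution. -/
theorem heckeMul_klC_gen_right (i : Fin 2) (x : Hecke) :
    heckeMul x (klC (gen i)) = heckeInv (cMul i (heckeInv x)) := by
  have h2 := genMul_altElt i 0
  have h3 : gen i = altElt i 1 := by rw [altElt_succ, altElt_zero, mul_one]
  rw [altElt_zero] at h2
  rw [cMul_apply, map_sub, map_smul, map_smul, heckeInv_genMul, heckeInv_heckeInv, ← cMul_one,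
    cMul_apply, klC_one, h2, ← h3, map_sub, map_smul, map_smul, heckeMul_one]

/-- The element of length `n` whose reduced word ends with `i`. -/
def revElt (i : Fin 2) (n : ℕ) : AffWeyl := (altElt i n)⁻¹

theorem klC_revElt_mul_self (i : Fin 2) (n : ℕ) :
    heckeMul (klC (revElt i (n + 1))) (klC (gen i)) = -vSum • klC (revElt i (n + 1)) := by
  rw [heckeMul_klC_gen_right, heckeInv_klC, revElt, inv_inv, cMul_self, map_smul, heckeInv_klC]

/-- The element `C_w` for `w` of length `n` with last letter `i`, or zero if `n = 0`. -/
noncomputable def klRev (i : Fin 2) (n : ℕ) : Hecke := if n = 0 then 0 else klC (revElt i n)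

theorem klRev_succ (i : Fin 2) (n : ℕ) : klRev i (n + 1) = klC (revElt i (n + 1)) := rfl

theorem heckeInv_klAlt (i : Fin 2) (n : ℕ) : heckeInv (klAlt i n) = klRev i n := by
  rcases n with _ | n
  · exact map_zero _
  · rw [klAlt_succ, heckeInv_klC]; rfl

theorem klC_revElt_mul_other (i : Fin 2) (n : ℕ) :
    heckeMul (klC (revElt (1 - i) (n + 1))) (klC (gen i)) = klRev i (n + 2) + klRev i n := by
  rw [heckeMul_klC_gen_right, heckeInv_klC, revElt, inv_inv, ← klAlt_succ, cMul_other, map_add,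
    heckeInv_klAlt, heckeInv_klAlt]

theorem klC_one_mul (x : Hecke) : heckeMul (klC 1) x = x := by
  rw [klC_one, one_heckeMul]

theorem mul_klC_one (x : Hecke) : heckeMul x (klC 1) = x := by
  rw [klC_one, heckeMul_one]

/-! ### Structure constants and the `a`-function -/

theorem repr_klC (w : AffWeyl) : klBasis.repr (klC w) = Finsupp.single w 1 := by
  have h : klBasis w = klC w := by simp [klBasis]
  rw [← h, Module.Basis.repr_self]

theorem revElt_zero (i : Fin 2) : revElt i 0 = 1 := by rw [revElt, altElt_zero, inv_one]

theorem len_revElt (i : Fin 2) (n : ℕ) : len (revElt i n) = n := by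
  rw [revElt, len_inv, (len_altElt i n).1]

theorem eq_or_eq_one_sub (i j : Fin 2) : i = j ∨ i = 1 - j := by
  revert i j; decide

theorem one_sub_ne (i : Fin 2) : 1 - i ≠ i := by
  revert i; decide

theorem revElt_inj {i j : Fin 2} {m n : ℕ} :
    revElt i m = revElt j n ↔ m = n ∧ (m = 0 ∨ i = j) := by
  constructor
  · intro h
    have h1 := congrArg len h
    rw [len_revElt, len_revElt] at h1
    subst h1
    refine ⟨rfl, ?_⟩
    by_cases h0 : m = 0
    · exact Or.inl h0
    · exact Or.inr (altElt_inj h0 (inv_injective h))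
  · rintro ⟨rfl, rfl | rfl⟩
    · rw [revElt_zero, revElt_zero]
    · rfl

theorem exists_revElt (x : AffWeyl) : ∃ i, x = revElt i (len x) := by
  refine ⟨firstLetter x⁻¹, ?_⟩
  have := eq_altElt x⁻¹
  rw [len_inv] at this
  rw [revElt, ← this, inv_inv]

/-- The dichotomy between x s_i < x and x s_i > x. The identity belongs to the second case, with m =
0. -/
theorem revElt_cases (i : Fin 2) (x : AffWeyl) :
    (∃ m, x = revElt i (m + 1)) ∨ ∃ m, x = revElt (1 - i) m := by
  obtain ⟨j, hj⟩ := exists_revElt x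
  rcases eq_or_eq_one_sub j i with rfl | rfl
  · rcases h : len x with _ | m
    · rw [h, revElt_zero] at hj
      exact Or.inr ⟨0, by rw [revElt_zero, hj]⟩
    · exact Or.inl ⟨m, by rw [hj, h]⟩
  · exact Or.inr ⟨_, hj⟩

theorem gen_eq_revElt (i : Fin 2) : gen i = revElt i 1 := by
  rw [revElt, altElt_succ, altElt_zero, mul_one, gen_inv]

theorem revElt_succ (i : Fin 2) (n : ℕ) : revElt i (n + 1) = revElt (1 - i) n * gen i := by
  rw [revElt, altElt_succ, mul_inv_rev, gen_inv]; rfl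

/-- The last letter of the word `altWord j n`, for `n > 0`. -/
def endLetter (j : Fin 2) : ℕ → Fin 2
  -- This value makes the letter for length one equal to j.
  | 0 => 1 - j
  | n + 1 => 1 - endLetter j n

theorem endLetter_one_sub (j : Fin 2) (n : ℕ) : endLetter (1 - j) n = 1 - endLetter j n := by
  induction n with
  | zero => rfl
  | succ n ih => rw [endLetter, ih]; rfl

theorem altElt_succ_right (j : Fin 2) (n : ℕ) :
    altElt j (n + 1) = altElt j n * gen (endLetter j (n + 1)) := by
  induction n generalizing j with
  | zero => rw [altElt_succ, altElt_zero, altElt_zero, endLetter, endLetter, sub_sub_cancel,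
      mul_one, one_mul]
  | succ n ih =>
    rw [altElt_succ, ih, endLetter_one_sub, ← mul_assoc, ← altElt_succ]; rfl

/-- Right multiplication sees last letters, while the recurrence for φ runs along words with a
common first letter; this translates between the two labellings. -/
theorem altElt_eq_revElt (j : Fin 2) (n : ℕ) : altElt j n = revElt (endLetter j n) n := by
  induction n with
  | zero => rw [revElt_zero]; rfl
  | succ n ih => rw [altElt_succ_right, ih, revElt_succ, endLetter, sub_sub_cancel]

theorem klRev_repr (i : Fin 2) (n : ℕ) (z : AffWeyl) :
    klBasis.repr (klRev i n) z = if n ≠ 0 ∧ revElt i n = z then 1 else 0 := by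
  rcases n with _ | n
  · simp [klRev]
  · rw [klRev_succ, repr_klC, Finsupp.single_apply]; simp

theorem hStruct_self (i : Fin 2) (m : ℕ) (z : AffWeyl) :
    hStruct (revElt i (m + 1)) (gen i) z = if revElt i (m + 1) = z then -vSum else 0 := by
  rw [hStruct, klC_revElt_mul_self, map_smul, repr_klC, Finsupp.smul_apply, Finsupp.single_apply]
  simp

theorem hStruct_other (i : Fin 2) (m : ℕ) (z : AffWeyl) :
    hStruct (revElt (1 - i) m) (gen i) z = (if revElt i (m + 1) = z then 1 else 0) +
      if 1 < m ∧ revElt i (m - 1) = z then 1 else 0 := by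
  rcases m with _ | m
  · rw [hStruct, revElt_zero, klC_one_mul, repr_klC, Finsupp.single_apply, gen_eq_revElt]; simp
  · rw [hStruct, klC_revElt_mul_other, map_add, Finsupp.add_apply, klRev_repr, klRev_repr]
    simp [Nat.pos_iff_ne_zero]

/-- Every C_z occurring in C_x C_s has z ending in s, so for each z ≠ 1 only one of the two
involutions s₀, s₁ contributes to φ. -/
theorem hStruct_gen_ne (i : Fin 2) (n : ℕ) (x : AffWeyl) :
    hStruct x (gen (1 - i)) (revElt i (n + 1)) = 0 := by
  have h := one_sub_ne i
  rcases revElt_cases (1 - i) x with ⟨m, rfl⟩ | ⟨m, rfl⟩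
  · rw [hStruct_self, if_neg]
    rw [revElt_inj]; simp [h]
  · rw [hStruct_other, if_neg, if_neg, add_zero]
    · rw [revElt_inj]; simp [h]; omega
    · rw [revElt_inj]; simp [h]

theorem hStruct_gen_eq (i : Fin 2) (n : ℕ) (x : AffWeyl) :
    hStruct x (gen i) (revElt i (n + 1)) = if x = revElt i (n + 1) then -vSum else
      if x = revElt (1 - i) n ∨ x = revElt (1 - i) (n + 2) then 1 else 0 := by
  have h := one_sub_ne i
  rcases revElt_cases i x with ⟨m, rfl⟩ | ⟨m, rfl⟩
  · rw [hStruct_self]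
    split_ifs with h1 h2
    · rfl
    · rw [revElt_inj, revElt_inj] at h2; simp [h.symm] at h2
    · rfl
  · rw [hStruct_other]
    simp only [revElt_inj, h, or_false, or_true, and_true]
    have h1 : ¬ (m = n + 1 ∧ m = 0) := by omega
    rw [if_neg h1]
    by_cases h2 : m = n
    · subst h2
      simp
    · have h3 : (1 < m ∧ m - 1 = n + 1) ↔ m = n + 2 := by omega
      rw [if_congr h3 rfl rfl]
      simp [h2]

theorem eq_one_or_revElt (z : AffWeyl) : z = 1 ∨ ∃ i n, z = revElt i (n + 1) := by
  obtain ⟨i, hi⟩ := exists_revElt z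
  rcases h : len z with _ | n
  · exact Or.inl (eq_one_of_len h)
  · exact Or.inr ⟨i, n, by rw [hi, h]⟩

/-- The elements whose coefficients in the Kazhdan-Lusztig basis become polynomials in `q ^ (1/2)`
when multiplied by its `n`-th power, and whose coefficient at the identity vanishes. -/
noncomputable def regular (n : ℕ) : AddSubgroup Hecke where
  carrier := {h | klBasis.repr h 1 = 0 ∧ ∀ z, ∃ p : Polynomial ℤ,
    (-LaurentPolynomial.T 1 : ℤ[T;T⁻¹]) ^ n * klBasis.repr h z = Polynomial.toLaurent p}
  zero_mem' := ⟨by simp, fun z => ⟨0, by simp⟩⟩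
  add_mem' := by
    rintro a b ⟨ha, ha'⟩ ⟨hb, hb'⟩
    refine ⟨by simp [ha, hb], fun z => ?_⟩
    obtain ⟨p, hp⟩ := ha' z
    obtain ⟨r, hr⟩ := hb' z
    exact ⟨p + r, by rw [map_add, map_add, Finsupp.add_apply, mul_add, hp, hr]⟩
  neg_mem' := by
    rintro a ⟨ha, ha'⟩
    refine ⟨by simp [ha], fun z => ?_⟩
    obtain ⟨p, hp⟩ := ha' z
    exact ⟨-p, by rw [map_neg, map_neg, Finsupp.neg_apply, mul_neg, hp]⟩

theorem mem_regular {n : ℕ} {h : Hecke} : h ∈ regular n ↔ klBasis.repr h 1 = 0 ∧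
    ∀ z, ∃ p : Polynomial ℤ,
      (-LaurentPolynomial.T 1 : ℤ[T;T⁻¹]) ^ n * klBasis.repr h z = Polynomial.toLaurent p := Iff.rfl

theorem regular_zero_le_one : regular 0 ≤ regular 1 := by
  intro h hh
  rw [mem_regular] at hh ⊢
  refine ⟨hh.1, fun z => ?_⟩
  obtain ⟨p, hp⟩ := hh.2 z
  rw [pow_zero, one_mul] at hp
  exact ⟨-Polynomial.X * p, by rw [hp, map_mul, map_neg, Polynomial.toLaurent_X, pow_one]⟩

theorem vSum_smul_mem_regular {h : Hecke} (hh : h ∈ regular 0) : -vSum • h ∈ regular 1 := by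
  rw [mem_regular] at hh ⊢
  refine ⟨by rw [map_smul, Finsupp.smul_apply, hh.1, smul_zero], fun z => ?_⟩
  obtain ⟨p, hp⟩ := hh.2 z
  rw [pow_zero, one_mul] at hp
  -- Because (-v) · (-(v + v⁻¹)) = v² + 1.
  refine ⟨(Polynomial.X ^ 2 + 1) * p, ?_⟩
  rw [map_smul, Finsupp.smul_apply, hp, map_mul, map_add, map_pow, Polynomial.toLaurent_X, map_one,
    pow_one, smul_eq_mul, ← mul_assoc, vSum]
  congr 1
  have : (LaurentPolynomial.T 1 * LaurentPolynomial.T (-1) : ℤ[T;T⁻¹]) = 1 := by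
    rw [T_add']; exact LaurentPolynomial.T_zero
  linear_combination this

theorem klC_mem_regular {w : AffWeyl} (hw : w ≠ 1) : klC w ∈ regular 0 := by
  rw [mem_regular]
  refine ⟨by rw [repr_klC, Finsupp.single_apply, if_neg hw], fun z => ?_⟩
  rw [repr_klC, Finsupp.single_apply, pow_zero, one_mul]
  split_ifs
  · exact ⟨1, (map_one _).symm⟩
  · exact ⟨0, (map_zero _).symm⟩

theorem ne_one_of_len_succ {w : AffWeyl} {n : ℕ} (h : len w = n + 1) : w ≠ 1 := by
  rintro rfl
  rw [len_one] at h; omega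

theorem klRev_mem_regular (i : Fin 2) (n : ℕ) : klRev i n ∈ regular 0 := by
  rcases n with _ | n
  · exact zero_mem _
  · exact klC_mem_regular (ne_one_of_len_succ (len_revElt i (n + 1)))

theorem gen_ne_one (i : Fin 2) : gen i ≠ 1 := ne_one_of_len_succ (len_gen i)

theorem klC_altElt_add_two (j : Fin 2) (n : ℕ) : klC (altElt j (n + 2)) =
    heckeMul (klC (gen j)) (klC (altElt (1 - j) (n + 1))) - klAlt j n := by
  rw [heckeMul_klC_gen, ← klAlt_succ (1 - j) n, cMul_other, add_sub_cancel_right, klAlt_succ]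

/-- Expand C_y = C_s C_{y'} - C_{y''} and move C_s onto C_x. If x does not end in s, no factor v +
v⁻¹ appears, and the new left factors end in s while y' starts with the other letter, so the
situation repeats. If x ends in s, one factor v + v⁻¹ appears and the remaining product is of the
first kind. Thus a pole of order at most one arises, and both claims must be proved together. -/
theorem mul_klC_altElt_mem_regular (n : ℕ) (j : Fin 2) :
    (∀ m, heckeMul (klC (revElt (1 - j) m)) (klC (altElt j (n + 1))) ∈ regular 0) ∧
      ∀ x, heckeMul (klC x) (klC (altElt j (n + 1))) ∈ regular 1 := by
  induction n using Nat.strong_induction_on generalizing j with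
  | _ n ih =>
    have key : ∀ m, heckeMul (klC (revElt (1 - j) m)) (klC (altElt j (n + 1))) ∈ regular 0 := by
      intro m
      rcases m with _ | m
      · rw [revElt_zero, klC_one_mul]
        exact klC_mem_regular (ne_one_of_len_succ (len_altElt j (n + 1)).1)
      rcases n with _ | n
      · rw [altElt_succ, altElt_zero, mul_one, klC_revElt_mul_other]
        exact add_mem (klRev_mem_regular _ _) (klRev_mem_regular _ _)
      · rw [klC_altElt_add_two, map_sub, ← heckeMul_assoc, klC_revElt_mul_other, map_add, LinearMap.add_apply]
        have h2 : ∀ k, heckeMul (klRev j k) (klC (altElt (1 - j) (n + 1))) ∈ regular 0 := by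
          intro k
          rcases k with _ | k
          · simp only [klRev, if_true, map_zero, LinearMap.zero_apply, zero_mem]
          · have := (ih n (by omega) (1 - j)).1 (k + 1)
            rwa [sub_sub_cancel] at this
        refine sub_mem (add_mem (h2 _) (h2 _)) ?_
        rcases n with _ | n
        · simp only [klAlt, if_true, map_zero, zero_mem]
        · exact (ih n (by omega) j).1 _
    refine ⟨key, fun x => ?_⟩
    rcases revElt_cases j x with ⟨m, rfl⟩ | ⟨m, rfl⟩
    · rcases n with _ | n
      · rw [altElt_succ, altElt_zero, mul_one, klC_revElt_mul_self]
        exact vSum_smul_mem_regular (klC_mem_regular (ne_one_of_len_succ (len_revElt _ _)))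
      · rw [klC_altElt_add_two, map_sub, ← heckeMul_assoc, klC_revElt_mul_self, map_smul, LinearMap.smul_apply]
        refine sub_mem (vSum_smul_mem_regular ?_) ?_
        · have := (ih n (by omega) (1 - j)).1 (m + 1)
          rwa [sub_sub_cancel] at this
        · rcases n with _ | n
          · simp only [klAlt, if_true, map_zero, zero_mem]
          · exact (ih n (by omega) j).2 _
    · exact regular_zero_le_one (key m)

theorem mul_klC_mem_regular (x : AffWeyl) {y : AffWeyl} (hy : y ≠ 1) :
    heckeMul (klC x) (klC y) ∈ regular 1 := by
  have h := eq_altElt y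
  rcases hl : len y with _ | n
  · exact absurd (eq_one_of_len hl) hy
  · rw [h, hl]
    exact (mul_klC_altElt_mem_regular n _).2 x

/-- For y ≠ 1 no product C_x C_y involves C_1, and for y = 1 the structure constants are 0 or 1. -/
theorem aFun_one : aFun 1 = 0 := by
  rw [aFun, Nat.sInf_eq_zero]
  left
  intro x y
  rw [pow_zero, one_mul, hStruct]
  by_cases hy : y = 1
  · subst hy
    rw [mul_klC_one, repr_klC, Finsupp.single_apply]
    split_ifs
    · exact ⟨1, (map_one _).symm⟩
    · exact ⟨0, (map_zero _).symm⟩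
  · exact ⟨0, by rw [(mem_regular.1 (mul_klC_mem_regular x hy)).1, map_zero]⟩

/-- Otherwise v⁻¹ would be a polynomial in v; multiplying by v and comparing constant terms gives 1
= 0. -/
theorem vSum_ne_toLaurent (p : Polynomial ℤ) : -vSum ≠ Polynomial.toLaurent p := by
  intro h
  have h2 : (LaurentPolynomial.T (-1) : ℤ[T;T⁻¹]) =
      Polynomial.toLaurent (-Polynomial.X - p) := by
    rw [map_sub, map_neg, ← h, Polynomial.toLaurent_X, vSum]; ring
  have h3 : (1 : ℤ[T;T⁻¹]) = Polynomial.toLaurent (Polynomial.X * (-Polynomial.X - p)) := by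
    rw [map_mul, ← h2, Polynomial.toLaurent_X, T_add']
    exact LaurentPolynomial.T_zero.symm
  rw [← map_one Polynomial.toLaurent] at h3
  have h4 := congrArg (Polynomial.coeff · 0) (Polynomial.toLaurent_injective h3)
  simp at h4

/-- The bound from above is `mul_klC_mem_regular`. It is attained by h_{z,s,z} = -(v + v⁻¹), where s
is the last letter of z. -/
theorem aFun_ne_one {z : AffWeyl} (hz : z ≠ 1) : aFun z = 1 := by
  have h1 : 1 ∈ {n | ∀ x y, ∃ p : Polynomial ℤ,
      (-LaurentPolynomial.T 1 : ℤ[T;T⁻¹]) ^ n * hStruct x y z = Polynomial.toLaurent p} := by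
    intro x y
    by_cases hy : y = 1
    · subst hy
      refine ⟨-Polynomial.X * if x = z then 1 else 0, ?_⟩
      rw [hStruct, mul_klC_one, repr_klC, Finsupp.single_apply, pow_one, map_mul, map_neg,
        Polynomial.toLaurent_X]
      split_ifs <;> simp
    · exact (mem_regular.1 (mul_klC_mem_regular x hy)).2 z
  refine le_antisymm (Nat.sInf_le h1) (Nat.one_le_iff_ne_zero.2 fun h0 => ?_)
  rw [aFun, Nat.sInf_eq_zero] at h0
  rcases h0 with h0 | h0
  · obtain rfl | ⟨i, n, rfl⟩ := eq_one_or_revElt z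
    · exact hz rfl
    · obtain ⟨p, hp⟩ := h0 (revElt i (n + 1)) (gen i)
      rw [pow_zero, one_mul, hStruct_self, if_pos rfl] at hp
      exact vSum_ne_toLaurent p hp
  · rw [h0] at h1; exact h1

/-! ### The preimages of `t_{s₀}` and `t_{s₁}` -/

theorem filter_distinguished_one :
    {d ∈ distinguished | aFun d = aFun 1} = {1} := by
  ext d
  simp only [distinguished, Finset.mem_filter, Finset.mem_insert, Finset.mem_singleton]
  constructor
  · rintro ⟨-, h⟩
    by_contra h1
    rw [aFun_ne_one h1, aFun_one] at h
    omega
  · rintro rfl; exact ⟨Or.inl rfl, rfl⟩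

theorem filter_distinguished_ne_one {z : AffWeyl} (hz : z ≠ 1) :
    {d ∈ distinguished | aFun d = aFun z} = {gen 0, gen 1} := by
  ext d
  simp only [distinguished, Finset.mem_filter, Finset.mem_insert, Finset.mem_singleton]
  rw [aFun_ne_one hz]
  constructor
  · rintro ⟨rfl | h, h1⟩
    · rw [aFun_one] at h1; omega
    · exact h
  · intro h
    refine ⟨Or.inr h, aFun_ne_one ?_⟩
    rcases h with rfl | rfl <;> exact gen_ne_one _

theorem toSeries_T (n : ℤ) : toSeries (LaurentPolynomial.T n) = HahnSeries.single n 1 := by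
  have h : ((seriesX ^ n : (LaurentSeries ℤ)ˣ) : LaurentSeries ℤ) = HahnSeries.single n 1 := by
    induction n using Int.induction_on with
    | zero => rfl
    | succ n ih =>
      rw [zpow_add_one, Units.val_mul, ih, seriesX, HahnSeries.single_mul_single, one_mul]
    | pred n ih =>
      rw [zpow_sub_one, Units.val_mul, ih]
      change _ * HahnSeries.single (-1) 1 = _
      rw [HahnSeries.single_mul_single, one_mul]; rfl
  rw [toSeries, LaurentPolynomial.eval₂_T, h]

theorem phiHat_one (b : AffWeyl → LaurentSeries ℤ) : phiHat b 1 = b 1 := by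
  have h : ∀ x, hStruct x 1 1 = if x = 1 then 1 else 0 := by
    intro x
    rw [hStruct, mul_klC_one, repr_klC, Finsupp.single_apply]
  rw [phiHat, filter_distinguished_one, finsum_eq_single _ 1]
  · simp [h]
  · intro x hx
    simp [h, hx]

theorem phiHat_revElt (b : AffWeyl → LaurentSeries ℤ) (i : Fin 2) (n : ℕ) :
    phiHat b (revElt i (n + 1)) = b (revElt (1 - i) n) + b (revElt (1 - i) (n + 2)) -
      (HahnSeries.single 1 1 + HahnSeries.single (-1) 1) * b (revElt i (n + 1)) := by
  have h : ∀ x, (∑ d ∈ {d ∈ distinguished | aFun d = aFun (revElt i (n + 1))},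
      b x * toSeries (hStruct x d (revElt i (n + 1)))) =
      b x * toSeries (hStruct x (gen i) (revElt i (n + 1))) := by
    intro x
    have h0 : gen 0 ≠ gen 1 := by decide
    rw [filter_distinguished_ne_one (ne_one_of_len_succ (len_revElt i (n + 1))),
      Finset.sum_pair h0]
    have h1 := hStruct_gen_ne i n x
    obtain rfl | rfl : i = 0 ∨ i = 1 := eq_or_eq_one_sub i 0
    · rw [show (1 - 0 : Fin 2) = 1 from rfl] at h1
      rw [h1, map_zero, mul_zero, add_zero]
    · rw [show (1 - 1 : Fin 2) = 0 from rfl] at h1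
      rw [h1, map_zero, mul_zero, zero_add]
  have n1 : revElt (1 - i) n ≠ revElt (1 - i) (n + 2) := by rw [Ne, revElt_inj]; omega
  have n2 : revElt (1 - i) n ≠ revElt i (n + 1) := by rw [Ne, revElt_inj]; omega
  have n3 : revElt (1 - i) (n + 2) ≠ revElt i (n + 1) := by rw [Ne, revElt_inj]; omega
  rw [phiHat]
  simp only [h, hStruct_gen_eq]
  rw [finsum_eq_sum_of_support_subset (s := {revElt (1 - i) n, revElt (1 - i) (n + 2),
    revElt i (n + 1)})]
  · rw [Finset.sum_insert (by simp [n1, n2]), Finset.sum_pair n3]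
    simp only [n2, n3, if_true, if_false, true_or, or_true, map_one, mul_one, map_neg, vSum,
      map_add, toSeries_T]
    ring
  · intro x hx
    rw [Function.mem_support] at hx
    contrapose! hx
    simp only [Finset.coe_insert, Finset.coe_singleton, Set.mem_insert_iff,
      Set.mem_singleton_iff, not_or] at hx
    rw [if_neg hx.2.2, if_neg (by tauto), map_zero, mul_zero]

/-- Appending or deleting a last letter keeps the first one, so φ acts on each ray separately, by a
difference operator with characteristic roots v and v⁻¹. Both rays have the identity as their zeroth
term. -/
theorem phiHat_altElt (b : AffWeyl → LaurentSeries ℤ) (j : Fin 2) (n : ℕ) :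
    phiHat b (altElt j (n + 1)) = b (altElt j n) + b (altElt j (n + 2)) -
      (HahnSeries.single 1 1 + HahnSeries.single (-1) 1) * b (altElt j (n + 1)) := by
  simp only [altElt_eq_revElt, phiHat_revElt, endLetter, sub_sub_cancel]

theorem eq_one_or_altElt (z : AffWeyl) : z = 1 ∨ ∃ i n, z = altElt i (n + 1) := by
  have hi := eq_altElt z
  rcases h : len z with _ | n
  · exact Or.inl (eq_one_of_len h)
  · rw [h] at hi
    exact Or.inr ⟨_, n, hi⟩

/-- The coefficients of `t_{s_i}` in the basis `C'_w`. -/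
noncomputable def tCoeff (i : Fin 2) (w : AffWeyl) : LaurentSeries ℤ :=
  -- The sign (-1)^ℓ is cancelled by j, which leaves -v^ℓ, the solution that decays in the
  -- completion. The condition `w ≠ 1` discards the junk first letter of the identity.
  if w ≠ 1 ∧ firstLetter w = i then HahnSeries.single (len w : ℤ) (-(-1) ^ len w) else 0

theorem jHat_tCoeff (i : Fin 2) (w : AffWeyl) : jHat (tCoeff i) w =
    if w ≠ 1 ∧ firstLetter w = i then -HahnSeries.single (len w : ℤ) 1 else 0 := by
  rw [jHat, tCoeff]
  split_ifs
  · rcases Nat.even_or_odd (len w) with h | h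
    · rw [h.neg_one_pow, h.neg_one_pow, one_mul, HahnSeries.single_neg]
    · rw [h.neg_one_pow, h.neg_one_pow, neg_neg, neg_one_mul]
  · exact mul_zero _

theorem firstLetter_altElt (j : Fin 2) (n : ℕ) : firstLetter (altElt j (n + 1)) = j :=
  (len_altElt j (n + 1)).2.resolve_left (Nat.succ_ne_zero n)

theorem altElt_succ_ne_one (j : Fin 2) (n : ℕ) : altElt j (n + 1) ≠ 1 :=
  ne_one_of_len_succ (len_altElt j (n + 1)).1

theorem jHat_tCoeff_altElt (i j : Fin 2) (n : ℕ) : jHat (tCoeff i) (altElt j (n + 1)) =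
    if j = i then -HahnSeries.single (n + 1 : ℤ) 1 else 0 := by
  rw [jHat_tCoeff, firstLetter_altElt, (len_altElt j (n + 1)).1]
  simp [altElt_succ_ne_one]

/-- The sequence -v^n, n ≥ 0, solves the homogeneous recurrence. Replacing its zeroth term -1 by 0
creates a defect of exactly 1, at the word of length one. -/
theorem phiHat_jHat_tCoeff (i : Fin 2) : phiHat (jHat (tCoeff i)) = asympT (gen i) := by
  have h1 : jHat (tCoeff i) 1 = 0 := by rw [jHat_tCoeff, if_neg]; simp
  have hg : gen i = altElt i 1 := by rw [altElt_succ, altElt_zero, mul_one]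
  funext z
  rw [asympT, Pi.single_apply]
  obtain rfl | ⟨j, n, rfl⟩ := eq_one_or_altElt z
  · rw [phiHat_one, h1, if_neg (gen_ne_one i).symm]
  · rw [phiHat_altElt, jHat_tCoeff_altElt, jHat_tCoeff_altElt]
    by_cases hj : j = i
    · subst hj
      rw [if_pos rfl, if_pos rfl, mul_neg, add_mul, HahnSeries.single_mul_single,
        HahnSeries.single_mul_single, mul_one]
      rcases n with _ | n
      · rw [altElt_zero, h1, hg, if_pos rfl]
        push_cast
        norm_num
      · rw [jHat_tCoeff_altElt, if_pos rfl, if_neg]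
        · push_cast
          ring_nf
        · intro h
          have := congrArg len h
          rw [(len_altElt _ _).1, len_gen] at this; omega
    · have h2 : jHat (tCoeff i) (altElt j n) = 0 := by
        rcases n with _ | n
        · rw [altElt_zero, h1]
        · rw [jHat_tCoeff_altElt, if_neg hj]
      rw [h2, if_neg hj, if_neg hj, if_neg]
      · simp
      · intro h
        have := congrArg firstLetter h
        rw [hg, firstLetter_altElt, firstLetter_altElt] at this
        exact hj this

theorem inCompletion_tCoeff (i : Fin 2) : InCompletion (tCoeff i) := by
  intro N
  refine ⟨N, fun x hx k hk => ?_⟩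
  rw [tCoeff]
  split_ifs
  · exact HahnSeries.coeff_single_of_ne (by omega)
  · rfl

theorem coeff_jHat (b : AffWeyl → LaurentSeries ℤ) (x : AffWeyl) (k : ℤ) :
    (jHat b x).coeff k = (b x).coeff k ∨ (jHat b x).coeff k = -(b x).coeff k := by
  rw [jHat]
  rcases neg_one_pow_eq_or (LaurentSeries ℤ) (len x) with h | h
  · left; rw [h, one_mul]
  · right; rw [h, neg_one_mul]; rfl

/-- A solution of the linear recurrence which tends to zero is zero. -/
theorem eq_zero_of_recurrence (d : ℕ → LaurentSeries ℤ) (h0 : d 0 = 0)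
    (hd : ∀ n, d n + d (n + 2) -
      (HahnSeries.single 1 1 + HahnSeries.single (-1) 1) * d (n + 1) = 0)
    (hlim : ∀ N : ℕ, ∃ L : ℕ, ∀ n, L ≤ n → ∀ k : ℤ, k < N → (d n).coeff k = 0) (n : ℕ) :
    d n = 0 := by
  set X : LaurentSeries ℤ := HahnSeries.single 1 1 with hX
  set Y : LaurentSeries ℤ := HahnSeries.single (-1) 1 with hY
  have hXY : X * Y = 1 := by rw [hX, hY, HahnSeries.single_mul_single, one_mul]; rfl
  -- The recurrence factors through its roots: d_{n+1} - X d_n is multiplied by X⁻¹ at each step.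
  -- Hence d_1 is X^n times something tending to zero, and must vanish.
  have he : ∀ n, d 1 = X ^ n * (d (n + 1) - X * d n) := by
    intro n
    induction n with
    | zero => rw [h0]; ring
    | succ n ih =>
      rw [ih]
      linear_combination (-X ^ (n + 1)) * hd n + (X ^ n * d (n + 1)) * (-hXY)
  have hXn : ∀ n : ℕ, X ^ n = HahnSeries.single (n : ℤ) 1 := by
    intro n
    rw [hX, HahnSeries.single_pow, one_pow, nsmul_one]
  have h1 : d 1 = 0 := by
    ext k
    obtain ⟨L, hL⟩ := hlim (k.toNat + 1)
    have h2 := congrArg (HahnSeries.coeff · k) (he L)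
    have h3 : k = (k - L) + L := by ring
    rw [h2, hXn]
    rw [h3, HahnSeries.coeff_single_mul_add, HahnSeries.coeff_sub, hL (L + 1) (by omega) _ (by omega)]
    have h4 : k - L = (k - L - 1) + 1 := by ring
    rw [h4, hX, HahnSeries.coeff_single_mul_add, hL L le_rfl _ (by omega)]
    simp
  have h2 : ∀ n, d n = 0 ∧ d (n + 1) = 0 := by
    intro n
    induction n with
    | zero => exact ⟨h0, h1⟩
    | succ n ih =>
      refine ⟨ih.2, ?_⟩
      have := hd n
      rw [ih.1, ih.2] at this
      simpa using this
  exact (h2 n).1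

/-- For uniqueness, the difference of two preimages vanishes at the identity by `phiHat_one`, solves
the homogeneous recurrence on each ray and tends to zero. -/
theorem isPreimageOfT_tCoeff (i : Fin 2) : IsPreimageOfT (gen i) (tCoeff i) := by
  refine ⟨⟨inCompletion_tCoeff i, phiHat_jHat_tCoeff i⟩, fun b hb hφ => ?_⟩
  have hφ' := hφ.trans (phiHat_jHat_tCoeff i).symm
  have key : ∀ x, jHat b x = jHat (tCoeff i) x := by
    have h1 : jHat b 1 = jHat (tCoeff i) 1 := by
      have := congrFun hφ' 1
      rwa [phiHat_one, phiHat_one] at this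
    intro x
    obtain rfl | ⟨j, n, rfl⟩ := eq_one_or_altElt x
    · exact h1
    refine sub_eq_zero.1 (eq_zero_of_recurrence
      (fun n => jHat b (altElt j n) - jHat (tCoeff i) (altElt j n)) ?_ ?_ ?_ (n + 1))
    · simp only [altElt_zero, h1, sub_self]
    · intro n
      have := congrFun hφ' (altElt j (n + 1))
      rw [phiHat_altElt, phiHat_altElt] at this
      linear_combination this
    · intro N
      obtain ⟨L, hL⟩ := hb N
      obtain ⟨L', hL'⟩ := inCompletion_tCoeff i N
      refine ⟨max L L', fun n hn k hk => ?_⟩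
      have hl := (len_altElt j n).1
      have e1 := hL (altElt j n) (by omega) k hk
      have e2 := hL' (altElt j n) (by omega) k hk
      rw [HahnSeries.coeff_sub]
      have e3 : (jHat b (altElt j n)).coeff k = 0 := by
        rcases coeff_jHat b (altElt j n) k with h | h <;> rw [h, e1]; rfl
      have e4 : (jHat (tCoeff i) (altElt j n)).coeff k = 0 := by
        rcases coeff_jHat (tCoeff i) (altElt j n) k with h | h <;> rw [h, e2]; rfl
      rw [e3, e4, sub_zero]
  funext x
  have := key x
  rw [jHat, jHat] at this
  rcases neg_one_pow_eq_or (LaurentSeries ℤ) (len x) with h | h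
  · rwa [h, one_mul, one_mul] at this
  · rwa [h, neg_one_mul, neg_one_mul, neg_inj] at this

end AffineSL2

namespace AffineSL2

open ValuativeRel Matrix

/-! ### Fractional ideals of the local field -/

section Valuation

variable {F : Type*} [Field F] [ValuativeRel F]

/-- The fractional ideal generated by the `n`-th power of `ϖ`. -/
def frac (ϖ : 𝒪[F]) (n : ℤ) : AddSubgroup F where
  carrier := {x | valuation F x ≤ valuation F ϖ ^ n}
  zero_mem' := by simp
  add_mem' := by
    intro a b ha hb
    exact (valuation F).map_add_le ha hb
  neg_mem' := by
    intro a ha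
    change valuation F (-a) ≤ _
    rwa [Valuation.map_neg]

theorem mem_frac {ϖ : 𝒪[F]} {n : ℤ} {x : F} :
    x ∈ frac ϖ n ↔ valuation F x ≤ valuation F ϖ ^ n := Iff.rfl

theorem mem_frac_zero {ϖ : 𝒪[F]} {x : F} : x ∈ frac ϖ 0 ↔ valuation F x ≤ 1 := by
  rw [mem_frac, zpow_zero]

theorem coe_mem_frac_zero {ϖ : 𝒪[F]} (x : 𝒪[F]) : (x : F) ∈ frac ϖ 0 :=
  mem_frac_zero.2 x.2

variable {ϖ : 𝒪[F]} (hϖ : Irreducible ϖ)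
include hϖ

theorem coe_ne_zero : (ϖ : F) ≠ 0 := fun h => hϖ.ne_zero (Subtype.ext h)

theorem valuation_ne_zero : valuation F ϖ ≠ 0 :=
  (Valuation.ne_zero_iff _).2 (coe_ne_zero hϖ)

theorem valuation_lt_one : valuation F ϖ < 1 := by
  refine lt_of_le_of_ne ϖ.2 fun h => hϖ.not_isUnit ?_
  exact Valuation.Integers.isUnit_of_one (Valuation.integer.integers (valuation F))
    ((coe_ne_zero hϖ).isUnit) h

theorem valuation_zpow_le_zpow {m n : ℤ} :
    valuation F ϖ ^ m ≤ valuation F ϖ ^ n ↔ n ≤ m :=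
  zpow_le_zpow_iff_right_of_lt_one₀ (zero_lt_iff.2 (valuation_ne_zero hϖ)) (valuation_lt_one hϖ)

theorem frac_mono {m n : ℤ} (h : m ≤ n) : frac ϖ n ≤ frac ϖ m :=
  fun _ hx => mem_frac.2 <| le_trans (mem_frac.1 hx) ((valuation_zpow_le_zpow hϖ).2 h)

omit hϖ in
theorem mul_mem_frac {m n k : ℤ} {x y : F} (hx : x ∈ frac ϖ m) (hy : y ∈ frac ϖ n)
    (hϖ : Irreducible ϖ) (h : k = m + n) : x * y ∈ frac ϖ k := by
  rw [h, mem_frac, map_mul, zpow_add₀ (valuation_ne_zero hϖ)]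
  exact mul_le_mul' hx hy

theorem zpow_mul_mem_frac {k n : ℤ} {x : F} : (ϖ : F) ^ k * x ∈ frac ϖ n ↔ x ∈ frac ϖ (n - k) := by
  rw [mem_frac, mem_frac, map_mul, map_zpow₀, zpow_sub₀ (valuation_ne_zero hϖ),
    le_div_iff₀ (zero_lt_iff.2 (zpow_ne_zero _ (valuation_ne_zero hϖ))), mul_comm]

theorem zpow_mem_frac {k n : ℤ} : (ϖ : F) ^ k ∈ frac ϖ n ↔ n ≤ k := by
  rw [mem_frac, map_zpow₀, valuation_zpow_le_zpow hϖ]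

theorem mem_frac_iff_exists {n : ℤ} {x : F} :
    x ∈ frac ϖ n ↔ ∃ c : 𝒪[F], x = (ϖ : F) ^ n * c := by
  have h : x = (ϖ : F) ^ n * ((ϖ : F) ^ (-n) * x) := by
    rw [← mul_assoc, ← zpow_add₀ (coe_ne_zero hϖ), add_neg_cancel, zpow_zero, one_mul]
  constructor
  · intro hx
    rw [h, zpow_mul_mem_frac hϖ, sub_self, mem_frac_zero] at hx
    exact ⟨⟨_, hx⟩, h⟩
  · rintro ⟨c, rfl⟩
    rw [zpow_mul_mem_frac hϖ, sub_self]
    exact coe_mem_frac_zero c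

omit hϖ in
theorem isUnit_iff_valuation (c : 𝒪[F]) : IsUnit c ↔ valuation F c = 1 := by
  refine ⟨fun h => Valuation.Integers.one_of_isUnit (Valuation.integer.integers (valuation F)) h,
    fun h => ?_⟩
  refine Valuation.Integers.isUnit_of_one (Valuation.integer.integers (valuation F)) ?_ h
  refine IsUnit.mk0 _ fun h0 => ?_
  change (c : F) = 0 at h0
  rw [h0, map_zero] at h
  exact zero_ne_one h

end Valuation

/-! ### The Iwahori subgroup in terms of valuations -/

section Field

variable {F : Type*} [Field F] [ValuativeRel F] [TopologicalSpace F]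
  [IsNonarchimedeanLocalField F] {ϖ : 𝒪[F]} (hϖ : Irreducible ϖ)
include hϖ

theorem exists_valuation_eq {x : F} (hx : x ≠ 0) :
    ∃ n : ℤ, valuation F x = valuation F ϖ ^ n := by
  have key : ∀ x : F, x ≠ 0 → valuation F x ≤ 1 →
      ∃ n : ℤ, valuation F x = valuation F ϖ ^ n := by
    intro x hx h
    obtain ⟨n, u, hu⟩ := IsDiscreteValuationRing.eq_unit_mul_pow_irreducible
      (x := (⟨x, h⟩ : 𝒪[F])) (fun h0 => hx (congrArg Subtype.val h0)) hϖ
    refine ⟨n, ?_⟩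
    have h2 : x = (u : 𝒪[F]) * (ϖ : F) ^ n := congrArg Subtype.val hu
    rw [h2, map_mul, (isUnit_iff_valuation _).1 u.isUnit, one_mul, map_pow, zpow_natCast]
  rcases le_total (valuation F x) 1 with h | h
  · exact key x hx h
  · obtain ⟨n, hn⟩ := key x⁻¹ (inv_ne_zero hx) (by rw [map_inv₀]; exact inv_le_one_of_one_le₀ h)
    exact ⟨-n, by rw [_root_.zpow_neg, ← hn, map_inv₀, inv_inv]⟩

theorem mem_frac_one_iff {x : F} : x ∈ frac ϖ 1 ↔ valuation F x < 1 := by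
  have h1 := valuation_lt_one hϖ
  rw [mem_frac, zpow_one]
  refine ⟨fun h => h.trans_lt h1, fun h => ?_⟩
  by_cases hx : x = 0
  · simp [hx]
  obtain ⟨n, hn⟩ := exists_valuation_eq hϖ hx
  have h2 : ¬ n ≤ 0 := by
    intro h3
    rw [← valuation_zpow_le_zpow hϖ, zpow_zero, ← hn] at h3
    exact absurd h h3.not_gt
  rw [hn]
  nth_rw 2 [← zpow_one (valuation F ϖ)]
  rw [valuation_zpow_le_zpow hϖ]
  omega

theorem mem_maximalIdeal_pow {n : ℕ} {c : 𝒪[F]} : c ∈ 𝓂[F] ^ n ↔ (c : F) ∈ frac ϖ n := by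
  rw [hϖ.maximalIdeal_eq, Ideal.span_singleton_pow, Ideal.mem_span_singleton,
    mem_frac_iff_exists hϖ]
  constructor
  · rintro ⟨d, rfl⟩; exact ⟨d, by simp⟩
  · rintro ⟨d, hd⟩; exact ⟨d, Subtype.ext (by simpa using hd)⟩

theorem mem_maximalIdeal {c : 𝒪[F]} : c ∈ 𝓂[F] ↔ (c : F) ∈ frac ϖ 1 := by
  have := mem_maximalIdeal_pow hϖ (n := 1) (c := c)
  rwa [pow_one] at this

theorem mem_iwahori_iff {g : SpecialLinearGroup (Fin 2) F} : g ∈ iwahori F ↔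
    g.1 0 0 ∈ frac ϖ 0 ∧ g.1 0 1 ∈ frac ϖ 0 ∧ g.1 1 0 ∈ frac ϖ 1 ∧ g.1 1 1 ∈ frac ϖ 0 := by
  constructor
  · rintro ⟨h, hh, rfl⟩
    exact ⟨coe_mem_frac_zero (h.1 0 0), coe_mem_frac_zero (h.1 0 1),
      (mem_maximalIdeal hϖ).1 hh, coe_mem_frac_zero (h.1 1 1)⟩
  · rintro ⟨h1, h2, h3, h4⟩
    have h3' := frac_mono hϖ zero_le_one h3
    rw [mem_frac_zero] at h1 h2 h3' h4
    have hdet := g.2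
    rw [det_fin_two] at hdet
    refine ⟨⟨!![⟨_, h1⟩, ⟨_, h2⟩; ⟨_, h3'⟩, ⟨_, h4⟩], ?_⟩, ?_, ?_⟩
    · rw [det_fin_two]; exact Subtype.ext hdet
    · exact (mem_maximalIdeal hϖ).2 h3
    · ext i j
      fin_cases i <;> fin_cases j <;> rfl

/-- In ad - bc = 1 the product bc lies in the maximal ideal, so ad has valuation one, and both
factors are integral. -/
theorem iwahori_diag {g : SpecialLinearGroup (Fin 2) F} (hg : g ∈ iwahori F) :
    valuation F (g.1 0 0) = 1 ∧ valuation F (g.1 1 1) = 1 := by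
  obtain ⟨h1, h2, h3, h4⟩ := (mem_iwahori_iff hϖ).1 hg
  have hdet := g.2
  rw [det_fin_two] at hdet
  have h5 : valuation F (g.1 0 1 * g.1 1 0) < 1 :=
    (mem_frac_one_iff hϖ).1 (mul_mem_frac h2 h3 hϖ (by norm_num))
  have h6 : valuation F (g.1 0 0) * valuation F (g.1 1 1) = 1 := by
    rw [← map_mul, sub_eq_iff_eq_add.1 hdet]
    rw [Valuation.map_add_eq_of_lt_left] <;> rw [map_one]
    exact h5
  rw [mem_frac_zero] at h1 h4
  constructor
  · exact le_antisymm h1 (by rw [← h6]; exact mul_le_of_le_one_right' h4)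
  · exact le_antisymm h4 (by rw [← h6]; exact mul_le_of_le_one_left' h1)

/-! ### Monomial representatives and root subgroups -/

/-- The monomial representative of an element of the affine Weyl group. -/
noncomputable def mono : AffWeyl → SpecialLinearGroup (Fin 2) F
  | .r n => let k : ℤ := n
    ⟨!![(ϖ : F) ^ k, 0; 0, (ϖ : F) ^ (-k)], by
      rw [det_fin_two_of, ← zpow_add₀ (coe_ne_zero hϖ)]; simp⟩
  | .sr n => let k : ℤ := n
    ⟨!![0, -(ϖ : F) ^ (-k); (ϖ : F) ^ k, 0], by
      rw [det_fin_two_of, neg_mul, ← zpow_add₀ (coe_ne_zero hϖ)]; simp⟩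

/-- The upper triangular root subgroup for `i = 0`, and the lower triangular one
(with entries scaled by the uniformizer) for `i = 1`. -/
def root (ϖ : 𝒪[F]) (i : Fin 2) (a : F) : SpecialLinearGroup (Fin 2) F :=
  if i = 0 then ⟨!![1, a; 0, 1], by simp⟩ else ⟨!![1, 0; ϖ * a, 1], by simp⟩

end Field

/-! ### Conjugation of Iwahori elements by monomial matrices -/

section Mono

variable {F : Type*} [Field F] [ValuativeRel F] [TopologicalSpace F]
  [IsNonarchimedeanLocalField F] {ϖ : 𝒪[F]} (hϖ : Irreducible ϖ)

theorem mono_r (k : ℤ) : (mono hϖ (.r k)).1 = !![(ϖ : F) ^ k, 0; 0, (ϖ : F) ^ (-k)] := rfl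

theorem mono_sr (k : ℤ) : (mono hϖ (.sr k)).1 = !![0, -(ϖ : F) ^ (-k); (ϖ : F) ^ k, 0] := rfl

include hϖ in
theorem zpow_mul_zpow (m n : ℤ) : (ϖ : F) ^ m * (ϖ : F) ^ n = (ϖ : F) ^ (m + n) :=
  (zpow_add₀ (coe_ne_zero hϖ) m n).symm

theorem conj_r_r (M : SpecialLinearGroup (Fin 2) F) (k l : ℤ) :
    ((mono hϖ (.r k))⁻¹ * M * mono hϖ (.r l)).1 =
      !![(ϖ : F) ^ (l - k) * M.1 0 0, (ϖ : F) ^ (-l - k) * M.1 0 1;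
        (ϖ : F) ^ (k + l) * M.1 1 0, (ϖ : F) ^ (k - l) * M.1 1 1] := by
  change adjugate (mono hϖ (.r k)).1 * M.1 * (mono hϖ (.r l)).1 = _
  rw [mono_r, mono_r, adjugate_fin_two_of, eta_fin_two M.1]
  simp only [sub_eq_add_neg, ← zpow_mul_zpow hϖ]
  ext i j
  fin_cases i <;> fin_cases j <;> simp [Matrix.mul_apply, Fin.sum_univ_two] <;> ring

theorem conj_r_sr (M : SpecialLinearGroup (Fin 2) F) (k l : ℤ) :
    ((mono hϖ (.r k))⁻¹ * M * mono hϖ (.sr l)).1 =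
      !![(ϖ : F) ^ (l - k) * M.1 0 1, -((ϖ : F) ^ (-l - k) * M.1 0 0);
        (ϖ : F) ^ (k + l) * M.1 1 1, -((ϖ : F) ^ (k - l) * M.1 1 0)] := by
  change adjugate (mono hϖ (.r k)).1 * M.1 * (mono hϖ (.sr l)).1 = _
  rw [mono_r, mono_sr, adjugate_fin_two_of, eta_fin_two M.1]
  simp only [sub_eq_add_neg, ← zpow_mul_zpow hϖ]
  ext i j
  fin_cases i <;> fin_cases j <;> simp [Matrix.mul_apply, Fin.sum_univ_two] <;> ring

theorem conj_sr_r (M : SpecialLinearGroup (Fin 2) F) (k l : ℤ) :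
    ((mono hϖ (.sr k))⁻¹ * M * mono hϖ (.r l)).1 =
      !![(ϖ : F) ^ (l - k) * M.1 1 0, (ϖ : F) ^ (-l - k) * M.1 1 1;
        -((ϖ : F) ^ (k + l) * M.1 0 0), -((ϖ : F) ^ (k - l) * M.1 0 1)] := by
  change adjugate (mono hϖ (.sr k)).1 * M.1 * (mono hϖ (.r l)).1 = _
  rw [mono_sr, mono_r, adjugate_fin_two_of, eta_fin_two M.1]
  simp only [sub_eq_add_neg, ← zpow_mul_zpow hϖ]
  ext i j
  fin_cases i <;> fin_cases j <;> simp [Matrix.mul_apply, Fin.sum_univ_two] <;> ring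

theorem conj_sr_sr (M : SpecialLinearGroup (Fin 2) F) (k l : ℤ) :
    ((mono hϖ (.sr k))⁻¹ * M * mono hϖ (.sr l)).1 =
      !![(ϖ : F) ^ (l - k) * M.1 1 1, -((ϖ : F) ^ (-l - k) * M.1 1 0);
        -((ϖ : F) ^ (k + l) * M.1 0 1), (ϖ : F) ^ (k - l) * M.1 0 0] := by
  change adjugate (mono hϖ (.sr k)).1 * M.1 * (mono hϖ (.sr l)).1 = _
  rw [mono_sr, mono_sr, adjugate_fin_two_of, eta_fin_two M.1]
  simp only [sub_eq_add_neg, ← zpow_mul_zpow hϖ]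
  ext i j
  fin_cases i <;> fin_cases j <;> simp [Matrix.mul_apply, Fin.sum_univ_two] <;> ring

theorem conj_r_r_mem (M : SpecialLinearGroup (Fin 2) F) (k l : ℤ) :
    (mono hϖ (.r k))⁻¹ * M * mono hϖ (.r l) ∈ iwahori F ↔
      M.1 0 0 ∈ frac ϖ (k - l) ∧ M.1 0 1 ∈ frac ϖ (k + l) ∧
        M.1 1 0 ∈ frac ϖ (1 - k - l) ∧ M.1 1 1 ∈ frac ϖ (l - k) := by
  rw [mem_iwahori_iff hϖ, conj_r_r]
  simp only [of_apply, cons_val', cons_val_zero, cons_val_one, cons_val_fin_one,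
    zpow_mul_mem_frac hϖ]
  rw [show 0 - (l - k) = k - l by ring, show 0 - (-l - k) = k + l by ring,
    show 1 - (k + l) = 1 - k - l by ring, show 0 - (k - l) = l - k by ring]

theorem conj_r_sr_mem (M : SpecialLinearGroup (Fin 2) F) (k l : ℤ) :
    (mono hϖ (.r k))⁻¹ * M * mono hϖ (.sr l) ∈ iwahori F ↔
      M.1 0 1 ∈ frac ϖ (k - l) ∧ M.1 0 0 ∈ frac ϖ (k + l) ∧
        M.1 1 1 ∈ frac ϖ (1 - k - l) ∧ M.1 1 0 ∈ frac ϖ (l - k) := by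
  rw [mem_iwahori_iff hϖ, conj_r_sr]
  simp only [of_apply, cons_val', cons_val_zero, cons_val_one, cons_val_fin_one,
    zpow_mul_mem_frac hϖ, neg_mem_iff]
  rw [show 0 - (l - k) = k - l by ring, show 0 - (-l - k) = k + l by ring,
    show 1 - (k + l) = 1 - k - l by ring, show 0 - (k - l) = l - k by ring]

theorem conj_sr_r_mem (M : SpecialLinearGroup (Fin 2) F) (k l : ℤ) :
    (mono hϖ (.sr k))⁻¹ * M * mono hϖ (.r l) ∈ iwahori F ↔
      M.1 1 0 ∈ frac ϖ (k - l) ∧ M.1 1 1 ∈ frac ϖ (k + l) ∧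
        M.1 0 0 ∈ frac ϖ (1 - k - l) ∧ M.1 0 1 ∈ frac ϖ (l - k) := by
  rw [mem_iwahori_iff hϖ, conj_sr_r]
  simp only [of_apply, cons_val', cons_val_zero, cons_val_one, cons_val_fin_one,
    zpow_mul_mem_frac hϖ, neg_mem_iff]
  rw [show 0 - (l - k) = k - l by ring, show 0 - (-l - k) = k + l by ring,
    show 1 - (k + l) = 1 - k - l by ring, show 0 - (k - l) = l - k by ring]

theorem conj_sr_sr_mem (M : SpecialLinearGroup (Fin 2) F) (k l : ℤ) :
    (mono hϖ (.sr k))⁻¹ * M * mono hϖ (.sr l) ∈ iwahori F ↔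
      M.1 1 1 ∈ frac ϖ (k - l) ∧ M.1 1 0 ∈ frac ϖ (k + l) ∧
        M.1 0 1 ∈ frac ϖ (1 - k - l) ∧ M.1 0 0 ∈ frac ϖ (l - k) := by
  rw [mem_iwahori_iff hϖ, conj_sr_sr]
  simp only [of_apply, cons_val', cons_val_zero, cons_val_one, cons_val_fin_one,
    zpow_mul_mem_frac hϖ, neg_mem_iff]
  rw [show 0 - (l - k) = k - l by ring, show 0 - (-l - k) = k + l by ring,
    show 1 - (k + l) = 1 - k - l by ring, show 0 - (k - l) = l - k by ring]

include hϖ in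
theorem mem_frac_of_valuation_one {x : F} (hx : valuation F x = 1) {n : ℤ} :
    x ∈ frac ϖ n ↔ n ≤ 0 := by
  rw [mem_frac, hx, ← zpow_zero (valuation F ϖ), valuation_zpow_le_zpow hϖ]

/-- The monomial representatives lie in different Iwahori double cosets. -/
theorem eq_of_conj_mem {M : SpecialLinearGroup (Fin 2) F} (hM : M ∈ iwahori F) {w v : AffWeyl}
    (h : (mono hϖ w)⁻¹ * M * mono hϖ v ∈ iwahori F) : w = v := by
  obtain ⟨h0, h1⟩ := iwahori_diag hϖ hM
  rcases w with k | k <;> rcases v with l | l <;> change ℤ at k <;> change ℤ at l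
  -- The diagonal entries of an Iwahori element are units, so the conditions on them alone force the
  -- translation parameters to agree, and are contradictory when one element is a translation and
  -- the other a reflection.
  · rw [conj_r_r_mem, mem_frac_of_valuation_one hϖ h0, mem_frac_of_valuation_one hϖ h1] at h
    have : k = l := by omega
    rw [this]
  · rw [conj_r_sr_mem, mem_frac_of_valuation_one hϖ h0, mem_frac_of_valuation_one hϖ h1] at h
    omega
  · rw [conj_sr_r_mem, mem_frac_of_valuation_one hϖ h0, mem_frac_of_valuation_one hϖ h1] at h
    omega
  · rw [conj_sr_sr_mem, mem_frac_of_valuation_one hϖ h0, mem_frac_of_valuation_one hϖ h1] at h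
    have : k = l := by omega
    rw [this]

theorem root_zero_val (a : F) : (root ϖ 0 a).1 = !![1, a; 0, 1] := rfl
theorem root_one_val (a : F) : (root ϖ 1 a).1 = !![1, 0; ϖ * a, 1] := rfl

theorem root_add (i : Fin 2) (a b : F) : root ϖ i (a + b) = root ϖ i a * root ϖ i b := by
  apply Subtype.ext
  change (root ϖ i (a + b)).1 = (root ϖ i a).1 * (root ϖ i b).1
  obtain rfl | rfl : i = 0 ∨ i = 1 := eq_or_eq_one_sub i 0
  · rw [root_zero_val, root_zero_val, root_zero_val]
    simp [add_comm]
  · rw [root_one_val, root_one_val, root_one_val]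
    simp [mul_add]

theorem root_zero (i : Fin 2) : root ϖ i (0 : F) = 1 := by
  have := root_add (ϖ := ϖ) i 0 0
  rwa [add_zero, left_eq_mul] at this

theorem root_neg (i : Fin 2) (a : F) : root ϖ i (-a) = (root ϖ i a)⁻¹ := by
  rw [eq_inv_iff_mul_eq_one, ← root_add, neg_add_cancel, root_zero]

include hϖ in
theorem mul_uniformizer_mem_frac {a : F} {n : ℤ} : (ϖ : F) * a ∈ frac ϖ n ↔ a ∈ frac ϖ (n - 1) := by
  rw [← zpow_mul_mem_frac hϖ (k := 1), zpow_one]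

include hϖ in
theorem one_mem_frac {n : ℤ} : (1 : F) ∈ frac ϖ n ↔ n ≤ 0 :=
  mem_frac_of_valuation_one hϖ (map_one _)

include hϖ in
theorem root_mem_iwahori (i : Fin 2) {a : F} (ha : a ∈ frac ϖ 0) : root ϖ i a ∈ iwahori F := by
  rw [mem_iwahori_iff hϖ]
  obtain rfl | rfl : i = 0 ∨ i = 1 := eq_or_eq_one_sub i 0
  · rw [root_zero_val]
    simp [one_mem_frac hϖ, ha, zero_mem]
  · rw [root_one_val]
    simp [one_mem_frac hϖ, zero_mem, mul_uniformizer_mem_frac hϖ, ha]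

/-- Conjugation by w⁻¹ lowers the filtration of the affine root subgroup attached to the first
letter by exactly ℓ(w). This is the source of the q^(ℓ(w)) cosets in IwI. For w = 1 any letter i is
allowed. -/
theorem conj_root_mem_iff {w : AffWeyl} {i : Fin 2} (hi : len w = 0 ∨ firstLetter w = i) {a : F}
    (h0 : a ∈ frac ϖ 0) :
    (mono hϖ w)⁻¹ * root ϖ i a * mono hϖ w ∈ iwahori F ↔ a ∈ frac ϖ (len w) := by
  have hm : ∀ m : ℤ, m ≤ 0 → a ∈ frac ϖ m := fun m hm => frac_mono hϖ hm h0
  rcases w with k | k <;> change ℤ at k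
  · rw [len_r, firstLetter_r] at hi
    rw [conj_r_r_mem, len_r]
    obtain rfl | rfl : i = 0 ∨ i = 1 := eq_or_eq_one_sub i 0
    · have hk : 0 ≤ k := by split_ifs at hi <;> simp at hi <;> omega
      rw [root_zero_val]
      simp only [of_apply, cons_val', cons_val_zero, cons_val_one, cons_val_fin_one, zero_mem,
        one_mem_frac hϖ, sub_self, le_refl, true_and, and_true]
      rw [show k + k = ((2 * k.natAbs : ℕ) : ℤ) by omega]
    · have hk : k ≤ 0 := by split_ifs at hi <;> simp at hi <;> omega
      rw [root_one_val]
      simp only [of_apply, cons_val', cons_val_zero, cons_val_one, cons_val_fin_one, zero_mem,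
        one_mem_frac hϖ, sub_self, le_refl, true_and, and_true, mul_uniformizer_mem_frac hϖ]
      rw [show 1 - k - k - 1 = ((2 * k.natAbs : ℕ) : ℤ) by omega]
  · rw [len_sr, firstLetter_sr] at hi
    rw [conj_sr_sr_mem, len_sr]
    obtain rfl | rfl : i = 0 ∨ i = 1 := eq_or_eq_one_sub i 0
    · have hk : k ≤ 0 := by split_ifs at hi <;> simp at hi <;> omega
      rw [root_zero_val]
      simp only [of_apply, cons_val', cons_val_zero, cons_val_one, cons_val_fin_one, zero_mem,
        one_mem_frac hϖ, sub_self, le_refl, true_and, and_true]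
      rw [show 1 - k - k = (((2 * k - 1).natAbs : ℕ) : ℤ) by omega]
    · have hk : 0 < k := by split_ifs at hi <;> simp at hi <;> omega
      rw [root_one_val]
      simp only [of_apply, cons_val', cons_val_zero, cons_val_one, cons_val_fin_one, zero_mem,
        one_mem_frac hϖ, sub_self, le_refl, true_and, and_true, mul_uniformizer_mem_frac hϖ]
      rw [show k + k - 1 = (((2 * k - 1).natAbs : ℕ) : ℤ) by omega]

/-- Modulo the root subgroup, conjugation by a representative of `w` preserves the Iwahori
subgroup. -/
theorem exists_root_mul_conj_mem {M : SpecialLinearGroup (Fin 2) F} (hM : M ∈ iwahori F)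
    (w : AffWeyl) : ∃ a : 𝒪[F],
      (mono hϖ w)⁻¹ * (root ϖ (firstLetter w) (-a : F) * M) * mono hϖ w ∈ iwahori F := by
  obtain ⟨h0, h1⟩ := iwahori_diag hϖ hM
  obtain ⟨m1, m2, m3, m4⟩ := (mem_iwahori_iff hϖ).1 hM
  -- The parameter is chosen to clear the only off-diagonal entry that conjugation by w⁻¹ could push
  -- out of I; the quotient is integral because the diagonal entry is a unit.
  have key0 : ∃ a : 𝒪[F], (root ϖ 0 (-a : F) * M).1 0 1 = 0 := by
    refine ⟨⟨M.1 0 1 / M.1 1 1, ?_⟩, ?_⟩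
    · rw [Valuation.mem_integer_iff, map_div₀, h1, div_one]
      exact mem_frac_zero.1 m2
    · have : M.1 1 1 ≠ 0 := by intro h; rw [h, map_zero] at h1; exact zero_ne_one h1
      change ((root ϖ 0 _).1 * M.1) 0 1 = 0
      rw [root_zero_val, Matrix.mul_apply, Fin.sum_univ_two]
      simp [div_mul_cancel₀ _ this]
  have key1 : ∃ a : 𝒪[F], (root ϖ 1 (-a : F) * M).1 1 0 = 0 := by
    obtain ⟨c, hc⟩ := (mem_frac_iff_exists hϖ).1 m3
    rw [zpow_one] at hc
    refine ⟨⟨c / M.1 0 0, ?_⟩, ?_⟩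
    · rw [Valuation.mem_integer_iff, map_div₀, h0, div_one]
      exact c.2
    · have : M.1 0 0 ≠ 0 := by intro h; rw [h, map_zero] at h0; exact zero_ne_one h0
      change ((root ϖ 1 _).1 * M.1) 1 0 = 0
      rw [root_one_val, Matrix.mul_apply, Fin.sum_univ_two]
      simp only [of_apply, cons_val', cons_val_zero, cons_val_one, cons_val_fin_one, hc]
      field_simp
      ring
  have hmem : ∀ (i : Fin 2) (a : 𝒪[F]), root ϖ i (-a : F) * M ∈ iwahori F := fun i a =>
    mul_mem (root_mem_iwahori hϖ i (neg_mem (coe_mem_frac_zero a))) hM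
  have h01 : firstLetter w = 0 ∨ firstLetter w = 1 := eq_or_eq_one_sub _ 0
  rcases h01 with hw | hw <;> rw [hw]
  · obtain ⟨a, ha⟩ := key0
    refine ⟨a, ?_⟩
    obtain ⟨m1, m2, m3, m4⟩ := (mem_iwahori_iff hϖ).1 (hmem 0 a)
    generalize root ϖ 0 (-a : F) * M = N at *
    rcases w with k | k <;> change ℤ at k
    · rw [firstLetter_r] at hw
      have hk : 0 < k := by split_ifs at hw <;> simp at hw; omega
      rw [conj_r_r_mem, ha]
      simp only [sub_self]
      exact ⟨m1, zero_mem _, frac_mono hϖ (by omega) m3, m4⟩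
    · rw [firstLetter_sr] at hw
      have hk : k ≤ 0 := by split_ifs at hw <;> simp at hw; omega
      rw [conj_sr_sr_mem, ha]
      simp only [sub_self]
      exact ⟨m4, frac_mono hϖ (by omega) m3, zero_mem _, m1⟩
  · obtain ⟨a, ha⟩ := key1
    refine ⟨a, ?_⟩
    obtain ⟨m1, m2, m3, m4⟩ := (mem_iwahori_iff hϖ).1 (hmem 1 a)
    generalize root ϖ 1 (-a : F) * M = N at *
    rcases w with k | k <;> change ℤ at k
    · rw [firstLetter_r] at hw
      have hk : k ≤ 0 := by split_ifs at hw <;> simp at hw; omega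
      rw [conj_r_r_mem, ha]
      simp only [sub_self]
      exact ⟨m1, frac_mono hϖ (by omega) m2, zero_mem _, m4⟩
    · rw [firstLetter_sr] at hw
      have hk : 0 < k := by split_ifs at hw <;> simp at hw; omega
      rw [conj_sr_sr_mem, ha]
      simp only [sub_self]
      exact ⟨m4, zero_mem _, frac_mono hϖ (by omega) m2, m1⟩

end Mono

/-! ### Iwahori double cosets and their left cosets -/

section Cells

variable {F : Type*} [Field F] [ValuativeRel F] [TopologicalSpace F]
  [IsNonarchimedeanLocalField F] {ϖ : 𝒪[F]} (hϖ : Irreducible ϖ)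

theorem genMatrix_zero_val : (genMatrix hϖ 0).1 = !![0, -1; 1, 0] := rfl
theorem genMatrix_one_val : (genMatrix hϖ 1).1 = !![0, (ϖ : F)⁻¹; -ϖ, 0] := rfl

theorem genMatrix_entries (i : Fin 2) : (genMatrix hϖ i).1 0 0 = 0 ∧ (genMatrix hϖ i).1 1 1 = 0 ∧
    (genMatrix hϖ i).1 0 1 ∈ frac ϖ (-(i.val : ℤ)) ∧
      (genMatrix hϖ i).1 1 0 ∈ frac ϖ (i.val : ℤ) := by
  obtain rfl | rfl : i = 0 ∨ i = 1 := eq_or_eq_one_sub i 0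
  · rw [genMatrix_zero_val]
    simp [one_mem_frac hϖ]
  · rw [genMatrix_one_val]
    have h1 := (zpow_mem_frac hϖ (k := -1) (n := -1)).2 le_rfl
    have h2 := (zpow_mem_frac hϖ (k := 1) (n := 1)).2 le_rfl
    rw [zpow_one] at h2
    rw [_root_.zpow_neg_one] at h1
    simp [h1, h2]

/-- The chosen representatives do not multiply exactly, signs intervene, but the discrepancy lies in
I, which is all that double cosets and I-invariant functions detect. -/
theorem genMatrix_conj_mem (i : Fin 2) (w : AffWeyl) :
    (mono hϖ (gen i * w))⁻¹ * genMatrix hϖ i * mono hϖ w ∈ iwahori F := by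
  obtain ⟨h1, h2, h3, h4⟩ := genMatrix_entries hϖ i
  rcases w with n | n <;> change ℤ at n
  · rw [exists_gen_mul_r, conj_sr_r_mem, h1, h2]
    refine ⟨?_, zero_mem _, zero_mem _, ?_⟩
    · rwa [add_sub_cancel_right]
    · rwa [sub_add_cancel_right]
  · rw [exists_gen_mul_sr, conj_r_sr_mem, h1, h2]
    refine ⟨?_, zero_mem _, zero_mem _, ?_⟩
    · rwa [sub_sub_cancel_left]
    · rwa [sub_sub_cancel]

theorem mono_one : mono hϖ 1 = 1 := by
  apply Subtype.ext
  change (mono hϖ (.r (0 : ℤ))).1 = 1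
  rw [mono_r, neg_zero, zpow_zero, one_fin_two]

theorem r_mul_gen (n : ℤ) (i : Fin 2) :
    (.r n : AffWeyl) * gen i = .sr ((i.val : ℤ) - n : ℤ) := by
  fin_cases i <;> rfl

theorem sr_mul_gen (n : ℤ) (i : Fin 2) :
    (.sr n : AffWeyl) * gen i = .r ((i.val : ℤ) - n : ℤ) := by
  fin_cases i <;> rfl

theorem gen_eq_sr (i : Fin 2) : gen i = .sr (i.val : ℤ) := by
  fin_cases i <;> rfl

/-- The version for right multiplication; it allows the invariance of f under s_j to be used at the
end of a word. -/
theorem mono_mul_gen_mem (i : Fin 2) (w : AffWeyl) :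
    (mono hϖ (w * gen i))⁻¹ * (mono hϖ w * genMatrix hϖ i) ∈ iwahori F := by
  have h1 : (mono hϖ (gen i))⁻¹ * genMatrix hϖ i ∈ iwahori F := by
    have := genMatrix_conj_mem hϖ i 1
    rwa [mul_one, mono_one, mul_one] at this
  have h2 : (mono hϖ (w * gen i))⁻¹ * mono hϖ w * mono hϖ (gen i) ∈ iwahori F := by
    rw [gen_eq_sr]
    rcases w with n | n <;> change ℤ at n
    · rw [← gen_eq_sr, r_mul_gen, gen_eq_sr, conj_sr_sr_mem, mono_r]
      simp only [of_apply, cons_val', cons_val_zero, cons_val_one, cons_val_fin_one, zero_mem,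
        zpow_mem_frac hϖ, true_and]
      omega
    · rw [← gen_eq_sr, sr_mul_gen, gen_eq_sr, conj_r_sr_mem, mono_sr]
      simp only [of_apply, cons_val', cons_val_zero, cons_val_one, cons_val_fin_one, zero_mem,
        zpow_mem_frac hϖ, true_and, neg_mem_iff]
      omega
  have := mul_mem h2 h1
  have e : (mono hϖ (w * gen i))⁻¹ * mono hϖ w * mono hϖ (gen i) *
      ((mono hϖ (gen i))⁻¹ * genMatrix hϖ i) =
      (mono hϖ (w * gen i))⁻¹ * (mono hϖ w * genMatrix hϖ i) := by group
  rwa [e] at this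

theorem mono_inv_mul_prod_mem (w : AffWeyl) :
    (mono hϖ w)⁻¹ * ((reducedWord w).map (genMatrix hϖ)).prod ∈ iwahori F := by
  induction w using up_induction with
  | h1 =>
    rw [mono_one]
    simp [reducedWord, len_one, altWord, one_mem]
  | h2 i w h ih =>
    rw [reducedWord_gen_mul h, List.map_cons, List.prod_cons]
    have := mul_mem (genMatrix_conj_mem hϖ i w) ih
    generalize ((reducedWord w).map (genMatrix hϖ)).prod = P at *
    have e : (mono hϖ (gen i * w))⁻¹ * genMatrix hϖ i * mono hϖ w * ((mono hϖ w)⁻¹ * P) =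
      (mono hϖ (gen i * w))⁻¹ * (genMatrix hϖ i * P) := by group
    rwa [e] at this

theorem mem_cell_iff {w : AffWeyl} {g : SpecialLinearGroup (Fin 2) F} : g ∈ cell hϖ w ↔
    ∃ x ∈ iwahori F, ∃ y ∈ iwahori F, g = x * mono hϖ w * y := by
  have hz := mono_inv_mul_prod_mem hϖ w
  rw [cell, DoubleCoset.mem_doubleCoset]
  generalize ((reducedWord w).map (genMatrix hϖ)).prod = P at *
  constructor
  · rintro ⟨x, hx, y, hy, rfl⟩
    exact ⟨x, hx, _, mul_mem hz hy, by group⟩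
  · rintro ⟨x, hx, y, hy, rfl⟩
    exact ⟨x, hx, _, mul_mem (inv_mem hz) hy, by group⟩

theorem eq_of_mem_cell {w v : AffWeyl} {g : SpecialLinearGroup (Fin 2) F} (hw : g ∈ cell hϖ w)
    (hv : g ∈ cell hϖ v) : w = v := by
  obtain ⟨x, hx, y, hy, rfl⟩ := (mem_cell_iff hϖ).1 hw
  obtain ⟨x', hx', y', hy', h⟩ := (mem_cell_iff hϖ).1 hv
  refine eq_of_conj_mem hϖ (mul_mem (inv_mem hx) hx') ?_
  have e : (mono hϖ w)⁻¹ * (x⁻¹ * x') * mono hϖ v = y * y'⁻¹ := by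
    have h2 : mono hϖ v = x'⁻¹ * (x * mono hϖ w * y) * y'⁻¹ := by rw [h]; group
    rw [h2]; group
  rw [e]
  exact mul_mem hy (inv_mem hy')

/-- The quotient of the ring of integers by a power of the maximal ideal. -/
abbrev Quo (F : Type*) [Field F] [ValuativeRel F] [TopologicalSpace F]
    [IsNonarchimedeanLocalField F] (n : ℕ) : Type _ := 𝒪[F] ⧸ 𝓂[F] ^ n

theorem card_quo (n : ℕ) : Nat.card (Quo F n) = Nat.card 𝓀[F] ^ n := by
  have h := cardQuot_pow_of_prime (P := 𝓂[F]) (IsDiscreteValuationRing.not_a_field _) (i := n)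
  rwa [Submodule.cardQuot_apply, Submodule.cardQuot_apply] at h

instance (n : ℕ) : Finite (Quo F n) :=
  Nat.finite_of_card_ne_zero (by
    rw [card_quo]; exact pow_ne_zero _ Nat.card_pos.ne')

noncomputable instance (n : ℕ) : Fintype (Quo F n) := Fintype.ofFinite _

/-- A representative of a residue class. -/
noncomputable def lift {n : ℕ} (a : Quo F n) : 𝒪[F] := Function.surjInv Ideal.Quotient.mk_surjective a

theorem mk_lift {n : ℕ} (a : Quo F n) : Ideal.Quotient.mk _ (lift a) = a :=
  Function.surjInv_eq Ideal.Quotient.mk_surjective a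

include hϖ in
theorem mk_eq_mk_iff {n : ℕ} {a b : 𝒪[F]} : Ideal.Quotient.mk (𝓂[F] ^ n) a =
    Ideal.Quotient.mk (𝓂[F] ^ n) b ↔ (a - b : F) ∈ frac ϖ n := by
  rw [Ideal.Quotient.mk_eq_mk_iff_sub_mem, mem_maximalIdeal_pow hϖ]; rfl

theorem root_coset_eq_iff {w : AffWeyl} {i : Fin 2} (hi : len w = 0 ∨ firstLetter w = i)
    {a b : 𝒪[F]} : (root ϖ i (a : F) * mono hϖ w : SpecialLinearGroup (Fin 2) F ⧸ iwahori F) =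
      (root ϖ i (b : F) * mono hϖ w : SpecialLinearGroup (Fin 2) F) ↔
      (a - b : F) ∈ frac ϖ (len w) := by
  rw [← neg_mem_iff, neg_sub,
    ← conj_root_mem_iff hϖ hi (sub_mem (coe_mem_frac_zero b) (coe_mem_frac_zero a))]
  rw [QuotientGroup.eq, sub_eq_neg_add, root_add, root_neg]
  rw [_root_.mul_inv_rev]
  simp only [mul_assoc]

/-- The coset indexed by an element of the affine Weyl group and a residue class. -/
noncomputable def cosetMap (p : Σ w : AffWeyl, Quo F (len w)) :
    SpecialLinearGroup (Fin 2) F ⧸ iwahori F :=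
  ((root ϖ (firstLetter p.1) (lift p.2 : F) * mono hϖ p.1 : SpecialLinearGroup (Fin 2) F))

/-- With `exists_cosetMap_eq` this parametrizes the cosets gI in the union of the cells by pairs of
a Weyl group element w and a class modulo the ℓ(w)-th power of the maximal ideal. -/
theorem cosetMap_injective : Function.Injective (cosetMap hϖ) := by
  rintro ⟨w, a⟩ ⟨v, b⟩ h
  have hwv : w = v := by
    rw [cosetMap, cosetMap, QuotientGroup.eq] at h
    refine eq_of_conj_mem hϖ (M := (root ϖ (firstLetter w) (lift a : F))⁻¹ *
      root ϖ (firstLetter v) (lift b : F)) (mul_mem (inv_mem ?_) ?_) ?_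
    · exact root_mem_iwahori hϖ _ (coe_mem_frac_zero _)
    · exact root_mem_iwahori hϖ _ (coe_mem_frac_zero _)
    · rw [_root_.mul_inv_rev] at h
      simp only [mul_assoc] at h ⊢
      exact h
  subst hwv
  have := (root_coset_eq_iff hϖ (Or.inr rfl)).1 h
  rw [← mk_eq_mk_iff hϖ, mk_lift, mk_lift] at this
  exact congrArg _ this

theorem mem_cell_of_mk_eq_cosetMap {p : Σ w : AffWeyl, Quo F (len w)}
    {g : SpecialLinearGroup (Fin 2) F} (h : cosetMap hϖ p = g) : g ∈ cell hϖ p.1 := by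
  rw [cosetMap, QuotientGroup.eq] at h
  rw [mem_cell_iff]
  exact ⟨_, root_mem_iwahori hϖ (firstLetter p.1) (coe_mem_frac_zero (lift p.2)), _, h,
    (mul_inv_cancel_left _ _).symm⟩

theorem exists_cosetMap_eq {w : AffWeyl} {g : SpecialLinearGroup (Fin 2) F}
    (h : g ∈ cell hϖ w) : ∃ a, cosetMap hϖ ⟨w, a⟩ = g := by
  obtain ⟨x, hx, y, hy, rfl⟩ := (mem_cell_iff hϖ).1 h
  obtain ⟨a, ha⟩ := exists_root_mul_conj_mem hϖ hx w
  refine ⟨Ideal.Quotient.mk _ a, ?_⟩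
  have h1 : cosetMap hϖ ⟨w, Ideal.Quotient.mk _ a⟩ =
      ((root ϖ (firstLetter w) (a : F) * mono hϖ w : SpecialLinearGroup (Fin 2) F) :
        SpecialLinearGroup (Fin 2) F ⧸ iwahori F) := by
    refine (root_coset_eq_iff hϖ (Or.inr rfl)).2 ?_
    rw [← mk_eq_mk_iff hϖ, mk_lift]
  rw [h1, QuotientGroup.eq]
  rw [root_neg] at ha
  have := mul_mem ha hy
  have e : (mono hϖ w)⁻¹ * ((root ϖ (firstLetter w) (a : F))⁻¹ * x) * mono hϖ w * y =
    (root ϖ (firstLetter w) (a : F) * mono hϖ w)⁻¹ * (x * mono hϖ w * y) := by group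
  rwa [e] at this

end Cells

/-! ### The function t_{s_i} on double cosets -/

section Specialization

variable {F : Type*} [Field F] [ValuativeRel F] [TopologicalSpace F]
  [IsNonarchimedeanLocalField F] {ϖ : 𝒪[F]} (hϖ : Irreducible ϖ)

variable (F) in
/-- The cardinality of the residue field. -/
noncomputable def resCard : ℕ := Nat.card 𝓀[F]

variable (F) in
theorem one_lt_resCard : 1 < resCard F := Finite.one_lt_card

variable (F) in
theorem resCard_ne_zero : (resCard F : ℂ) ≠ 0 := by
  have := one_lt_resCard F
  exact_mod_cast (by omega : resCard F ≠ 0)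

variable (F) in
theorem sqrtq_mul_self : ((sqrtq F : ℂˣ) : ℂ) * (sqrtq F : ℂˣ) = resCard F := by
  change ((Real.sqrt (Nat.card 𝓀[F]) : ℝ) : ℂ) * ((Real.sqrt (Nat.card 𝓀[F]) : ℝ) : ℂ) = _
  rw [← Complex.ofReal_mul, Real.mul_self_sqrt (Nat.cast_nonneg _), Complex.ofReal_natCast]
  rfl

variable (F) in
/-- The number `-1/q`. -/
noncomputable def negInv : ℂ := -(resCard F : ℂ)⁻¹

variable (F) in
theorem norm_negInv : ‖negInv F‖ = (resCard F : ℝ)⁻¹ := by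
  rw [negInv, norm_neg, norm_inv, Complex.norm_natCast]

variable (F) in
theorem norm_negInv_lt_one : ‖negInv F‖ < 1 := by
  rw [norm_negInv]
  exact inv_lt_one_of_one_lt₀ (by exact_mod_cast one_lt_resCard F)

variable (F) in
theorem resCard_mul_negInv : (resCard F : ℂ) * negInv F = -1 := by
  rw [negInv, mul_neg, mul_inv_cancel₀ (resCard_ne_zero F)]

variable (F) in
theorem one_sub_negInv_ne_zero : 1 - negInv F ≠ 0 := by
  intro h
  have := norm_negInv_lt_one F
  rw [← sub_eq_zero.1 h, norm_one] at this
  exact lt_irrefl _ this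

/-- The least length of an element `≥ w` with first letter `i`. -/
def lowIndex (i : Fin 2) (w : AffWeyl) : ℕ :=
  if w = 1 then 1 else if firstLetter w = i then len w else len w + 1

/-- Along the ray of words starting with i, the elements above y form a final segment. The sum
defining the value of t_{s_i} is therefore a geometric tail. -/
theorem mem_bruhatIic_altElt_iff (i : Fin 2) (n : ℕ) (y : AffWeyl) :
    y ∈ bruhatIic (altElt i (n + 1)) ↔ lowIndex i y ≤ n + 1 := by
  rw [mem_bruhatIic_altElt, lowIndex]
  split_ifs with h1 h2
  · subst h1; simp [len_one]
  · have h3 := eq_altElt y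
    rw [h2] at h3
    constructor
    · rintro (h | h)
      · rw [h, (len_altElt _ _).1]
      · omega
    · intro h
      rcases h.lt_or_eq with h | h
      · exact Or.inr h
      · exact Or.inl (by rw [← h]; exact h3)
  · constructor
    · rintro (h | h)
      · rw [h, firstLetter_altElt] at h2; exact absurd rfl h2
      · omega
    · intro h; exact Or.inr (by omega)

theorem lowIndex_pos (i : Fin 2) (w : AffWeyl) : 1 ≤ lowIndex i w := by
  rw [lowIndex]
  split_ifs with h1
  · exact le_rfl
  · by_contra h
    exact h1 (eq_one_of_len (by omega))
  · omega

theorem len_le_lowIndex (i : Fin 2) (w : AffWeyl) : len w ≤ lowIndex i w := by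
  rw [lowIndex]
  split_ifs with h1
  · rw [h1, len_one]; omega
  · exact le_rfl
  · omega

variable (F) in
/-- The value of `t_{s_i}` on the double coset of `w`. -/
noncomputable def tVal (i : Fin 2) (w : AffWeyl) : ℂ :=
  -- The tail -∑ r^n over n ≥ `lowIndex i w`, with r = -1/q.
  -negInv F ^ lowIndex i w / (1 - negInv F)

/-- The function `t_{s_i}`. -/
noncomputable def tFun (i : Fin 2) (g : SpecialLinearGroup (Fin 2) F) : ℂ :=
  -- That the cells cover the group is not needed: outside all of them every T_w vanishes, so zero
  -- is the correct value.
  open Classical in if h : ∃ w, g ∈ cell hϖ w then tVal F i h.choose else 0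

theorem tFun_of_mem (i : Fin 2) {w : AffWeyl} {g : SpecialLinearGroup (Fin 2) F}
    (h : g ∈ cell hϖ w) : tFun hϖ i g = tVal F i w := by
  have h' : ∃ w, g ∈ cell hϖ w := ⟨w, h⟩
  rw [tFun, dif_pos h', eq_of_mem_cell hϖ h'.choose_spec h]

theorem tFun_of_forall_not_mem (i : Fin 2) {g : SpecialLinearGroup (Fin 2) F}
    (h : ∀ w, g ∉ cell hϖ w) : tFun hϖ i g = 0 := by
  rw [tFun, dif_neg (by simpa using h)]

theorem klPrime_apply (w y : AffWeyl) :
    klPrime w y = if y ∈ bruhatIic w then LaurentPolynomial.T (-(len w : ℤ)) else 0 := by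
  rw [klPrime, Finsupp.finsetSum_apply]
  simp only [stdT, Finsupp.smul_single, smul_eq_mul, mul_one, Finsupp.single_apply]
  rw [Finset.sum_ite_eq']

theorem heckeFun_klPrime (w : AffWeyl) (g : SpecialLinearGroup (Fin 2) F) :
    heckeFun hϖ (klPrime w) g = ∑ y ∈ bruhatIic w,
      ((sqrtq F ^ (-(len w : ℤ)) : ℂˣ) : ℂ) * Set.indicator (cell hϖ y) 1 g := by
  rw [heckeFun, Finsupp.sum_of_support_subset _ (s := bruhatIic w)]
  · refine Finset.sum_congr rfl fun y hy => ?_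
    rw [klPrime_apply, if_pos hy, LaurentPolynomial.eval₂_T]
  · intro y hy
    rw [Finsupp.mem_support_iff, klPrime_apply] at hy
    by_contra h
    exact hy (if_neg h)
  · intro y _
    rw [map_zero, zero_mul]

theorem heckeFun_klPrime_of_mem (w : AffWeyl) {y : AffWeyl} {g : SpecialLinearGroup (Fin 2) F}
    (hg : g ∈ cell hϖ y) : heckeFun hϖ (klPrime w) g =
      if y ∈ bruhatIic w then ((sqrtq F ^ (-(len w : ℤ)) : ℂˣ) : ℂ) else 0 := by
  rw [heckeFun_klPrime]
  have h : ∀ z, ((sqrtq F ^ (-(len w : ℤ)) : ℂˣ) : ℂ) * Set.indicator (cell hϖ z) 1 g =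
      if z = y then ((sqrtq F ^ (-(len w : ℤ)) : ℂˣ) : ℂ) else 0 := by
    intro z
    split_ifs with hz
    · rw [hz, Set.indicator_of_mem hg, Pi.one_apply, mul_one]
    · rw [Set.indicator_of_notMem (fun hz' => hz (eq_of_mem_cell hϖ hz' hg)), mul_zero]
  rw [Finset.sum_congr rfl fun z _ => h z, Finset.sum_ite_eq']

variable (F) in
/-- The coefficients of `t_{s_i}`, specialized. -/
noncomputable def tCoeffVal (i : Fin 2) (w : AffWeyl) : ℂ :=
  if w ≠ 1 ∧ firstLetter w = i then
    -(-1) ^ len w * ((sqrtq F ^ (-(len w : ℤ)) : ℂˣ) : ℂ) else 0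

theorem hasSum_tCoeff (i : Fin 2) (w : AffWeyl) :
    HasSum (fun k : ℤ => ((tCoeff i w).coeff k : ℂ) * ((sqrtq F ^ (-k) : ℂˣ) : ℂ))
      (tCoeffVal F i w) := by
  rw [tCoeff, tCoeffVal]
  split_ifs
  · convert hasSum_single (len w : ℤ) _ using 1
    · rw [HahnSeries.coeff_single_same]; push_cast; rfl
    · intro k hk
      rw [HahnSeries.coeff_single_of_ne hk, Int.cast_zero, zero_mul]
  · simp [hasSum_zero]

theorem hasSum_tail (N : ℕ) {r : ℂ} (hr : ‖r‖ < 1) :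
    HasSum (fun n : ℕ => if N + 1 ≤ n + 1 then -r ^ (n + 1) else 0) (-r ^ (N + 1) / (1 - r)) := by
  have hinj : Function.Injective (fun k : ℕ => N + k) := fun a b h => Nat.add_left_cancel h
  rw [← hinj.hasSum_iff]
  · have := (hasSum_geometric_of_norm_lt_one hr).mul_left (-r ^ (N + 1))
    rw [← div_eq_mul_inv] at this
    have e : (fun n : ℕ => if N + 1 ≤ n + 1 then -r ^ (n + 1) else 0) ∘ (fun k => N + k) =
        fun k => -r ^ (N + 1) * r ^ k := by
      funext k
      rw [Function.comp_apply, if_pos (by omega)]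
      ring
    rwa [e]
  · intro n hn
    rw [if_neg]
    intro h
    exact hn ⟨n - N, by simp only; omega⟩

/-- The coefficient -(-1)^n q^(-n/2) meets the factor q^(-n/2) in the definition of C'_w, so each w
≥ y of length n on the ray contributes -(-1/q)^n to the value on the cell of y. -/
theorem isSpecialization_tFun (i : Fin 2) : IsSpecialization hϖ (tCoeff i) (tFun hϖ i) := by
  refine ⟨tCoeffVal F i, hasSum_tCoeff i, fun g => ?_⟩
  by_cases hg : ∃ y, g ∈ cell hϖ y
  · obtain ⟨y, hy⟩ := hg
    rw [tFun_of_mem hϖ i hy, tVal]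
    have hinj : Function.Injective (fun n : ℕ => altElt i (n + 1)) := by
      intro m n h
      have := congrArg len h
      simp only [(len_altElt _ _).1] at this
      omega
    rw [← hinj.hasSum_iff]
    · obtain ⟨N, hN⟩ := Nat.exists_eq_add_of_le' (lowIndex_pos i y)
      rw [hN]
      convert hasSum_tail N (norm_negInv_lt_one F) using 2 with n
      simp only [Function.comp_apply]
      rw [heckeFun_klPrime_of_mem hϖ _ hy, if_congr (mem_bruhatIic_altElt_iff i n y) rfl rfl, hN,
        tCoeffVal, if_pos ⟨altElt_succ_ne_one i n, firstLetter_altElt i n⟩, (len_altElt _ _).1]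
      split_ifs
      · rw [mul_assoc, ← Units.val_mul, ← mul_zpow, ← neg_one_mul (negInv F ^ (n + 1)), negInv,
          _root_.zpow_neg, zpow_natCast, Units.val_inv_eq_inv_val, Units.val_pow_eq_pow_val,
          Units.val_mul, sqrtq_mul_self, neg_pow (resCard F : ℂ)⁻¹, inv_pow]
        ring
      · rw [mul_zero]
    · intro w hw
      rw [tCoeffVal, if_neg, zero_mul]
      rintro ⟨h1, h2⟩
      refine hw ⟨len w - 1, ?_⟩
      have h3 : len w ≠ 0 := fun h => h1 (eq_one_of_len h)
      simp only
      rw [Nat.sub_add_cancel (by omega), ← h2, ← eq_altElt]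
  · push Not at hg
    rw [tFun_of_forall_not_mem hϖ i hg]
    convert hasSum_zero with w
    rw [heckeFun_klPrime, Finset.sum_eq_zero, mul_zero]
    intro y _
    rw [Set.indicator_of_notMem (hg y), mul_zero]

end Specialization

/-- Fibres of a surjective homomorphism have equal size. The double sum of f (φ a + b) over A × B,
evaluated in both orders, gives this by translation invariance. -/
theorem card_mul_sum_comp {A B : Type*} [AddCommGroup A] [AddCommGroup B] [Fintype A] [Fintype B]
    (φ : A →+ B) (hφ : Function.Surjective φ) (f : B → ℂ) :
    (Fintype.card B : ℂ) * ∑ a, f (φ a) = Fintype.card A * ∑ b, f b := by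
  have h1 : ∀ b : B, ∑ a, f (φ a + b) = ∑ a, f (φ a) := by
    intro b
    obtain ⟨c, rfl⟩ := hφ b
    simp only [← map_add]
    exact Equiv.sum_comp (Equiv.addRight c) (fun a => f (φ a))
  have h2 : ∀ a : A, ∑ b, f (φ a + b) = ∑ b, f b := fun a =>
    Equiv.sum_comp (Equiv.addLeft (φ a)) f
  have h3 := Finset.sum_comm (s := Finset.univ) (t := Finset.univ)
    (f := fun (a : A) (b : B) => f (φ a + b))
  simp only [h1, h2, Finset.sum_const, Finset.card_univ, nsmul_eq_mul] at h3
  exact h3.symm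

/-- Lengthening a nonempty reduced word on the right keeps its first letter, so w and w s_j use the
same root subgroup. -/
theorem firstLetter_mul_gen {w : AffWeyl} {j : Fin 2} (h : len (w * gen j) = len w + 1) :
    len w = 0 ∨ firstLetter w = firstLetter (w * gen j) := by
  rcases w with n | n <;> change ℤ at n
  · rw [r_mul_gen, len_sr, len_r] at h
    rw [r_mul_gen, len_r, firstLetter_r, firstLetter_sr]
    obtain rfl | rfl : j = 0 ∨ j = 1 := eq_or_eq_one_sub j 0 <;>
    · simp at h ⊢
      split_ifs <;> simp <;> omega
  · rw [sr_mul_gen, len_sr, len_r] at h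
    rw [sr_mul_gen, len_sr, firstLetter_r, firstLetter_sr]
    obtain rfl | rfl : j = 0 ∨ j = 1 := eq_or_eq_one_sub j 0 <;>
    · simp at h ⊢
      split_ifs <;> simp <;> omega

/-! ### Sums over the cosets in one double coset -/

section OrbitSums

variable {F : Type*} [Field F] [ValuativeRel F] [TopologicalSpace F]
  [IsNonarchimedeanLocalField F] {ϖ : 𝒪[F]} (hϖ : Irreducible ϖ)

theorem fintype_card_quo (n : ℕ) : Fintype.card (Quo F n) = resCard F ^ n := by
  rw [← Nat.card_eq_fintype_card, card_quo]; rfl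

/-- Reduction of residue classes. -/
noncomputable def reduce {m n : ℕ} (h : m ≤ n) : Quo F n →+* Quo F m :=
  Ideal.Quotient.factor (Ideal.pow_le_pow_right h)

theorem reduce_mk {m n : ℕ} (h : m ≤ n) (a : 𝒪[F]) :
    reduce h (Ideal.Quotient.mk (𝓂[F] ^ n) a) = Ideal.Quotient.mk (𝓂[F] ^ m) a := rfl

theorem reduce_surjective {m n : ℕ} (h : m ≤ n) :
    Function.Surjective (reduce h : Quo F n →+* Quo F m) := by
  intro a
  exact ⟨Ideal.Quotient.mk _ (lift a), by rw [reduce_mk, mk_lift]⟩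

theorem inv_mul_mulVec (g h : SpecialLinearGroup (Fin 2) F) (x : Fin 2 → F) :
    ((g * h)⁻¹).1 *ᵥ x = (h⁻¹).1 *ᵥ ((g⁻¹).1 *ᵥ x) := by
  rw [mulVec_mulVec, _root_.mul_inv_rev]; rfl

/-- Invariance under a single element. -/
def InvariantBy (f : (Fin 2 → F) → ℂ) (g : SpecialLinearGroup (Fin 2) F) : Prop :=
  ∀ x, f ((g⁻¹).1 *ᵥ x) = f x

theorem apply_eq_of_coset_eq {f : (Fin 2 → F) → ℂ} (hf : ∀ g ∈ iwahori F, InvariantBy f g)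
    {g h : SpecialLinearGroup (Fin 2) F}
    (hgh : (g : SpecialLinearGroup (Fin 2) F ⧸ iwahori F) = h) (x : Fin 2 → F) :
    f ((g⁻¹).1 *ᵥ x) = f ((h⁻¹).1 *ᵥ x) := by
  rw [QuotientGroup.eq] at hgh
  have h1 : h = g * (g⁻¹ * h) := by group
  rw [h1, inv_mul_mulVec, hf _ hgh]

/-- The sum of a function over the cosets in the double coset of `w`. -/
noncomputable def orbSum (f : (Fin 2 → F) → ℂ) (w : AffWeyl) (x : Fin 2 → F) : ℂ :=
  ∑ a : Quo F (len w), f (((root ϖ (firstLetter w) (lift a : F) * mono hϖ w)⁻¹).1 *ᵥ x)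

theorem orbSum_eq {f : (Fin 2 → F) → ℂ} (hf : ∀ g ∈ iwahori F, InvariantBy f g) {w : AffWeyl}
    {i : Fin 2} (hi : len w = 0 ∨ firstLetter w = i) (x : Fin 2 → F) : orbSum hϖ f w x =
      ∑ a : Quo F (len w), f (((root ϖ i (lift a : F) * mono hϖ w)⁻¹).1 *ᵥ x) := by
  rcases hi with hi | rfl
  · refine Finset.sum_congr rfl fun a _ => ?_
    have hw := eq_one_of_len hi
    have : mono hϖ w = 1 := by rw [hw, mono_one]
    rw [this, mul_one, mul_one, hf _ (root_mem_iwahori hϖ _ (coe_mem_frac_zero _)),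
      hf _ (root_mem_iwahori hϖ _ (coe_mem_frac_zero _))]
  · rfl

theorem orbSum_one {f : (Fin 2 → F) → ℂ} (hf : ∀ g ∈ iwahori F, InvariantBy f g) (x : Fin 2 → F) :
    orbSum hϖ f 1 x = f x := by
  have h : ∀ a : Quo F (len 1),
      f (((root ϖ (firstLetter 1) (lift a : F) * mono hϖ 1)⁻¹).1 *ᵥ x) = f x := by
    intro a
    rw [mono_one, mul_one, hf _ (root_mem_iwahori hϖ _ (coe_mem_frac_zero _))]
  rw [orbSum, Finset.sum_congr rfl fun a _ => h a, Finset.sum_const, Finset.card_univ,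
    fintype_card_quo, len_one, pow_zero, one_smul]

/-- A residue class for w s_j reduces to one for w, with q classes in each fibre. Invariance under
s_j and I makes the summand depend only on the reduced class. -/
theorem orbSum_mul_gen {f : (Fin 2 → F) → ℂ} (hf : ∀ g ∈ iwahori F, InvariantBy f g) {j : Fin 2}
    (hj : InvariantBy f (genMatrix hϖ j)) {w : AffWeyl} (h : len (w * gen j) = len w + 1)
    (x : Fin 2 → F) : orbSum hϖ f (w * gen j) x = resCard F * orbSum hϖ f w x := by
  have hi := firstLetter_mul_gen h
  rw [orbSum_eq hϖ hf hi, orbSum]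
  generalize firstLetter (w * gen j) = i at *
  set G : Quo F (len w) → ℂ := fun a => f (((root ϖ i (lift a : F) * mono hϖ w)⁻¹).1 *ᵥ x) with hG
  have hle : len w ≤ len (w * gen j) := by omega
  have h1 : ∀ a : Quo F (len (w * gen j)),
      f (((root ϖ i (lift a : F) * mono hϖ (w * gen j))⁻¹).1 *ᵥ x) = G (reduce hle a) := by
    intro a
    have h2 := mono_mul_gen_mem hϖ j w
    -- This element of I corrects the representative of w s_j to the product of those of w and s_j.
    set z := (mono hϖ (w * gen j))⁻¹ * (mono hϖ w * genMatrix hϖ j)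
    have h3 : root ϖ i (lift a : F) * mono hϖ (w * gen j) * z =
        root ϖ i (lift a : F) * mono hϖ w * genMatrix hϖ j := by simp only [z]; group
    rw [← hf z h2, ← inv_mul_mulVec, h3, inv_mul_mulVec, hj, hG]
    refine apply_eq_of_coset_eq hf ?_ x
    refine (root_coset_eq_iff hϖ hi).2 ?_
    rw [← mk_eq_mk_iff hϖ, mk_lift, ← reduce_mk hle, mk_lift]
  rw [Finset.sum_congr rfl fun a _ => h1 a]
  have h4 := card_mul_sum_comp (reduce hle : Quo F (len (w * gen j)) →+* _).toAddMonoidHom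
    (reduce_surjective hle) G
  have h6 : resCard F ^ len (w * gen j) = resCard F ^ len w * resCard F := by rw [h, pow_succ]
  rw [fintype_card_quo, fintype_card_quo, h6] at h4
  have h5 : (resCard F : ℂ) ^ len w ≠ 0 := pow_ne_zero _ (resCard_ne_zero F)
  push_cast at h4
  rw [mul_assoc] at h4
  exact mul_left_cancel₀ h5 h4

/-! ### Bounds for the number of cosets -/

/-- The set lies in one fibre of the reduction. Adding lifts of the classes modulo the e-th power
gives disjoint translates inside the whole quotient. -/
theorem card_filter_le {n : ℕ} (S : Finset (Quo F n)) {e : ℕ} (he : e ≤ n)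
    (hS : ∀ a ∈ S, ∀ b ∈ S, reduce he a = reduce he b) : S.card ≤ resCard F ^ (n - e) := by
  have h1 : S.card * resCard F ^ e ≤ resCard F ^ n := by
    rw [← fintype_card_quo, ← fintype_card_quo, ← Finset.card_univ, ← Finset.card_product,
      ← Finset.card_univ]
    refine Finset.card_le_card_of_injOn
      (fun p => p.1 + Ideal.Quotient.mk _ (lift p.2))
      (fun _ _ => Finset.mem_coe.2 (Finset.mem_univ _)) ?_
    rintro ⟨s, b⟩ hs ⟨s', b'⟩ hs' h
    simp only [Finset.coe_product, Set.mem_prod, Finset.mem_coe] at hs hs' h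
    have h2 := congrArg (reduce he) h
    rw [map_add, map_add, hS s hs.1 s' hs'.1, reduce_mk, reduce_mk, mk_lift, mk_lift] at h2
    have h3 := add_left_cancel h2
    subst h3
    rw [add_right_cancel h]
  have h2 : resCard F ^ n = resCard F ^ (n - e) * resCard F ^ e := by
    rw [← pow_add, Nat.sub_add_cancel he]
  rw [h2] at h1
  exact Nat.le_of_mul_le_mul_right h1 (pow_pos (by have := one_lt_resCard F; omega) _)

include hϖ in
-- If Y ≠ 0 the congruence fixes a modulo a power with exponent n/2 up to a constant, which leaves
-- O(q^(n/2)) classes. If Y = 0 it can hold only for bounded n. The summand 1 in J accounts for odd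
-- n.
theorem exists_card_le {X Y : F} (h : X ≠ 0 ∨ Y ≠ 0) (m : ℤ) : ∃ J : ℕ, ∀ n : ℕ,
    ∀ S : Finset (Quo F n), (∀ a ∈ S, X - lift a * Y ∈ frac ϖ (m + (n / 2 : ℕ))) →
      S.card ≤ resCard F ^ (n / 2 + J) := by
  have hq : 0 < resCard F := by have := one_lt_resCard F; omega
  by_cases hY : Y = 0
  · have hX : X ≠ 0 := by tauto
    obtain ⟨j, hj⟩ := exists_valuation_eq hϖ hX
    refine ⟨(j - m).toNat + 1, fun n S hS => ?_⟩
    rcases S.eq_empty_or_nonempty with rfl | ⟨a, ha⟩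
    · simp
    · have h1 := hS a ha
      rw [hY, mul_zero, sub_zero, mem_frac, hj, valuation_zpow_le_zpow hϖ] at h1
      refine (Finset.card_le_univ S).trans ?_
      rw [fintype_card_quo]
      exact Nat.pow_le_pow_right hq (by omega)
  · obtain ⟨j, hj⟩ := exists_valuation_eq hϖ hY
    refine ⟨(j - m).toNat + 1, fun n S hS => ?_⟩
    set e : ℕ := min n (m + (n / 2 : ℕ) - j).toNat with he
    have hen : e ≤ n := min_le_left _ _
    refine (card_filter_le S hen fun a ha b hb => ?_).trans (Nat.pow_le_pow_right hq (by omega))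
    have h1 := sub_mem (hS b hb) (hS a ha)
    have h2 : X - lift b * Y - (X - lift a * Y) = (lift a - lift b) * Y := by ring
    rw [h2, mem_frac, map_mul, hj, ← le_div_iff₀ (zero_lt_iff.2 (zpow_ne_zero _
      (valuation_ne_zero hϖ))), ← zpow_sub₀ (valuation_ne_zero hϖ), ← mem_frac] at h1
    rw [← mk_lift a, ← mk_lift b, reduce_mk, reduce_mk, mk_eq_mk_iff hϖ]
    rcases le_total 0 (m + (n / 2 : ℕ) - j) with h3 | h3
    · exact frac_mono hϖ (by omega) h1
    · have h4 : (e : ℤ) = 0 := by omega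
      rw [h4]
      exact sub_mem (coe_mem_frac_zero _) (coe_mem_frac_zero _)

/-- The lattice `ϖ ^ m 𝒪²`. -/
def ball (ϖ : 𝒪[F]) (m : ℤ) : Set (Fin 2 → F) := {x | x 0 ∈ frac ϖ m ∧ x 1 ∈ frac ϖ m}

theorem mono_r_inv_mulVec (k : ℤ) (y : Fin 2 → F) :
    ((mono hϖ (.r k))⁻¹).1 *ᵥ y = ![(ϖ : F) ^ (-k) * y 0, (ϖ : F) ^ k * y 1] := by
  change adjugate (mono hϖ (.r k)).1 *ᵥ y = _
  rw [mono_r, adjugate_fin_two_of]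
  ext i
  fin_cases i <;> simp [mulVec, dotProduct, Fin.sum_univ_two]

theorem mono_sr_inv_mulVec (k : ℤ) (y : Fin 2 → F) :
    ((mono hϖ (.sr k))⁻¹).1 *ᵥ y = ![(ϖ : F) ^ (-k) * y 1, -((ϖ : F) ^ k * y 0)] := by
  change adjugate (mono hϖ (.sr k)).1 *ᵥ y = _
  rw [mono_sr, adjugate_fin_two_of]
  ext i
  fin_cases i <;> simp [mulVec, dotProduct, Fin.sum_univ_two]

theorem root_zero_inv_mulVec (a : F) (x : Fin 2 → F) :
    ((root ϖ 0 a)⁻¹).1 *ᵥ x = ![x 0 - a * x 1, x 1] := by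
  rw [← root_neg, root_zero_val]
  ext i
  fin_cases i <;> simp [mulVec, dotProduct, Fin.sum_univ_two]; ring

theorem root_one_inv_mulVec (a : F) (x : Fin 2 → F) :
    ((root ϖ 1 a)⁻¹).1 *ᵥ x = ![x 0, x 1 - a * (ϖ * x 0)] := by
  rw [← root_neg, root_one_val]
  ext i
  fin_cases i <;> simp [mulVec, dotProduct, Fin.sum_univ_two]; ring

/-- The inverse of the representative of w scales the coordinate moved by the root subgroup of the
first letter by a power of ϖ with exponent at most -⌊ℓ(w)/2⌋, so landing in a fixed lattice is a
strong congruence on that coordinate. -/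
theorem sub_mem_frac_of_mem_ball {w : AffWeyl} {a : F} {x : Fin 2 → F} {m : ℤ}
    (h : ((root ϖ (firstLetter w) a * mono hϖ w)⁻¹).1 *ᵥ x ∈ ball ϖ m) :
    (firstLetter w = 0 → x 0 - a * x 1 ∈ frac ϖ (m + (len w / 2 : ℕ))) ∧
      (firstLetter w = 1 → x 1 - a * (ϖ * x 0) ∈ frac ϖ (m + (len w / 2 : ℕ))) := by
  rw [inv_mul_mulVec] at h
  constructor <;> intro hw <;> rw [hw] at h
  · rw [root_zero_inv_mulVec] at h
    rcases w with k | k <;> change ℤ at k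
    · rw [firstLetter_r] at hw
      have hk : 0 < k := by split_ifs at hw <;> simp at hw; omega
      rw [mono_r_inv_mulVec] at h
      have h1 := h.1
      simp only [cons_val_zero, cons_val_one, zpow_mul_mem_frac hϖ] at h1
      rw [len_r]
      exact frac_mono hϖ (by omega) h1
    · rw [firstLetter_sr] at hw
      have hk : k ≤ 0 := by split_ifs at hw <;> simp at hw; omega
      rw [mono_sr_inv_mulVec] at h
      have h1 := h.2
      simp only [cons_val_zero, cons_val_one, zpow_mul_mem_frac hϖ, neg_mem_iff] at h1
      rw [len_sr]
      exact frac_mono hϖ (by omega) h1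
  · rw [root_one_inv_mulVec] at h
    rcases w with k | k <;> change ℤ at k
    · rw [firstLetter_r] at hw
      have hk : k ≤ 0 := by split_ifs at hw <;> simp at hw; omega
      rw [mono_r_inv_mulVec] at h
      have h1 := h.2
      simp only [cons_val_zero, cons_val_one, zpow_mul_mem_frac hϖ] at h1
      rw [len_r]
      exact frac_mono hϖ (by omega) h1
    · rw [firstLetter_sr] at hw
      have hk : 0 < k := by split_ifs at hw <;> simp at hw; omega
      rw [mono_sr_inv_mulVec] at h
      have h1 := h.1
      simp only [cons_val_zero, cons_val_one, zpow_mul_mem_frac hϖ] at h1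
      rw [len_sr]
      exact frac_mono hϖ (by omega) h1

end OrbitSums

/-! ### Absolute convergence and cancellation in the convolution -/

theorem len_mul_gen (w : AffWeyl) (j : Fin 2) :
    len (w * gen j) = len w + 1 ∨ len w = len (w * gen j) + 1 := by
  have h1 := len_inv w
  have h2 := len_inv (w * gen j)
  rw [_root_.mul_inv_rev, gen_inv] at h2
  rcases len_gen_mul j w⁻¹ with h | h
  · left; omega
  · right; omega

theorem firstLetter_gen (j : Fin 2) : firstLetter (gen j) = j := by
  fin_cases j <;> decide

/-- The index normally grows with the length. The exception is the step from 1 to s_i, because s_i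
is the least nontrivial element of its ray and lies above both. -/
theorem lowIndex_mul_gen {i j : Fin 2} {w : AffWeyl} (h : len (w * gen j) = len w + 1) :
    lowIndex i (w * gen j) = if w = 1 ∧ i = j then 1 else lowIndex i w + 1 := by
  have h1 : w * gen j ≠ 1 := ne_one_of_len_succ h
  by_cases hw : w = 1
  · subst hw
    simp only [lowIndex, one_mul, gen_ne_one, if_false, if_true, firstLetter_gen, len_gen, true_and,
      @eq_comm _ j i]
  · have h2 := (firstLetter_mul_gen h).resolve_left fun h => hw (eq_one_of_len h)
    simp only [lowIndex, h1, hw, if_false, false_and, ← h2, h]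
    split_ifs <;> rfl

section Convolution

variable {F : Type*} [Field F] [ValuativeRel F] [TopologicalSpace F]
  [IsNonarchimedeanLocalField F] {ϖ : 𝒪[F]} (hϖ : Irreducible ϖ)

variable (F) in
-- With r = -1/q one has 1 + qr = 0, which gives cancellation when the index grows. In the
-- exceptional case the sum is -r(1 + q)/(1 - r) = 1.
theorem tVal_add {i j : Fin 2} {w : AffWeyl} (h : len (w * gen j) = len w + 1) :
    tVal F i w + resCard F * tVal F i (w * gen j) = if w = 1 ∧ i = j then 1 else 0 := by
  have h0 := one_sub_negInv_ne_zero F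
  have h1 := resCard_mul_negInv F
  rw [tVal, tVal, lowIndex_mul_gen h]
  split_ifs with hw
  · rw [lowIndex, if_pos hw.1, pow_one]
    field_simp
    linear_combination -h1
  · rw [pow_succ]
    field_simp
    linear_combination (-negInv F ^ lowIndex i w) * h1

variable (F) in
theorem norm_tVal_le (i : Fin 2) (w : AffWeyl) : ‖tVal F i w‖ ≤ ((resCard F : ℝ)⁻¹) ^ len w := by
  have hq : (1 : ℝ) < resCard F := by exact_mod_cast one_lt_resCard F
  have h1 : 1 - negInv F = ((1 + (resCard F : ℝ)⁻¹ : ℝ) : ℂ) := by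
    rw [negInv]; push_cast; ring
  have h2 : 1 ≤ ‖1 - negInv F‖ := by
    rw [h1, Complex.norm_real, Real.norm_of_nonneg (by positivity)]
    have : 0 ≤ (resCard F : ℝ)⁻¹ := by positivity
    linarith
  rw [tVal, norm_div, norm_neg, norm_pow, norm_negInv]
  refine (div_le_self (by positivity) h2).trans ?_
  exact pow_le_pow_of_le_one (by positivity) (inv_le_one_of_one_le₀ hq.le) (len_le_lowIndex i w)

variable (F) in
theorem pow_half_div_le (n : ℕ) : ((resCard F : ℝ)⁻¹) ^ n * (resCard F : ℝ) ^ (n / 2) ≤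
    ((Real.sqrt (resCard F))⁻¹) ^ n := by
  have hq : (1 : ℝ) < resCard F := by exact_mod_cast one_lt_resCard F
  have h1 : 1 ≤ Real.sqrt (resCard F) := Real.one_le_sqrt.2 hq.le
  have h2 : Real.sqrt (resCard F) ^ 2 = resCard F := Real.sq_sqrt (by positivity)
  have h3 : (resCard F : ℝ) ^ (n / 2) ≤ Real.sqrt (resCard F) ^ n := by
    conv_lhs => rw [← h2, ← pow_mul]
    exact pow_le_pow_right₀ h1 (by omega)
  have h4 : ((resCard F : ℝ)⁻¹) ^ n = ((Real.sqrt (resCard F))⁻¹) ^ n *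
      ((Real.sqrt (resCard F))⁻¹) ^ n := by
    rw [← mul_pow, ← mul_inv, ← sq, h2]
  rw [h4, mul_assoc]
  refine mul_le_of_le_one_right (by positivity) ?_
  rw [inv_pow]
  exact inv_mul_le_one_of_le₀ h3 (by positivity)

variable (F) in
theorem summable_len : Summable fun w : AffWeyl => ((Real.sqrt (resCard F))⁻¹) ^ len w := by
  have hq : (1 : ℝ) < resCard F := by exact_mod_cast one_lt_resCard F
  have h1 : (Real.sqrt (resCard F))⁻¹ < 1 :=
    inv_lt_one_of_one_lt₀ (by rw [Real.lt_sqrt zero_le_one]; simpa using hq)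
  have h2 : Summable fun p : Fin 2 × ℕ => ((Real.sqrt (resCard F))⁻¹) ^ p.2 := by
    rw [summable_prod_of_nonneg (fun _ => by positivity)]
    exact ⟨fun _ => summable_geometric_of_lt_one (by positivity) h1, Summable.of_finite⟩
  have h3 : Function.Injective fun w : AffWeyl => (firstLetter w, len w) := by
    intro w v h
    rw [Prod.mk.injEq] at h
    rw [eq_altElt w, h.1, h.2, ← eq_altElt v]
  exact h2.comp_injective h3

/-- Bounded functions that vanish outside a lattice. -/
def BoundedOnBall (ϖ : 𝒪[F]) (f : (Fin 2 → F) → ℂ) : Prop :=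
  ∃ (C : ℝ) (m : ℤ), 0 ≤ C ∧ ∀ x, ‖f x‖ ≤ C ∧ (x ∉ ball ϖ m → f x = 0)

theorem exists_sum_norm_le {f : (Fin 2 → F) → ℂ} (hf : BoundedOnBall ϖ f) {x : Fin 2 → F}
    (hx : x ≠ 0) : ∃ B : ℝ, ∀ w : AffWeyl,
      ∑ a : Quo F (len w), ‖f (((root ϖ (firstLetter w) (lift a : F) * mono hϖ w)⁻¹).1 *ᵥ x)‖ ≤
        B * (resCard F : ℝ) ^ (len w / 2) := by
  classical
  obtain ⟨C, m, hC, hf⟩ := hf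
  have hx' : x 0 ≠ 0 ∨ x 1 ≠ 0 := by
    by_contra! h
    exact hx (by ext i; fin_cases i; exacts [h.1, h.2])
  have hϖ0 := coe_ne_zero hϖ
  obtain ⟨J₀, h₀⟩ := exists_card_le hϖ (X := x 0) (Y := x 1) hx' m
  obtain ⟨J₁, h₁⟩ := exists_card_le hϖ (X := x 1) (Y := ϖ * x 0)
    (hx'.symm.imp id fun h => mul_ne_zero hϖ0 h) m
  have hq : (1 : ℝ) ≤ resCard F := by exact_mod_cast (one_lt_resCard F).le
  refine ⟨C * (resCard F : ℝ) ^ (J₀ + J₁), fun w => ?_⟩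
  set S : Finset (Quo F (len w)) := Finset.univ.filter fun a =>
    ((root ϖ (firstLetter w) (lift a : F) * mono hϖ w)⁻¹).1 *ᵥ x ∈ ball ϖ m with hS
  have hcard : S.card ≤ resCard F ^ (len w / 2 + (J₀ + J₁)) := by
    have hq' : 0 < resCard F := by have := one_lt_resCard F; omega
    have h01 : firstLetter w = 0 ∨ firstLetter w = 1 := eq_or_eq_one_sub _ 0
    rcases h01 with hw | hw
    · refine (h₀ (len w) S fun a ha => ?_).trans (Nat.pow_le_pow_right hq' (by omega))
      exact (sub_mem_frac_of_mem_ball hϖ (Finset.mem_filter.1 ha).2).1 hw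
    · refine (h₁ (len w) S fun a ha => ?_).trans (Nat.pow_le_pow_right hq' (by omega))
      exact (sub_mem_frac_of_mem_ball hϖ (Finset.mem_filter.1 ha).2).2 hw
  rw [← Finset.sum_subset (Finset.subset_univ S) fun a _ ha => by
    rw [(hf _).2 (fun h => ha (Finset.mem_filter.2 ⟨Finset.mem_univ _, h⟩)), norm_zero]]
  refine (Finset.sum_le_card_nsmul _ _ C fun a _ => (hf _).1).trans ?_
  rw [nsmul_eq_mul]
  have h2 : (S.card : ℝ) ≤ (resCard F : ℝ) ^ (len w / 2 + (J₀ + J₁)) := by exact_mod_cast hcard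
  calc (S.card : ℝ) * C ≤ (resCard F : ℝ) ^ (len w / 2 + (J₀ + J₁)) * C :=
        mul_le_mul_of_nonneg_right h2 hC
    _ = _ := by rw [pow_add]; ring

/-- The bound q^(-ℓ) on the coefficients outweighs the O(q^(ℓ/2)) nonzero terms per double coset.
The resulting bound q^(-ℓ/2) is summable because there are at most two elements of each length. -/
theorem summable_convolution {f : (Fin 2 → F) → ℂ} (hf : BoundedOnBall ϖ f) {x : Fin 2 → F}
    (hx : x ≠ 0) (i : Fin 2) : Summable fun p : Σ w : AffWeyl, Quo F (len w) =>
      tVal F i p.1 * f (((root ϖ (firstLetter p.1) (lift p.2 : F) * mono hϖ p.1)⁻¹).1 *ᵥ x) := by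
  refine Summable.of_norm ?_
  rw [summable_sigma_of_nonneg fun _ => norm_nonneg _]
  refine ⟨fun w => Summable.of_finite, ?_⟩
  obtain ⟨B, hB⟩ := exists_sum_norm_le hϖ hf hx
  have hB0 : 0 ≤ B := by
    have := (Finset.sum_nonneg fun a _ => norm_nonneg _).trans (hB 1)
    rwa [len_one, Nat.zero_div, pow_zero, mul_one] at this
  refine Summable.of_nonneg_of_le (fun w => tsum_nonneg fun _ => norm_nonneg _) (fun w => ?_)
    ((summable_len F).mul_left B)
  rw [tsum_fintype]
  simp only [norm_mul]
  rw [← Finset.mul_sum]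
  calc _ ≤ ((resCard F : ℝ)⁻¹) ^ len w * (B * (resCard F : ℝ) ^ (len w / 2)) :=
        mul_le_mul (norm_tVal_le F i w) (hB w) (Finset.sum_nonneg fun _ _ => norm_nonneg _)
          (by positivity)
    _ = B * (((resCard F : ℝ)⁻¹) ^ len w * (resCard F : ℝ) ^ (len w / 2)) := by ring
    _ ≤ _ := mul_le_mul_of_nonneg_left (pow_half_div_le F _) hB0

/-- In the pair {w, w s_j} the longer orbit sum is q times the shorter one, so `tVal_add` applies.
Only the pair {1, s_j} survives. -/
theorem tVal_mul_orbSum_add {f : (Fin 2 → F) → ℂ} (hf : ∀ g ∈ iwahori F, InvariantBy f g)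
    {i j : Fin 2} (hj : InvariantBy f (genMatrix hϖ j)) (w : AffWeyl) (x : Fin 2 → F) :
    tVal F i w * orbSum hϖ f w x + tVal F i (w * gen j) * orbSum hϖ f (w * gen j) x =
      if w ∈ ({1, gen j} : Finset AffWeyl) then (if i = j then f x else 0) else 0 := by
  have key : ∀ w, len (w * gen j) = len w + 1 →
      tVal F i w * orbSum hϖ f w x + tVal F i (w * gen j) * orbSum hϖ f (w * gen j) x =
        if w = 1 then (if i = j then f x else 0) else 0 := by
    intro w h
    have h1 := tVal_add F (i := i) h
    rw [orbSum_mul_gen hϖ hf hj h]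
    have h2 : tVal F i w * orbSum hϖ f w x +
        tVal F i (w * gen j) * (resCard F * orbSum hϖ f w x) =
        (tVal F i w + resCard F * tVal F i (w * gen j)) * orbSum hϖ f w x := by ring
    rw [h2, h1]
    by_cases hw : w = 1
    · subst hw
      rw [orbSum_one hϖ hf]
      by_cases hij : i = j <;> simp [hij]
    · simp [hw]
  have hg := gen_ne_one j
  rcases len_mul_gen w j with h | h
  · rw [key w h]
    have h1 : w ≠ gen j := by
      rintro rfl
      rw [gen_mul_gen, len_one] at h; omega
    simp [h1]
  · have h1 : w * gen j * gen j = w := by rw [mul_assoc, gen_mul_gen, mul_one]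
    have h2 := key (w * gen j) (by rw [h1]; exact h)
    rw [h1, add_comm] at h2
    rw [h2]
    have h3 : w ≠ 1 := ne_one_of_len_succ h
    have h4 : w * gen j = 1 ↔ w = gen j := by
      rw [mul_eq_one_iff_eq_inv, gen_inv]
    simp [h3, h4]

/-- Convolution with `t_{s_i}` on functions that are invariant under `I` and `s_j`. -/
theorem hasSum_convolution {f : (Fin 2 → F) → ℂ} (hf : ∀ g ∈ iwahori F, InvariantBy f g)
    (hb : BoundedOnBall ϖ f) {j : Fin 2} (hj : InvariantBy f (genMatrix hϖ j)) (i : Fin 2)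
    {x : Fin 2 → F} (hx : x ≠ 0) :
    HasSum (fun c : SpecialLinearGroup (Fin 2) F ⧸ iwahori F =>
      tFun hϖ i c.out * f ((c.out⁻¹).1 *ᵥ x)) (if i = j then f x else 0) := by
  rw [← (cosetMap_injective hϖ).hasSum_iff]
  · have h1 : (fun c : SpecialLinearGroup (Fin 2) F ⧸ iwahori F =>
        tFun hϖ i c.out * f ((c.out⁻¹).1 *ᵥ x)) ∘ cosetMap hϖ =
        fun p : Σ w : AffWeyl, Quo F (len w) => tVal F i p.1 *
          f (((root ϖ (firstLetter p.1) (lift p.2 : F) * mono hϖ p.1)⁻¹).1 *ᵥ x) := by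
      funext p
      have h2 := (QuotientGroup.out_eq' (cosetMap hϖ p)).symm
      rw [Function.comp_apply, tFun_of_mem hϖ i (mem_cell_of_mk_eq_cosetMap hϖ h2)]
      congr 1
      exact (apply_eq_of_coset_eq hf h2 x).symm
    rw [h1]
    obtain ⟨S, hS⟩ := summable_convolution hϖ hb hx i
    have h2 : HasSum (fun w => tVal F i w * orbSum hϖ f w x) S := by
      refine hS.sigma fun w => ?_
      rw [orbSum, Finset.mul_sum]
      exact hasSum_fintype _
    -- Adding the series to its reindexing by w ↦ w s_j gives twice its sum, with only the terms w =
    -- 1 and w = s_j left, both equal to f x or both zero.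
    have h3 := h2.add ((Equiv.mulRight (gen j)).hasSum_iff.2 h2)
    simp only [Function.comp_apply, Equiv.coe_mulRight, tVal_mul_orbSum_add hϖ hf hj] at h3
    have h4 := hasSum_sum_of_ne_finset_zero (L := .unconditional _)
      (s := ({1, gen j} : Finset AffWeyl))
      (f := fun w => if w ∈ ({1, gen j} : Finset AffWeyl) then (if i = j then f x else 0) else 0)
      (fun w hw => if_neg hw)
    have h5 := h3.unique h4
    rw [Finset.sum_pair (gen_ne_one j).symm] at h5
    simp only [Finset.mem_insert, Finset.mem_singleton, true_or, or_true, if_true] at h5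
    have h6 : S = if i = j then f x else 0 := by linear_combination h5 / 2
    rw [← h6]
    exact hS
  · intro c hc
    rw [tFun_of_forall_not_mem, zero_mul]
    intro w hw
    obtain ⟨a, ha⟩ := exists_cosetMap_eq hϖ hw
    exact hc ⟨_, ha.trans (QuotientGroup.out_eq' c)⟩

end Convolution

theorem indicator_one_eq_of_iff {X : Type*} {s : Set X} {x y : X} (h : x ∈ s ↔ y ∈ s) :
    s.indicator (1 : X → ℂ) x = s.indicator 1 y := by
  classical
  simp only [Set.indicator_apply, h, Pi.one_apply]

section Schwartz

variable {F : Type*} [Field F] [ValuativeRel F] [TopologicalSpace F]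
  [IsNonarchimedeanLocalField F] {ϖ : 𝒪[F]} (hϖ : Irreducible ϖ)

/-! ### Lattices and orbits -/

/-- The lattice `ϖ ^ m 𝒪 × ϖ ^ n 𝒪`. -/
def box (ϖ : 𝒪[F]) (m n : ℤ) : Set (Fin 2 → F) := {x | x 0 ∈ frac ϖ m ∧ x 1 ∈ frac ϖ n}

theorem mem_box {m n : ℤ} {x : Fin 2 → F} :
    x ∈ box ϖ m n ↔ x 0 ∈ frac ϖ m ∧ x 1 ∈ frac ϖ n := Iff.rfl

include hϖ in
theorem isOpen_frac (n : ℤ) : IsOpen (frac ϖ n : Set F) := by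
  refine AddSubgroup.isOpen_of_mem_nhds _ (g := 0) ?_
  refine Filter.mem_of_superset ((IsValuativeTopology.hasBasis_nhds_zero' F).mem_of_mem
    (zpow_ne_zero n (valuation_ne_zero hϖ))) fun x hx => ?_
  exact mem_frac.2 (le_of_lt hx)

theorem isCompact_frac (n : ℤ) : IsCompact (frac ϖ n : Set F) :=
  IsNonarchimedeanLocalField.isCompact_closedBall F _

include hϖ in
theorem isClosed_frac (n : ℤ) : IsClosed (frac ϖ n : Set F) :=
  AddSubgroup.isClosed_of_isOpen _ (isOpen_frac hϖ n)

include hϖ in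
theorem isOpen_box (m n : ℤ) : IsOpen (box ϖ m n) :=
  ((isOpen_frac hϖ m).preimage (continuous_apply 0)).inter
    ((isOpen_frac hϖ n).preimage (continuous_apply 1))

include hϖ in
theorem isClosed_box (m n : ℤ) : IsClosed (box ϖ m n) :=
  ((isClosed_frac hϖ m).preimage (continuous_apply 0)).inter
    ((isClosed_frac hϖ n).preimage (continuous_apply 1))

include hϖ in
theorem isCompact_box (m n : ℤ) : IsCompact (box ϖ m n) := by
  have h := isCompact_univ_pi (s := fun _ : Fin 2 => (frac ϖ (min m n) : Set F))
    fun _ => isCompact_frac _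
  refine h.of_isClosed_subset (isClosed_box hϖ m n) ?_
  intro x hx i _
  fin_cases i
  · exact frac_mono hϖ (min_le_left _ _) hx.1
  · exact frac_mono hϖ (min_le_right _ _) hx.2

include hϖ in
-- Such lattices are clopen and compact, so only stability under U has to be checked.
theorem indicator_box_mem_schwartz (m n : ℤ) {U : Subgroup (SpecialLinearGroup (Fin 2) F)}
    (hU : ∀ g ∈ U, ∀ x ∈ box ϖ m n, g.1 *ᵥ x ∈ box ϖ m n) :
    Set.indicator (box ϖ m n) 1 ∈ schwartz U := by
  refine ⟨?_, ?_, fun g hg x => ?_⟩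
  · have hc : IsClopen (box ϖ m n) := ⟨isClosed_box hϖ m n, isOpen_box hϖ m n⟩
    rw [← LocallyConstant.coe_charFn ℂ hc]
    exact (LocallyConstant.charFn ℂ hc).isLocallyConstant
  · exact HasCompactSupport.intro (isCompact_box hϖ m n) fun x hx => Set.indicator_of_notMem hx 1
  · have h : (g⁻¹).1 *ᵥ x ∈ box ϖ m n ↔ x ∈ box ϖ m n := by
      refine ⟨fun h => ?_, fun h => hU _ (inv_mem hg) x h⟩
      have h2 := hU g hg _ h
      rw [mulVec_mulVec] at h2
      have h3 : g.1 * (g⁻¹).1 = 1 := congrArg Subtype.val (mul_inv_cancel g)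
      rwa [h3, one_mulVec] at h2
    exact indicator_one_eq_of_iff h

theorem zero_mem_box (m n : ℤ) : (0 : Fin 2 → F) ∈ box ϖ m n :=
  ⟨(frac ϖ m).zero_mem, (frac ϖ n).zero_mem⟩

include hϖ in
theorem box_mono {m n m' n' : ℤ} (hm : m' ≤ m) (hn : n' ≤ n) : box ϖ m n ⊆ box ϖ m' n' :=
  fun _ hx => ⟨frac_mono hϖ hm hx.1, frac_mono hϖ hn hx.2⟩

theorem mulVec_apply_two (A : Matrix (Fin 2) (Fin 2) F) (x : Fin 2 → F) (i : Fin 2) :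
    (A *ᵥ x) i = A i 0 * x 0 + A i 1 * x 1 := by
  rw [mulVec, dotProduct, Fin.sum_univ_two]

include hϖ in
theorem maxCompact_mulVec_mem_box {g : SpecialLinearGroup (Fin 2) F} (hg : g ∈ maxCompact F)
    {m : ℤ} {x : Fin 2 → F} (hx : x ∈ box ϖ m m) : g.1 *ᵥ x ∈ box ϖ m m := by
  obtain ⟨k, rfl⟩ := hg
  have h : ∀ i j, ∀ y ∈ frac ϖ m,
      (SpecialLinearGroup.map (algebraMap 𝒪[F] F) k).1 i j * y ∈ frac ϖ m := fun i j y hy =>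
    mul_mem_frac (coe_mem_frac_zero (k.1 i j)) hy hϖ (zero_add m).symm
  rw [mem_box, mulVec_apply_two, mulVec_apply_two]
  exact ⟨add_mem (h _ _ _ hx.1) (h _ _ _ hx.2), add_mem (h _ _ _ hx.1) (h _ _ _ hx.2)⟩

include hϖ in
theorem iwahori_mulVec_mem_box {g : SpecialLinearGroup (Fin 2) F} (hg : g ∈ iwahori F)
    {m : ℤ} {x : Fin 2 → F} (hx : x ∈ box ϖ m (m + 1)) : g.1 *ᵥ x ∈ box ϖ m (m + 1) := by
  obtain ⟨h1, h2, h3, h4⟩ := (mem_iwahori_iff hϖ).1 hg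
  rw [mem_box, mulVec_apply_two, mulVec_apply_two]
  exact ⟨add_mem (mul_mem_frac h1 hx.1 hϖ (by omega))
      (frac_mono hϖ (by omega) (mul_mem_frac h2 hx.2 hϖ rfl)),
    add_mem (mul_mem_frac h3 hx.1 hϖ (by omega)) (mul_mem_frac h4 hx.2 hϖ (by omega))⟩

theorem iwahori_le_maxCompact : iwahori F ≤ maxCompact F := by
  rintro _ ⟨k, _, rfl⟩
  exact ⟨k, rfl⟩

theorem schwartz_maxCompact_le : schwartz (maxCompact F) ≤ schwartz (iwahori F) :=
  fun _ hf => ⟨hf.1, hf.2.1, fun g hg => hf.2.2 g (iwahori_le_maxCompact hg)⟩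

theorem genMatrix_zero_mem_maxCompact : genMatrix hϖ 0 ∈ maxCompact F := by
  refine ⟨⟨!![0, -1; 1, 0], by simp [det_fin_two]⟩, ?_⟩
  ext i j
  rw [genMatrix_zero_val]
  fin_cases i <;> fin_cases j
  · exact map_zero (algebraMap 𝒪[F] F)
  · exact (map_neg (algebraMap 𝒪[F] F) 1).trans (congrArg _ (map_one _))
  · exact map_one (algebraMap 𝒪[F] F)
  · exact map_zero (algebraMap 𝒪[F] F)

include hϖ in
theorem mem_phiOrbit_iff {n : ℤ} {x : Fin 2 → F} : x ∈ phiOrbit ϖ n ↔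
    x 0 ∈ frac ϖ n ∧ valuation F (x 1) = valuation F ϖ ^ n := by
  constructor
  · rintro ⟨a, b, hb, rfl⟩
    refine ⟨(mem_frac_iff_exists hϖ).2 ⟨a, rfl⟩, ?_⟩
    simp [(isUnit_iff_valuation b).1 hb]
  · rintro ⟨h0, h1⟩
    obtain ⟨a, ha⟩ := (mem_frac_iff_exists hϖ).1 h0
    obtain ⟨b, hb⟩ := (mem_frac_iff_exists hϖ).1 (mem_frac.2 h1.le)
    refine ⟨a, b, (isUnit_iff_valuation b).2 ?_, ?_⟩
    · rw [hb, map_mul, map_zpow₀] at h1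
      exact (mul_eq_left₀ (zpow_ne_zero n (valuation_ne_zero hϖ))).1 h1
    · ext i; fin_cases i
      · exact ha
      · exact hb

include hϖ in
theorem mem_psiOrbit_iff {n : ℤ} {x : Fin 2 → F} : x ∈ psiOrbit ϖ n ↔
    valuation F (x 0) = valuation F ϖ ^ n ∧ x 1 ∈ frac ϖ (n + 1) := by
  constructor
  · rintro ⟨a, b, ha, rfl⟩
    refine ⟨?_, (mem_frac_iff_exists hϖ).2 ⟨b, rfl⟩⟩
    simp [(isUnit_iff_valuation a).1 ha]
  · rintro ⟨h0, h1⟩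
    obtain ⟨a, ha⟩ := (mem_frac_iff_exists hϖ).1 (mem_frac.2 h0.le)
    obtain ⟨b, hb⟩ := (mem_frac_iff_exists hϖ).1 h1
    refine ⟨a, b, (isUnit_iff_valuation a).2 ?_, ?_⟩
    · rw [ha, map_mul, map_zpow₀] at h0
      exact (mul_eq_left₀ (zpow_ne_zero n (valuation_ne_zero hϖ))).1 h0
    · ext i; fin_cases i
      · exact ha
      · exact hb

include hϖ in
theorem exists_mem_orbit {x : Fin 2 → F} (hx : x ≠ 0) :
    ∃ n : ℤ, x ∈ phiOrbit ϖ n ∨ x ∈ psiOrbit ϖ n := by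
  simp only [mem_phiOrbit_iff hϖ, mem_psiOrbit_iff hϖ]
  by_cases h1 : x 1 = 0
  · have h0 : x 0 ≠ 0 := fun h0 => hx (by ext i; fin_cases i <;> assumption)
    obtain ⟨n, hn⟩ := exists_valuation_eq hϖ h0
    exact ⟨n, Or.inr ⟨hn, h1 ▸ zero_mem _⟩⟩
  obtain ⟨n, hn⟩ := exists_valuation_eq hϖ h1
  by_cases h0 : x 0 = 0
  · exact ⟨n, Or.inl ⟨h0 ▸ zero_mem _, hn⟩⟩
  obtain ⟨m, hm⟩ := exists_valuation_eq hϖ h0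
  rcases le_or_gt n m with h | h
  · exact ⟨n, Or.inl ⟨frac_mono hϖ h (mem_frac.2 hm.le), hn⟩⟩
  · exact ⟨m, Or.inr ⟨hm, frac_mono hϖ (Int.add_one_le_iff.2 h) (mem_frac.2 hn.le)⟩⟩

include hϖ in
theorem mem_frac_iff_le {x : F} {k n : ℤ} (h : valuation F x = valuation F ϖ ^ k) :
    x ∈ frac ϖ n ↔ n ≤ k := by
  rw [mem_frac, h, valuation_zpow_le_zpow hϖ]

include hϖ in
theorem mem_box_iff_of_mem_phiOrbit {x : Fin 2 → F} {k m n : ℤ} (hx : x ∈ phiOrbit ϖ k)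
    (h : m ≤ n) : x ∈ box ϖ m n ↔ n ≤ k := by
  obtain ⟨h0, h1⟩ := (mem_phiOrbit_iff hϖ).1 hx
  rw [mem_box, mem_frac_iff_le hϖ h1]
  exact ⟨fun h => h.2, fun h' => ⟨frac_mono hϖ (h.trans h') h0, h'⟩⟩

include hϖ in
theorem mem_box_iff_of_mem_psiOrbit {x : Fin 2 → F} {k m n : ℤ} (hx : x ∈ psiOrbit ϖ k)
    (h : n ≤ m + 1) : x ∈ box ϖ m n ↔ m ≤ k := by
  obtain ⟨h0, h1⟩ := (mem_psiOrbit_iff hϖ).1 hx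
  rw [mem_box, mem_frac_iff_le hϖ h0]
  exact ⟨fun h => h.1, fun h' => ⟨h', frac_mono hϖ (by omega) h1⟩⟩

include hϖ in
-- The union of orbits, with the origin added, is the lattice ϖ^m 𝒪², which K preserves. For
-- `psiBar` it is ϖ^m 𝒪 × ϖ^(m+1) 𝒪, which I and s₁ preserve.
theorem phiBar_eq_indicator_box (m : ℤ) : phiBar ϖ m = Set.indicator (box ϖ m m) 1 := by
  rw [phiBar]
  congr 1
  ext x
  simp only [Set.mem_union, Set.mem_singleton_iff, Set.mem_iUnion, exists_prop]
  constructor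
  · rintro (rfl | ⟨k, hk, hx | hx⟩)
    · exact zero_mem_box m m
    · exact (mem_box_iff_of_mem_phiOrbit hϖ hx le_rfl).2 hk
    · exact (mem_box_iff_of_mem_psiOrbit hϖ hx (by omega)).2 hk
  · intro h
    by_cases hx : x = 0
    · exact Or.inl hx
    obtain ⟨k, hk | hk⟩ := exists_mem_orbit hϖ hx
    · exact Or.inr ⟨k, (mem_box_iff_of_mem_phiOrbit hϖ hk le_rfl).1 h, Or.inl hk⟩
    · exact Or.inr ⟨k, (mem_box_iff_of_mem_psiOrbit hϖ hk (by omega)).1 h, Or.inr hk⟩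

include hϖ in
theorem psiBar_eq_indicator_box (m : ℤ) : psiBar ϖ m = Set.indicator (box ϖ m (m + 1)) 1 := by
  rw [psiBar]
  congr 1
  ext x
  simp only [Set.mem_union, Set.mem_singleton_iff, Set.mem_iUnion, exists_prop]
  constructor
  · rintro (rfl | ⟨k, hk, hx | hx⟩)
    · exact zero_mem_box _ _
    · exact (mem_box_iff_of_mem_psiOrbit hϖ hx le_rfl).2 hk
    · exact (mem_box_iff_of_mem_phiOrbit hϖ hx (by omega)).2 (by omega)
  · intro h
    by_cases hx : x = 0
    · exact Or.inl hx
    obtain ⟨k, hk | hk⟩ := exists_mem_orbit hϖ hx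
    · have h1 := (mem_box_iff_of_mem_phiOrbit hϖ hk (by omega)).1 h
      exact Or.inr ⟨k - 1, by omega, Or.inr (by rwa [sub_add_cancel])⟩
    · exact Or.inr ⟨k, (mem_box_iff_of_mem_psiOrbit hϖ hk le_rfl).1 h, Or.inl hk⟩

include hϖ in
theorem phiBar_mem_schwartz_maxCompact (m : ℤ) : phiBar ϖ m ∈ schwartz (maxCompact F) := by
  rw [phiBar_eq_indicator_box hϖ]
  exact indicator_box_mem_schwartz hϖ m m fun _ hg _ => maxCompact_mulVec_mem_box hϖ hg

include hϖ in
theorem phiBar_mem_schwartz (m : ℤ) : phiBar ϖ m ∈ schwartz (iwahori F) :=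
  schwartz_maxCompact_le (phiBar_mem_schwartz_maxCompact hϖ m)

include hϖ in
theorem psiBar_mem_schwartz (m : ℤ) : psiBar ϖ m ∈ schwartz (iwahori F) := by
  rw [psiBar_eq_indicator_box hϖ]
  exact indicator_box_mem_schwartz hϖ m (m + 1) fun _ hg _ => iwahori_mulVec_mem_box hϖ hg

/-- Up to sign, s₁ exchanges the coordinates with factors ϖ^(±1), which is exactly the offset
between the two sides of the lattice. -/
theorem psiBar_invariantBy_genMatrix_one (m : ℤ) :
    InvariantBy (psiBar ϖ m) (genMatrix hϖ 1) := by
  intro x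
  rw [psiBar_eq_indicator_box hϖ]
  have h0 : (((genMatrix hϖ 1)⁻¹).1 *ᵥ x) 0 = (ϖ : F) ^ (-1 : ℤ) * -x 1 := by
    rw [mulVec_apply_two]
    change adjugate (genMatrix hϖ 1).1 0 0 * x 0 + adjugate (genMatrix hϖ 1).1 0 1 * x 1 = _
    rw [genMatrix_one_val, adjugate_fin_two_of]
    simp
  have h1 : (((genMatrix hϖ 1)⁻¹).1 *ᵥ x) 1 = (ϖ : F) ^ (1 : ℤ) * x 0 := by
    rw [mulVec_apply_two]
    change adjugate (genMatrix hϖ 1).1 1 0 * x 0 + adjugate (genMatrix hϖ 1).1 1 1 * x 1 = _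
    rw [genMatrix_one_val, adjugate_fin_two_of]
    simp
  have h : ((genMatrix hϖ 1)⁻¹).1 *ᵥ x ∈ box ϖ m (m + 1) ↔ x ∈ box ϖ m (m + 1) := by
    rw [mem_box, mem_box, h0, h1, zpow_mul_mem_frac hϖ, zpow_mul_mem_frac hϖ, neg_mem_iff,
      sub_neg_eq_add, add_sub_cancel_right, and_comm]
  exact indicator_one_eq_of_iff h

end Schwartz

section Decomposition

variable {F : Type*} [Field F] [ValuativeRel F] [TopologicalSpace F]
  [IsNonarchimedeanLocalField F] {ϖ : 𝒪[F]} (hϖ : Irreducible ϖ)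

/-! ### The decomposition of the space of `I`-invariant functions -/

include hϖ in
theorem exists_mem_box (x : Fin 2 → F) : ∃ n : ℤ, x ∈ box ϖ n n := by
  by_cases hx : x = 0
  · exact ⟨0, hx ▸ zero_mem_box 0 0⟩
  obtain ⟨k, hk | hk⟩ := exists_mem_orbit hϖ hx
  · exact ⟨k, (mem_box_iff_of_mem_phiOrbit hϖ hk le_rfl).2 le_rfl⟩
  · exact ⟨k, (mem_box_iff_of_mem_psiOrbit hϖ hk (by omega)).2 le_rfl⟩

include hϖ in
theorem boundedOnBall_of_mem_schwartz {U : Subgroup (SpecialLinearGroup (Fin 2) F)}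
    {f : (Fin 2 → F) → ℂ} (hf : f ∈ schwartz U) : BoundedOnBall ϖ f := by
  obtain ⟨C, hC⟩ := hf.2.1.exists_bound_of_continuous hf.1.continuous
  -- The boxes are indexed by -n so that they increase with n; compactness then needs only one of
  -- them.
  obtain ⟨m, hm⟩ := hf.2.1.isCompact.elim_directed_cover (fun n : ℤ => box ϖ (-n) (-n))
    (fun n => isOpen_box hϖ _ _)
    (fun x _ => by
      obtain ⟨n, hn⟩ := exists_mem_box hϖ x
      exact Set.mem_iUnion.2 ⟨-n, by rwa [neg_neg]⟩)
    (Monotone.directed_le fun a b hab => box_mono hϖ (neg_le_neg hab) (neg_le_neg hab))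
  exact ⟨C, -m, (norm_nonneg _).trans (hC 0), fun x => ⟨hC x, fun hx =>
    image_eq_zero_of_notMem_tsupport fun h => hx (hm h)⟩⟩

include hϖ in
theorem exists_frac_subset {s : Set F} (hs : IsOpen s) (h0 : (0 : F) ∈ s) :
    ∃ n : ℤ, (frac ϖ n : Set F) ⊆ s := by
  obtain ⟨γ, hγ, h⟩ := (IsValuativeTopology.hasBasis_nhds_zero' F).mem_iff.1 (hs.mem_nhds h0)
  obtain ⟨y, rfl⟩ := valuation_surjective γ
  obtain ⟨n, hn⟩ := exists_valuation_eq hϖ ((Valuation.ne_zero_iff _).1 hγ)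
  refine ⟨n + 1, fun x hx => h ?_⟩
  refine lt_of_le_of_lt (mem_frac.1 hx) (lt_of_not_ge ?_)
  rw [hn, valuation_zpow_le_zpow hϖ]
  omega

include hϖ in
theorem exists_forall_mem_box_eq {f : (Fin 2 → F) → ℂ} (hf : IsLocallyConstant f) :
    ∃ n : ℤ, ∀ x ∈ box ϖ n n, f x = f 0 := by
  obtain ⟨u, hu, hs⟩ := isOpen_pi_iff'.1 (hf.isOpen_fiber (f 0)) 0 rfl
  choose n hn using fun i => exists_frac_subset hϖ (hu i).1 (hu i).2
  refine ⟨max (n 0) (n 1), fun x hx => hs fun i _ => hn i ?_⟩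
  fin_cases i
  · exact frac_mono hϖ (le_max_left _ _) hx.1
  · exact frac_mono hϖ (le_max_right _ _) hx.2

include hϖ in
-- The convolution is only known away from the origin. Local constancy recovers the value there from
-- a nonzero vector in a small lattice.
theorem eq_of_forall_ne_zero {f g : (Fin 2 → F) → ℂ} (hf : IsLocallyConstant f)
    (hg : IsLocallyConstant g) (h : ∀ x, x ≠ 0 → f x = g x) : f = g := by
  funext x
  by_cases hx : x = 0
  · obtain ⟨m, hm⟩ := exists_forall_mem_box_eq hϖ hf
    obtain ⟨n, hn⟩ := exists_forall_mem_box_eq hϖ hg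
    have hy : (![(ϖ : F) ^ max m n, 0] : Fin 2 → F) ∈ box ϖ (max m n) (max m n) :=
      ⟨(zpow_mem_frac hϖ).2 le_rfl, zero_mem _⟩
    rw [hx, ← hm _ (box_mono hϖ (le_max_left m n) (le_max_left m n) hy),
      ← hn _ (box_mono hϖ (le_max_right m n) (le_max_right m n) hy)]
    exact h _ fun h0 => zpow_ne_zero _ (coe_ne_zero hϖ) (congrFun h0 0)
  · exact h x hx

theorem apply_mulVec_of_mem {U : Subgroup (SpecialLinearGroup (Fin 2) F)}
    {f : (Fin 2 → F) → ℂ} (hf : f ∈ schwartz U) {g : SpecialLinearGroup (Fin 2) F} (hg : g ∈ U)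
    (x : Fin 2 → F) : f (g.1 *ᵥ x) = f x := by
  have h := hf.2.2 g⁻¹ (inv_mem hg) x
  rwa [inv_inv] at h

include hϖ in
theorem apply_eq_of_mem_phiOrbit {f : (Fin 2 → F) → ℂ} (hf : f ∈ schwartz (iwahori F)) {n : ℤ}
    {x : Fin 2 → F} (hx : x ∈ phiOrbit ϖ n) : f x = f ![0, (ϖ : F) ^ n] := by
  obtain ⟨a, b, hb, rfl⟩ := hx
  have hb1 := (isUnit_iff_valuation b).1 hb
  have hb0 : (b : F) ≠ 0 := (Valuation.ne_zero_iff _).1 (hb1 ▸ one_ne_zero)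
  -- An upper triangular element of I whose second column is (a, b) carries (0, ϖ^n) to the given
  -- vector; the ψ-orbits use a lower triangular one.
  rw [← apply_mulVec_of_mem hf (g := ⟨!![(b : F)⁻¹, a; 0, b], by simp [det_fin_two, hb0]⟩)
    ((mem_iwahori_iff hϖ).2 ⟨mem_frac_zero.2 (by simp [hb1]), coe_mem_frac_zero a, zero_mem _,
      coe_mem_frac_zero b⟩) ![0, (ϖ : F) ^ n]]
  congr 1
  ext i
  rw [mulVec_apply_two]
  fin_cases i <;> simp [mul_comm]

include hϖ in
theorem apply_eq_of_mem_psiOrbit {f : (Fin 2 → F) → ℂ} (hf : f ∈ schwartz (iwahori F)) {n : ℤ}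
    {x : Fin 2 → F} (hx : x ∈ psiOrbit ϖ n) : f x = f ![(ϖ : F) ^ n, 0] := by
  obtain ⟨a, b, ha, rfl⟩ := hx
  have ha1 := (isUnit_iff_valuation a).1 ha
  have ha0 : (a : F) ≠ 0 := (Valuation.ne_zero_iff _).1 (ha1 ▸ one_ne_zero)
  rw [← apply_mulVec_of_mem hf (g := ⟨!![(a : F), 0; ϖ * b, (a : F)⁻¹], by
      simp [det_fin_two, ha0]⟩)
    ((mem_iwahori_iff hϖ).2 ⟨coe_mem_frac_zero a, zero_mem _,
      (mem_frac_iff_exists hϖ).2 ⟨b, by simp⟩, mem_frac_zero.2 (by simp [ha1])⟩)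
    ![(ϖ : F) ^ n, 0]]
  congr 1
  ext i
  rw [mulVec_apply_two]
  fin_cases i
  · simp [mul_comm]
  · simp [zpow_add_one₀ (coe_ne_zero hϖ)]; ring

/-- The `I`-invariant functions that are moreover invariant under the generator `s₁`. -/
noncomputable def genOneInvariants : Submodule ℂ (schwartz (iwahori F)) where
  carrier := {f | InvariantBy f.1 (genMatrix hϖ 1)}
  zero_mem' := fun _ => rfl
  add_mem' := fun ha hb x => congrArg₂ (· + ·) (ha x) (hb x)
  smul_mem' := fun c _ ha x => congrArg (c * ·) (ha x)

variable (F) in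
/-- The `K`-invariant functions among the `I`-invariant ones. -/
noncomputable def maxCompactInvariants : Submodule ℂ (schwartz (iwahori F)) :=
  (schwartz (maxCompact F)).comap (schwartz (iwahori F)).subtype

/-- `φ̄_m` as an element of the space of `I`-invariant functions. -/
noncomputable def phiBarElt (m : ℤ) : schwartz (iwahori F) := ⟨phiBar ϖ m, phiBar_mem_schwartz hϖ m⟩

/-- `ψ̄_m` as an element of the space of `I`-invariant functions. -/
noncomputable def psiBarElt (m : ℤ) : schwartz (iwahori F) := ⟨psiBar ϖ m, psiBar_mem_schwartz hϖ m⟩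

theorem phiBarElt_mem (m : ℤ) : phiBarElt hϖ m ∈ maxCompactInvariants F :=
  phiBar_mem_schwartz_maxCompact hϖ m

theorem psiBarElt_mem (m : ℤ) : psiBarElt hϖ m ∈ genOneInvariants hϖ :=
  psiBar_invariantBy_genMatrix_one hϖ m

theorem phiBarElt_apply_of_mem {m : ℤ} {x : Fin 2 → F} (hx : x ∈ box ϖ m m) :
    (phiBarElt hϖ m).1 x = 1 := by
  change phiBar ϖ m x = _
  rw [phiBar_eq_indicator_box hϖ, Set.indicator_of_mem hx, Pi.one_apply]

theorem phiBarElt_apply_of_notMem {m : ℤ} {x : Fin 2 → F} (hx : x ∉ box ϖ m m) :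
    (phiBarElt hϖ m).1 x = 0 := by
  change phiBar ϖ m x = _
  rw [phiBar_eq_indicator_box hϖ, Set.indicator_of_notMem hx]

theorem psiBarElt_apply_of_mem {m : ℤ} {x : Fin 2 → F} (hx : x ∈ box ϖ m (m + 1)) :
    (psiBarElt hϖ m).1 x = 1 := by
  change psiBar ϖ m x = _
  rw [psiBar_eq_indicator_box hϖ, Set.indicator_of_mem hx, Pi.one_apply]

theorem psiBarElt_apply_of_notMem {m : ℤ} {x : Fin 2 → F} (hx : x ∉ box ϖ m (m + 1)) :
    (psiBarElt hϖ m).1 x = 0 := by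
  change psiBar ϖ m x = _
  rw [psiBar_eq_indicator_box hϖ, Set.indicator_of_notMem hx]

/-- Induction on the number d of shells between the lattice containing the support and the one on
which f is constant. The outermost shell consists of two I-orbits, with indicators φ̄_n - ψ̄_n and
ψ̄_n - φ̄_{n+1}, so subtracting a combination of these removes it. -/
theorem mem_sup_of_eq_zero_off_box (d : ℕ) : ∀ (n : ℤ) (f : schwartz (iwahori F)),
    (∀ x ∈ box ϖ (n + d) (n + d), f.1 x = f.1 0) → (∀ x ∉ box ϖ n n, f.1 x = 0) →
    f ∈ maxCompactInvariants F ⊔ genOneInvariants hϖ := by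
  induction d with
  | zero =>
    intro n f h1 h2
    have h : f = f.1 0 • phiBarElt hϖ n := by
      refine Subtype.ext (funext fun x => ?_)
      change f.1 x = f.1 0 * (phiBarElt hϖ n).1 x
      by_cases hx : x ∈ box ϖ n n
      · rw [phiBarElt_apply_of_mem hϖ hx, mul_one]
        exact h1 x (by simpa using hx)
      · rw [phiBarElt_apply_of_notMem hϖ hx, mul_zero, h2 x hx]
    rw [h]
    exact Submodule.mem_sup_left (Submodule.smul_mem _ _ (phiBarElt_mem hϖ n))
  | succ d ih =>
    intro n f h1 h2
    have hφ : ∀ m, phiBarElt hϖ m ∈ maxCompactInvariants F ⊔ genOneInvariants hϖ :=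
      fun m => Submodule.mem_sup_left (phiBarElt_mem hϖ m)
    have hψ : ∀ m, psiBarElt hϖ m ∈ maxCompactInvariants F ⊔ genOneInvariants hϖ :=
      fun m => Submodule.mem_sup_right (psiBarElt_mem hϖ m)
    set e := f.1 ![0, (ϖ : F) ^ n] • (phiBarElt hϖ n - psiBarElt hϖ n) +
      f.1 ![(ϖ : F) ^ n, 0] • (psiBarElt hϖ n - phiBarElt hϖ (n + 1)) with he
    have heval : ∀ x, (f - e).1 x = f.1 x -
        (f.1 ![0, (ϖ : F) ^ n] * ((phiBarElt hϖ n).1 x - (psiBarElt hϖ n).1 x) +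
        f.1 ![(ϖ : F) ^ n, 0] * ((psiBarElt hϖ n).1 x - (phiBarElt hϖ (n + 1)).1 x)) :=
      fun _ => rfl
    have hin : ∀ x ∈ box ϖ (n + 1) (n + 1), (f - e).1 x = f.1 x := by
      intro x hx
      rw [heval, phiBarElt_apply_of_mem hϖ hx,
        phiBarElt_apply_of_mem hϖ (box_mono hϖ (by omega) (by omega) hx),
        psiBarElt_apply_of_mem hϖ (box_mono hϖ (by omega) (by omega) hx)]
      ring
    have hmem : e ∈ maxCompactInvariants F ⊔ genOneInvariants hϖ :=
      add_mem (Submodule.smul_mem _ _ (sub_mem (hφ _) (hψ _)))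
        (Submodule.smul_mem _ _ (sub_mem (hψ _) (hφ _)))
    rw [← sub_add_cancel f e]
    refine add_mem (ih (n + 1) (f - e) (fun x hx => ?_) fun x hx => ?_) hmem
    · rw [hin x (box_mono hϖ (by omega) (by omega) hx), hin 0 (zero_mem_box _ _)]
      exact h1 x (by rwa [show n + ((d + 1 : ℕ) : ℤ) = n + 1 + d by push_cast; ring])
    · rw [heval, phiBarElt_apply_of_notMem hϖ hx]
      by_cases hxn : x ∈ box ϖ n n
      · rw [phiBarElt_apply_of_mem hϖ hxn]
        have hx0 : x ≠ 0 := fun h => hx (h ▸ zero_mem_box _ _)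
        obtain ⟨k, hk | hk⟩ := exists_mem_orbit hϖ hx0
        · rw [mem_box_iff_of_mem_phiOrbit hϖ hk le_rfl] at hx hxn
          obtain rfl : k = n := by omega
          rw [psiBarElt_apply_of_notMem hϖ fun h => hx
            ((mem_box_iff_of_mem_phiOrbit hϖ hk (by omega)).1 h), apply_eq_of_mem_phiOrbit hϖ f.2 hk]
          ring
        · rw [mem_box_iff_of_mem_psiOrbit hϖ hk (by omega)] at hx hxn
          obtain rfl : k = n := by omega
          rw [psiBarElt_apply_of_mem hϖ ((mem_box_iff_of_mem_psiOrbit hϖ hk le_rfl).2 le_rfl),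
            apply_eq_of_mem_psiOrbit hϖ f.2 hk]
          ring
      · rw [phiBarElt_apply_of_notMem hϖ hxn, psiBarElt_apply_of_notMem hϖ fun h =>
          hxn (box_mono hϖ le_rfl (by omega) h), h2 x hxn]
        ring

theorem invariantBy_genMatrix_zero {f : schwartz (iwahori F)} (hf : f ∈ maxCompactInvariants F) :
    InvariantBy f.1 (genMatrix hϖ 0) :=
  hf.2.2 _ (genMatrix_zero_mem_maxCompact hϖ)

theorem hasSum_convolution_of_mem {f : schwartz (iwahori F)} {j : Fin 2}
    (hj : InvariantBy f.1 (genMatrix hϖ j)) (i : Fin 2) {x : Fin 2 → F} (hx : x ≠ 0) :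
    HasSum (fun c : SpecialLinearGroup (Fin 2) F ⧸ iwahori F =>
      tFun hϖ i c.out * f.1 ((c.out⁻¹).1 *ᵥ x)) (if i = j then f.1 x else 0) :=
  hasSum_convolution hϖ f.2.2.2 (boundedOnBall_of_mem_schwartz hϖ f.2) hj i hx

/-- A function in both spaces is sent by t_{s_0} to itself and to zero, so it vanishes off the
origin and hence everywhere. For the sum, compact support and constancy near the origin leave
finitely many shells. -/
theorem isCompl_maxCompactInvariants :
    IsCompl (maxCompactInvariants F) (genOneInvariants hϖ) := by
  refine ⟨Submodule.disjoint_def.2 fun f h0 h1 => ?_, codisjoint_iff.2 (top_unique fun f _ => ?_)⟩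
  · refine Subtype.ext (eq_of_forall_ne_zero hϖ f.2.1 (IsLocallyConstant.const 0) fun x hx => ?_)
    exact (hasSum_convolution_of_mem hϖ (invariantBy_genMatrix_zero hϖ h0) 0 hx).unique
      (hasSum_convolution_of_mem hϖ h1 0 hx)
  · obtain ⟨N, hN⟩ := exists_forall_mem_box_eq hϖ f.2.1
    obtain ⟨C, m, -, hm⟩ := boundedOnBall_of_mem_schwartz hϖ f.2
    refine mem_sup_of_eq_zero_off_box hϖ (N - m).toNat m f (fun x hx => hN x ?_)
      fun x hx => (hm x).2 hx
    exact box_mono hϖ (by omega) (by omega) hx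

/-- The action of `t_{s_i}` on the `I`-invariant functions. -/
noncomputable def tAction (i : Fin 2) : Module.End ℂ (schwartz (iwahori F)) :=
  if i = 0 then (maxCompactInvariants F).projection _ (isCompl_maxCompactInvariants hϖ)
  else LinearMap.id - (maxCompactInvariants F).projection _ (isCompl_maxCompactInvariants hϖ)

theorem tAction_one : tAction hϖ 1 = LinearMap.id - tAction hϖ 0 := rfl

theorem tAction_zero_of_mem {f : schwartz (iwahori F)} (hf : f ∈ maxCompactInvariants F) :
    tAction hϖ 0 f = f :=
  Submodule.projection_apply_of_mem_left _ hf

theorem tAction_zero_of_mem_genOneInvariants {f : schwartz (iwahori F)}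
    (hf : f ∈ genOneInvariants hϖ) : tAction hϖ 0 f = 0 :=
  (Submodule.projection_apply_eq_zero_iff _).2 hf

theorem tAction_add {f g : schwartz (iwahori F)} (hf : f ∈ maxCompactInvariants F)
    (hg : g ∈ genOneInvariants hϖ) (i : Fin 2) :
    tAction hϖ i (f + g) = if i = 0 then f else g := by
  have h0 : tAction hϖ 0 (f + g) = f := by
    rw [map_add, tAction_zero_of_mem hϖ hf, tAction_zero_of_mem_genOneInvariants hϖ hg, add_zero]
  fin_cases i
  · exact h0
  · change f + g - tAction hϖ 0 (f + g) = g
    rw [h0, add_sub_cancel_left]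

/-- Convolution is additive in f, so it suffices to know it on the two summands, where it is
multiplication by 1 or 0. -/
theorem isConvolution_tAction (i : Fin 2) (f : schwartz (iwahori F)) :
    IsConvolution (tFun hϖ i) f (tAction hϖ i f) := by
  intro x hx
  have hf : f ∈ maxCompactInvariants F ⊔ genOneInvariants hϖ := by
    rw [(isCompl_maxCompactInvariants hϖ).sup_eq_top]
    exact Submodule.mem_top
  obtain ⟨f0, h0, f1, h1, rfl⟩ := Submodule.mem_sup.1 hf
  have h := (hasSum_convolution_of_mem hϖ (invariantBy_genMatrix_zero hϖ h0) i hx).add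
    (hasSum_convolution_of_mem hϖ h1 i hx)
  rw [tAction_add hϖ h0 h1]
  convert h using 1
  · funext c
    exact mul_add _ _ _
  · fin_cases i <;> simp

end Decomposition

end AffineSL2

/-! ### The theorem -/

open ValuativeRel AffineSL2 in
theorem mainTheorem6 {F : Type*} [Field F] [ValuativeRel F] [TopologicalSpace F]
    [IsNonarchimedeanLocalField F] (ϖ : 𝒪[F]) (hϖ : Irreducible ϖ) :
    ∃ (b : Fin 2 → AffWeyl → LaurentSeries ℤ)
      (t : Fin 2 → Matrix.SpecialLinearGroup (Fin 2) F → ℂ)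
      (E : Fin 2 → Module.End ℂ (schwartz (iwahori F)))
      (hφ : ∀ m, phiBar ϖ m ∈ schwartz (iwahori F))
      (hψ : ∀ m, psiBar ϖ m ∈ schwartz (iwahori F)),
      (∀ i, IsPreimageOfT (gen i) (b i)) ∧
      (∀ i, IsSpecialization hϖ (b i) (t i)) ∧
      (∀ i (f : schwartz (iwahori F)), IsConvolution (t i) f (E i f)) ∧
      (∀ m, E 0 ⟨phiBar ϖ m, hφ m⟩ = ⟨phiBar ϖ m, hφ m⟩) ∧
      (∀ m, E 0 ⟨psiBar ϖ m, hψ m⟩ = 0) ∧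
      LinearMap.IsProj ((schwartz (maxCompact F)).comap (schwartz (iwahori F)).subtype) (E 0) ∧
      (∀ m, E 1 ⟨psiBar ϖ m, hψ m⟩ = ⟨psiBar ϖ m, hψ m⟩) ∧
      (∀ m, E 1 ⟨phiBar ϖ m, hφ m⟩ = 0) ∧
      E 1 = LinearMap.id - E 0 := by
  refine ⟨tCoeff, tFun hϖ, tAction hϖ, phiBar_mem_schwartz hϖ, psiBar_mem_schwartz hϖ,
    isPreimageOfT_tCoeff, isSpecialization_tFun hϖ, isConvolution_tAction hϖ,
    fun m => tAction_zero_of_mem hϖ (phiBarElt_mem hϖ m),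
    fun m => tAction_zero_of_mem_genOneInvariants hϖ (psiBarElt_mem hϖ m),
    ⟨fun f => Submodule.projection_apply_mem (isCompl_maxCompactInvariants hϖ) f,
      fun f hf => tAction_zero_of_mem hϖ hf⟩, fun m => ?_, fun m => ?_, tAction_one hϖ⟩
  · rw [tAction_one]
    exact (congrArg (_ - ·)
      (tAction_zero_of_mem_genOneInvariants hϖ (psiBarElt_mem hϖ m))).trans (sub_zero _)
  · rw [tAction_one]
    exact (congrArg (_ - ·) (tAction_zero_of_mem hϖ (phiBarElt_mem hϖ m))).trans (sub_self _)
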